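/- Let $(X,\chi)$ be a compact Hermitian manifold of complex dimension $n$; in local holomorphic coordinates write $\chi = i\chi_{\bar kj}\,dz^j\wedge d\bar z^k$, and let $\chi^{j\bar k}$ denote the inverse matrix. Let $f:X\to\mathbb R$ be smooth, let $F:(0,\infty)\to\mathbb R$ be smooth with $F'>0$ everywhere, and let $u_0:X\to\mathbb R$ be smooth with $\chi+i\partial\bar\partial u_0>0$. For a real function $u$ on $X$ let $h$ be the endomorphism of $T^{1,0}X$ given by $h^j{}_\ell=\delta^j{}_\ell+\chi^{j\bar k}u_{\bar k\ell}$, where $u_{\bar k\ell}=\partial_\ell\partial_{\bar k}u$. Then there is a constant $C>0$, depending only on $X$, $\chi$, $f$, $F$ and $u_0$, with the following property. Let $0<T\le\infty$ and let $u$ be a smooth function on $X\times[0,T]$ (on $X\times[0,\infty)$ if $T=\infty$) that solves $$\partial_t u = F(e^{-f}\det h),\qquad u(0)=u_0,$$ where it is part of the equation that $\det h>0$, so that the right-hand side is defined. Put $$\varphi = u-\frac1V\int_X u\,\chi^n,\qquad V=\int_X\chi^n,\qquad \inf\varphi=\inf_{X\times[0,T]}\varphi .$$ Then $$\operatorname{Tr}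 h\le C\,e^{C(\varphi-\inf\varphi)}\qquad\text{on } X\times[0,T].$$ Here $\inf\varphi$ is finite if $T<\infty$; if $T=\infty$ and $\inf\varphi=-\infty$, the right-hand side is read as $+\infty$. -/

import Mathlib

open scoped Manifold ContDiff ComplexConjugate ComplexOrder

noncomputable section

namespace HermitianFlow

/-- The complex Euclidean space `ℂⁿ`, the model space of an `n`-dimensional complex manifold. -/
abbrev Cn (n : ℕ) : Type := EuclideanSpace ℂ (Fin n)

section Wirtinger

variable {n : ℕ}

/-- The `j`-th standard basis vector of `ℂⁿ`. -/
def stdVec (j : Fin n) : Cn n := EuclideanSpace.single j (1 : ℂ)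

/-- The Wirtinger derivative `∂w/∂z^j = (∂w/∂x^j - i ∂w/∂y^j) / 2`. -/
def dz (j : Fin n) (w : Cn n → ℂ) (z : Cn n) : ℂ :=
  (1 / 2 : ℂ) * (fderiv ℝ w z (stdVec j) - Complex.I * fderiv ℝ w z (Complex.I • stdVec j))

/-- The Wirtinger derivative `∂w/∂z̄^k = (∂w/∂x^k + i ∂w/∂y^k) / 2`. -/
def dzbar (k : Fin n) (w : Cn n → ℂ) (z : Cn n) : ℂ :=
  (1 / 2 : ℂ) * (fderiv ℝ w z (stdVec k) + Complex.I * fderiv ℝ w z (Complex.I • stdVec k))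

end Wirtinger

/-- A smooth Hermitian metric on the complex manifold `X`: a positive definite Hermitian form on
every (complex) tangent space, conjugate-linear in the first argument, whose coefficients in
every chart are smooth functions. -/
structure HermitianMetric (n : ℕ) (X : Type*) [TopologicalSpace X] [ChartedSpace (Cn n) X] where
  /-- the Hermitian form at a point -/
  form : ∀ x : X, TangentSpace 𝓘(ℂ, Cn n) x →ₗ⋆[ℂ] TangentSpace 𝓘(ℂ, Cn n) x →ₗ[ℂ] ℂ
  conj_symm : ∀ (x : X) (v w : TangentSpace 𝓘(ℂ, Cn n) x), conj (form x v w) = form x w v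
  pos_def : ∀ (x : X) (v : TangentSpace 𝓘(ℂ, Cn n) x), v ≠ 0 → 0 < (form x v v).re
  smooth : ∀ e ∈ atlas (Cn n) X, ∀ k j : Fin n,
    ContDiffOn ℝ ∞ (fun z : Cn n => form (e.symm z)
      (mfderiv 𝓘(ℂ, Cn n) 𝓘(ℂ, Cn n) e.symm z (stdVec k))
      (mfderiv 𝓘(ℂ, Cn n) 𝓘(ℂ, Cn n) e.symm z (stdVec j))) e.target

section Geometry

variable {n : ℕ} {X : Type*} [TopologicalSpace X] [ChartedSpace (Cn n) X]

/-- The coefficient matrix of `χ` in the chart `e`, at the coordinate `z`. The entry in row `k`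
and column `j` is `χ_{k̄j} = χ(∂/∂z^k, ∂/∂z^j)`, so that `χ = i χ_{k̄j} dz^j ∧ dz̄^k`. -/
def metricMatrix (χ : HermitianMetric n X) (e : OpenPartialHomeomorph X (Cn n)) (z : Cn n) :
    Matrix (Fin n) (Fin n) ℂ :=
  Matrix.of fun k j => χ.form (e.symm z)
    (mfderiv 𝓘(ℂ, Cn n) 𝓘(ℂ, Cn n) e.symm z (stdVec k))
    (mfderiv 𝓘(ℂ, Cn n) 𝓘(ℂ, Cn n) e.symm z (stdVec j))

/-- The complex Hessian of `v : X → ℝ` in the chart `e`, at the coordinate `z`. The entry in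
row `k` and column `j` is `v_{k̄j} = ∂_j ∂_{k̄} v`, so that `i∂∂̄v = i v_{k̄j} dz^j ∧ dz̄^k`. -/
def hessianMatrix (v : X → ℝ) (e : OpenPartialHomeomorph X (Cn n)) (z : Cn n) :
    Matrix (Fin n) (Fin n) ℂ :=
  Matrix.of fun k j => dz j (dzbar k (fun y => ((v (e.symm y) : ℝ) : ℂ))) z

/-- The coefficient matrix `g_{k̄j} = χ_{k̄j} + v_{k̄j}` of `χ + i∂∂̄v` at the point `x`, in the
preferred chart at `x`. -/
def gMatrix (χ : HermitianMetric n X) (v : X → ℝ) (x : X) : Matrix (Fin n) (Fin n) ℂ :=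
  metricMatrix χ (chartAt (Cn n) x) (chartAt (Cn n) x x)
    + hessianMatrix v (chartAt (Cn n) x) (chartAt (Cn n) x x)

/-- The condition `χ + i∂∂̄v > 0` on `X`. -/
def IsPositive (χ : HermitianMetric n X) (v : X → ℝ) : Prop :=
  ∀ x : X, (gMatrix χ v x).PosDef

/-- The matrix of the endomorphism `h^j_ℓ = δ^j_ℓ + χ^{jk̄} v_{k̄ℓ}` of `T^{1,0}X` at `x`, in the
preferred chart at `x`. -/
def hMatrix (χ : HermitianMetric n X) (v : X → ℝ) (x : X) : Matrix (Fin n) (Fin n) ℂ :=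
  1 + (metricMatrix χ (chartAt (Cn n) x) (chartAt (Cn n) x x))⁻¹
    * hessianMatrix v (chartAt (Cn n) x) (chartAt (Cn n) x x)

/-- The trace of the endomorphism `h` at `x` (a real number, as `h` is `χ`-self-adjoint). -/
def traceH (χ : HermitianMetric n X) (v : X → ℝ) (x : X) : ℝ := (hMatrix χ v x).trace.re

/-- The determinant of the endomorphism `h` at `x` (a real number, as `h` is
`χ`-self-adjoint). -/
def detH (χ : HermitianMetric n X) (v : X → ℝ) (x : X) : ℝ := (hMatrix χ v x).det.re

/-- The measure on `X` given by the volume form `χⁿ`. In a chart,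
`χⁿ = n! det(χ_{k̄j}) ∏_j (i dz^j ∧ dz̄^j) = n! 2ⁿ det(χ_{k̄j}) dLebesgue`. The measures so
obtained on the domains of the charts agree on overlaps, and their supremum is the measure
on `X` that restricts to each of them. -/
def volumeMeasure [MeasurableSpace X] (χ : HermitianMetric n X) : MeasureTheory.Measure X :=
  ⨆ e ∈ atlas (Cn n) X, MeasureTheory.Measure.map e.symm
    (((MeasureTheory.volume : MeasureTheory.Measure (Cn n)).restrict e.target).withDensity
      fun z => ENNReal.ofReal
        ((Nat.factorial n : ℝ) * 2 ^ n * (metricMatrix χ e z).det.re))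

/-- The normalization `v - (1/V) ∫_X v χⁿ`, with `V = ∫_X χⁿ`. -/
def normalized [MeasurableSpace X] (χ : HermitianMetric n X) (v : X → ℝ) (x : X) : ℝ :=
  v x - (1 / (volumeMeasure χ).real Set.univ) * ∫ y, v y ∂(volumeMeasure χ)

/-- The time interval `[0, T]`, read as `[0, ∞)` if `T = ∞`. -/
def timeInterval (T : EReal) : Set ℝ := {t : ℝ | 0 ≤ t ∧ (t : EReal) ≤ T}

/-- `u` is a smooth solution on `X × [0, T]` of `∂_t u = F(e^{-f} det h)` with `u(0) = u₀`, for
a function `F` on `(0, ∞)`; the equation includes that `e^{-f} det h` lies in `(0, ∞)`, i.e.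
`det h > 0`. The time derivative is one-sided at the ends of the interval. -/
structure IsSolution (χ : HermitianMetric n X) (f : X → ℝ) (F : ℝ → ℝ) (u₀ : X → ℝ)
    (T : EReal) (u : ℝ → X → ℝ) : Prop where
  smooth : ContMDiffOn (𝓘(ℝ, ℝ).prod 𝓘(ℝ, Cn n)) 𝓘(ℝ, ℝ) ∞ (fun p : ℝ × X => u p.1 p.2)
    (timeInterval T ×ˢ Set.univ)
  det_pos : ∀ t ∈ timeInterval T, ∀ x, 0 < detH χ (u t) x
  flow : ∀ t ∈ timeInterval T, ∀ x,
    HasDerivWithinAt (fun s => u s x) (F (Real.exp (-f x) * detH χ (u t) x)) (timeInterval T) t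
  initial : ∀ x, u 0 x = u₀ x

/-- The set of values on `X × [0, T]` of `φ = u - (1/V) ∫_X u χⁿ`. -/
def normalizedValues [MeasurableSpace X] (χ : HermitianMetric n X) (T : EReal)
    (u : ℝ → X → ℝ) : Set ℝ :=
  {r : ℝ | ∃ t ∈ timeInterval T, ∃ x : X, r = normalized χ (u t) x}

end Geometry

end HermitianFlow

end

/-! The proof applies the maximum principle to G = log Tr h + P(φ) + (B/2) (∂_t u)², where P(y) = -A
(y - m) + 1/(y - m + 1) and m = inf φ.

Write V = ∂_t u, e = e^{-f} det h and β = F'(e) e. Differentiating the equation in time gives the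
linear parabolic equation V_t = β g^{jk̄} V_{k̄j}, so V keeps its initial bounds (`speed_le`). As F
is strictly increasing, e stays in its initial range as well (`arg_mem_Icc`). On that compact
subinterval of (0,∞) the quantities |F|, 1/β and Ψ = (F'' + F'/e)/F'² are bounded independently of
T, and det h is bounded above.

At a maximum of G at positive time, choose a constant frame in which χ is the identity and g is
diagonal with eigenvalues l_j. Two spatial derivatives of the equation produce Ψ|∂V|², a negative
third order term, fourth derivatives of u, and bounded terms. No concavity of F is available, so
Ψ|∂V|² has no sign; it is absorbed by B|∂V|² from the last term of G. Fourth derivatives of u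
commute and cancel up to derivatives of χ. Since χ need not be Kähler, the third order terms control
|∂ Tr h|²/Tr h only up to torsion (`third_order_bound`). The resulting cross term is rewritten with
∂G = 0 and absorbed by P''|∂u|² = 2|∂u|²/r³, with r = φ - m + 1, as long as (A+1)² r³ ≤ (Tr h)²
(`cross_term_bound`). A large A then makes -P' Σ 1/l_j dominate, which bounds Σ 1/l_j
(`inverse_trace_bound`). With the bound on det h this bounds Tr h (`sum_le_of_sum_inv_le`). Where
(A+1)² r³ ≤ (Tr h)² fails, log Tr h is at most a constant plus φ - m, which is enough because A ≥ 1.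
In every case G is bounded above, and solving for Tr h gives the theorem (`exists_trace_bound`).

Three supporting points. Positivity of g persists because det h never vanishes (`posDef_of_path`).
Uniform constants come from compactness (`exists_geometryBound`) and are transported to the
diagonalizing frame in `exists_localModel`. The spatial average enters only through a Lipschitz
bound for φ in time, so it is never differentiated. -/

noncomputable section

set_option linter.unusedSectionVars false

namespace HermitianFlow

/-! ### Calculus of derivatives in constant complexified directions. -/

section Calculus

variable {E : Type*} [NormedAddCommGroup E] [NormedSpace ℝ E]

/-- The derivative of `w` at `p` in the complexified direction `ξ.1 + i ξ.2`. -/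
def cdir (ξ : E × E) (w : E → ℂ) (p : E) : ℂ :=
  fderiv ℝ w p ξ.1 + Complex.I * fderiv ℝ w p ξ.2

/-- The complex conjugate of a complexified direction. -/
def cbar (ξ : E × E) : E × E := (ξ.1, -ξ.2)

variable {ξ η : E × E} {w w' : E → ℂ} {p : E} {O : Set E}

lemma cdir_congr (h : w =ᶠ[nhds p] w') : cdir ξ w p = cdir ξ w' p := by
  simp [cdir, h.fderiv_eq]

lemma cdir_congrOn (hO : IsOpen O) (h : Set.EqOn w w' O) (hp : p ∈ O) :
    cdir ξ w p = cdir ξ w' p :=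
  cdir_congr (h.eventuallyEq_of_mem (hO.mem_nhds hp))

@[simp] lemma cdir_const (c : ℂ) : cdir ξ (fun _ => c) p = 0 := by
  simp [cdir]

lemma cdir_add (h : DifferentiableAt ℝ w p) (h' : DifferentiableAt ℝ w' p) :
    cdir ξ (fun q => w q + w' q) p = cdir ξ w p + cdir ξ w' p := by
  simp only [cdir, fderiv_fun_add h h', add_apply]; ring

lemma cdir_mul (h : DifferentiableAt ℝ w p) (h' : DifferentiableAt ℝ w' p) :
    cdir ξ (fun q => w q * w' q) p = cdir ξ w p * w' p + w p * cdir ξ w' p := by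
  simp only [cdir, fderiv_fun_mul h h', add_apply,
    smul_apply, smul_eq_mul]; ring

lemma cdir_const_mul (c : ℂ) (h : DifferentiableAt ℝ w p) :
    cdir ξ (fun q => c * w q) p = c * cdir ξ w p := by
  rw [cdir_mul (differentiableAt_const c) h]; simp

lemma cdir_sum {ι : Type*} (s : Finset ι) {W : ι → E → ℂ}
    (h : ∀ i ∈ s, DifferentiableAt ℝ (W i) p) :
    cdir ξ (fun q => ∑ i ∈ s, W i q) p = ∑ i ∈ s, cdir ξ (W i) p := by
  simp only [cdir, fderiv_fun_sum h, sum_apply, Finset.mul_sum,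
    Finset.sum_add_distrib]

lemma cdir_conj :
    cdir ξ (fun q => conj (w q)) p = conj (cdir (cbar ξ) w p) := by
  have : fderiv ℝ (fun q => conj (w q)) p =
      (Complex.conjCLE : ℂ →L[ℝ] ℂ).comp (fderiv ℝ w p) :=
    Complex.conjCLE.comp_fderiv (f := w) (x := p)
  simp [cdir, this, cbar]

@[simp] lemma cbar_cbar : cbar (cbar ξ) = ξ := by simp [cbar]

lemma contDiffOn_cdir (hO : IsOpen O) (h : ContDiffOn ℝ ∞ w O) :
    ContDiffOn ℝ ∞ (cdir ξ w) O := by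
  have h1 : ContDiffOn ℝ ∞ (fderiv ℝ w) O := h.fderiv_of_isOpen hO (by simp)
  exact (h1.clm_apply contDiffOn_const).add
    (contDiffOn_const.mul (h1.clm_apply contDiffOn_const))

lemma differentiableAt_of_contDiffOn {F : Type*} [NormedAddCommGroup F] [NormedSpace ℝ F]
    {w : E → F} (hO : IsOpen O) (h : ContDiffOn ℝ ∞ w O)
    (hp : p ∈ O) : DifferentiableAt ℝ w p :=
  (h.contDiffAt (hO.mem_nhds hp)).differentiableAt (by simp)

lemma fderiv_fderiv_apply (hO : IsOpen O) (h : ContDiffOn ℝ ∞ w O) (hp : p ∈ O) (a b : E) :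
    fderiv ℝ (fun q => fderiv ℝ w q a) p b = fderiv ℝ (fderiv ℝ w) p b a := by
  have h1 : DifferentiableAt ℝ (fderiv ℝ w) p :=
    differentiableAt_of_contDiffOn hO (h.fderiv_of_isOpen hO (by simp)) hp
  rw [fderiv_clm_apply h1 (differentiableAt_const a)]
  simp

lemma fderiv_fderiv_symm (hO : IsOpen O) (h : ContDiffOn ℝ ∞ w O) (hp : p ∈ O) (a b : E) :
    fderiv ℝ (fderiv ℝ w) p b a = fderiv ℝ (fderiv ℝ w) p a b := by
  have h2 : IsSymmSndFDerivAt ℝ w p :=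
    (h.contDiffAt (hO.mem_nhds hp)).isSymmSndFDerivAt (by
      rw [minSmoothness_of_isRCLikeNormedField]
      exact WithTop.coe_le_coe.2 le_top)
  exact h2 b a

lemma cdir_cdir (hO : IsOpen O) (h : ContDiffOn ℝ ∞ w O) (hp : p ∈ O) :
    cdir ξ (cdir η w) p = fderiv ℝ (fderiv ℝ w) p ξ.1 η.1
      + Complex.I * fderiv ℝ (fderiv ℝ w) p ξ.1 η.2
      + Complex.I * fderiv ℝ (fderiv ℝ w) p ξ.2 η.1
      - fderiv ℝ (fderiv ℝ w) p ξ.2 η.2 := by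
  have h1 : ContDiffOn ℝ ∞ (fderiv ℝ w) O := h.fderiv_of_isOpen hO (by simp)
  have ha : ∀ a : E, DifferentiableAt ℝ (fun q => fderiv ℝ w q a) p := fun a =>
    differentiableAt_of_contDiffOn hO (h1.clm_apply contDiffOn_const) hp
  have e : cdir η w = fun q => fderiv ℝ w q η.1 + Complex.I * fderiv ℝ w q η.2 := rfl
  rw [e, cdir_add (ha _) ((ha _).const_mul _), cdir_const_mul _ (ha _)]
  simp only [cdir, fderiv_fderiv_apply hO h hp]
  linear_combination (fderiv ℝ (fderiv ℝ w) p ξ.2 η.2) * Complex.I_sq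

/-- The directions are constant vectors, so symmetry of the real second derivative extends
bilinearly. All later commutations of third and fourth derivatives, and of time with space
derivatives, reduce to this. -/
lemma cdir_comm (hO : IsOpen O) (h : ContDiffOn ℝ ∞ w O) (hp : p ∈ O) :
    cdir ξ (cdir η w) p = cdir η (cdir ξ w) p := by
  rw [cdir_cdir hO h hp, cdir_cdir hO h hp, fderiv_fderiv_symm hO h hp η.1 ξ.1,
    fderiv_fderiv_symm hO h hp η.1 ξ.2, fderiv_fderiv_symm hO h hp η.2 ξ.1,
    fderiv_fderiv_symm hO h hp η.2 ξ.2]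
  ring

/-- The chain rule for a real function of a real function. -/
lemma cdir_comp_real {H : ℝ → ℝ} {r : E → ℝ} (hr : DifferentiableAt ℝ r p)
    (hH : DifferentiableAt ℝ H (r p)) :
    cdir ξ (fun q => ((H (r q) : ℝ) : ℂ)) p
      = (deriv H (r p) : ℝ) * cdir ξ (fun q => ((r q : ℝ) : ℂ)) p := by
  have h1 : HasFDerivAt (fun q => ((r q : ℝ) : ℂ)) (Complex.ofRealCLM.comp (fderiv ℝ r p)) p :=
    Complex.ofRealCLM.hasFDerivAt.comp p hr.hasFDerivAt
  have h2 : HasFDerivAt (fun q => ((H (r q) : ℝ) : ℂ))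
      (Complex.ofRealCLM.comp (deriv H (r p) • fderiv ℝ r p)) p :=
    Complex.ofRealCLM.hasFDerivAt.comp p (hH.hasDerivAt.comp_hasFDerivAt p hr.hasFDerivAt)
  simp only [cdir, h1.fderiv, h2.fderiv]
  simp
  ring

lemma cdir_cdir_comp_real (hO : IsOpen O) {H : ℝ → ℝ} {r : E → ℝ} {V : Set ℝ} (hV : IsOpen V)
    (hr : ContDiffOn ℝ ∞ r O) (hH : ContDiffOn ℝ ∞ H V) (hm : Set.MapsTo r O V) (hp : p ∈ O) :
    cdir ξ (cdir η (fun q => ((H (r q) : ℝ) : ℂ))) p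
      = (deriv (deriv H) (r p) : ℝ) * cdir ξ (fun q => ((r q : ℝ) : ℂ)) p
          * cdir η (fun q => ((r q : ℝ) : ℂ)) p
        + (deriv H (r p) : ℝ) * cdir ξ (cdir η (fun q => ((r q : ℝ) : ℂ))) p := by
  have hdH : ContDiffOn ℝ ∞ (deriv H) V := hH.deriv_of_isOpen hV (by simp)
  have e : Set.EqOn (cdir η (fun q => ((H (r q) : ℝ) : ℂ)))
      (fun q => ((deriv H (r q) : ℝ) : ℂ) * cdir η (fun q => ((r q : ℝ) : ℂ)) q) O := fun q hq =>
    cdir_comp_real (differentiableAt_of_contDiffOn hO hr hq)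
      (differentiableAt_of_contDiffOn hV hH (hm hq))
  have hrc : ContDiffOn ℝ ∞ (fun q => ((r q : ℝ) : ℂ)) O :=
    Complex.ofRealCLM.contDiff.comp_contDiffOn hr
  have hdc : ContDiffOn ℝ ∞ (fun q => ((deriv H (r q) : ℝ) : ℂ)) O :=
    Complex.ofRealCLM.contDiff.comp_contDiffOn (hdH.comp hr hm)
  rw [cdir_congrOn hO e hp, cdir_mul (differentiableAt_of_contDiffOn hO hdc hp)
    (differentiableAt_of_contDiffOn hO (contDiffOn_cdir hO hrc) hp),
    cdir_comp_real (differentiableAt_of_contDiffOn hO hr hp)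
      (differentiableAt_of_contDiffOn hV hdH (hm hp))]

lemma cdir_cbar_real {r : E → ℝ} :
    cdir (cbar ξ) (fun q => ((r q : ℝ) : ℂ)) p = conj (cdir ξ (fun q => ((r q : ℝ) : ℂ)) p) := by
  have := cdir_conj (ξ := cbar ξ) (w := fun q => ((r q : ℝ) : ℂ)) (p := p)
  simpa using this

end Calculus

/-! ### Derivatives of matrix-valued functions and Jacobi's formula. -/

section MatrixCalculus

variable {E : Type*} [NormedAddCommGroup E] [NormedSpace ℝ E]
variable {m : Type*} [Fintype m] [DecidableEq m]
variable {ξ η : E × E} {p : E} {O : Set E}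

/-- The entrywise derivative of a matrix valued function in a complexified direction. -/
def mdir (ξ : E × E) (M : E → Matrix m m ℂ) (p : E) : Matrix m m ℂ :=
  Matrix.of fun i j => cdir ξ (fun q => M q i j) p

/-- Entrywise smoothness of a matrix valued function. -/
def MSmoothOn (M : E → Matrix m m ℂ) (O : Set E) : Prop :=
  ∀ i j, ContDiffOn ℝ ∞ (fun q => M q i j) O

variable {M N : E → Matrix m m ℂ}

lemma MSmoothOn.diff (h : MSmoothOn M O) (hO : IsOpen O) (hp : p ∈ O) (i j : m) :
    DifferentiableAt ℝ (fun q => M q i j) p :=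
  differentiableAt_of_contDiffOn hO (h i j) hp

lemma MSmoothOn.mdir (h : MSmoothOn M O) (hO : IsOpen O) :
    MSmoothOn (mdir ξ M) O := fun i j => contDiffOn_cdir hO (h i j)

lemma MSmoothOn.mul (h : MSmoothOn M O) (h' : MSmoothOn N O) :
    MSmoothOn (fun q => M q * N q) O := fun i j => by
  simp only [Matrix.mul_apply]
  exact ContDiffOn.sum fun k _ => (h i k).mul (h' k j)

lemma MSmoothOn.trace (h : MSmoothOn M O) : ContDiffOn ℝ ∞ (fun q => (M q).trace) O := by
  simp only [Matrix.trace, Matrix.diag]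
  exact ContDiffOn.sum fun k _ => h k k

lemma MSmoothOn.det (h : MSmoothOn M O) : ContDiffOn ℝ ∞ (fun q => (M q).det) O := by
  simp only [Matrix.det_apply]
  refine ContDiffOn.sum fun σ _ => ContDiffOn.const_smul _ ?_
  exact contDiffOn_prod fun i _ => h _ _

lemma mdir_mul (hO : IsOpen O) (h : MSmoothOn M O) (h' : MSmoothOn N O) (hp : p ∈ O) :
    mdir ξ (fun q => M q * N q) p = mdir ξ M p * N p + M p * mdir ξ N p := by
  ext i j
  simp only [mdir, Matrix.of_apply, Matrix.add_apply, Matrix.mul_apply]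
  rw [cdir_sum (W := fun k q => M q i k * N q k j) _
    fun k _ => (h.diff hO hp i k).mul (h'.diff hO hp k j), ← Finset.sum_add_distrib]
  exact Finset.sum_congr rfl fun k _ => cdir_mul (h.diff hO hp i k) (h'.diff hO hp k j)

lemma cdir_trace (hO : IsOpen O) (h : MSmoothOn M O) (hp : p ∈ O) :
    cdir ξ (fun q => (M q).trace) p = (mdir ξ M p).trace := by
  simp only [Matrix.trace, Matrix.diag, mdir, Matrix.of_apply]
  exact cdir_sum _ fun k _ => h.diff hO hp k k

lemma cdir_prod {ι : Type*} [DecidableEq ι] (s : Finset ι) {W : ι → E → ℂ}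
    (h : ∀ i ∈ s, DifferentiableAt ℝ (W i) p) :
    cdir ξ (fun q => ∏ i ∈ s, W i q) p
      = ∑ i ∈ s, (∏ j ∈ s.erase i, W j p) * cdir ξ (W i) p := by
  have h1 : HasFDerivAt (fun q => ∏ i ∈ s, W i q) _ p :=
    HasFDerivAt.finsetProd fun i hi => (h i hi).hasFDerivAt
  simp only [cdir, h1.fderiv, sum_apply, smul_apply,
    smul_eq_mul, Finset.mul_sum, ← Finset.sum_add_distrib]
  exact Finset.sum_congr rfl fun i _ => by ring

lemma sum_det_updateCol (A H : Matrix m m ℂ) :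
    ∑ i, (A.updateCol i (fun k => H k i)).det = (A.adjugate * H).trace := by
  simp only [← Matrix.cramer_apply, Matrix.cramer_eq_adjugate_mulVec, Matrix.trace, Matrix.diag,
    Matrix.mul_apply, Matrix.mulVec, dotProduct]

/-- Jacobi's formula. -/
lemma cdir_det (hO : IsOpen O) (h : MSmoothOn M O) (hp : p ∈ O) :
    cdir ξ (fun q => (M q).det) p = ((M p).adjugate * mdir ξ M p).trace := by
  rw [← sum_det_updateCol]
  simp only [Matrix.det_apply]
  have hd : ∀ σ : Equiv.Perm m, ∀ i ∈ Finset.univ,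
      DifferentiableAt ℝ (fun q => M q (σ i) i) p := fun σ i _ => h.diff hO hp _ _
  have hs : ∀ σ : Equiv.Perm m, (fun q => Equiv.Perm.sign σ • ∏ i, M q (σ i) i)
      = fun q => ((Equiv.Perm.sign σ : ℤ) : ℂ) * ∏ i, M q (σ i) i := by
    intro σ; ext q; simp [Units.smul_def]
  have hd' : ∀ σ : Equiv.Perm m, DifferentiableAt ℝ (fun q => ∏ i, M q (σ i) i) p := fun σ =>
    (HasFDerivAt.finsetProd fun i hi => (hd σ i hi).hasFDerivAt).differentiableAt
  rw [cdir_sum, Finset.sum_comm]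
  · refine Finset.sum_congr rfl fun σ _ => ?_
    rw [hs σ, cdir_const_mul _ (hd' σ), cdir_prod _ (hd σ), Finset.mul_sum]
    refine Finset.sum_congr rfl fun i _ => ?_
    rw [Units.smul_def, zsmul_eq_mul, ← Finset.mul_prod_erase _ _ (Finset.mem_univ i)]
    simp only [Matrix.updateCol_self]
    have : ∏ j ∈ Finset.univ.erase i, M p (σ j) j =
        ∏ j ∈ Finset.univ.erase i, (M p).updateCol i (fun k => mdir ξ M p k i) (σ j) j := by
      refine Finset.prod_congr rfl fun j hj => ?_
      rw [Matrix.updateCol_ne (Finset.ne_of_mem_erase hj)]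
    rw [this]
    simp only [mdir, Matrix.of_apply]
    ring
  · intro σ _
    rw [hs σ]
    exact (hd' σ).const_mul _

end MatrixCalculus

/-! ### The pointwise inequalities at a maximum point. -/

section Algebra

variable {n : ℕ}

lemma norm_sq_sum_le (l : Fin n → ℝ) (hl : ∀ j, 0 < l j) (x : Fin n → ℂ) :
    ‖∑ j, x j‖ ^ 2 ≤ (∑ j, l j) * ∑ j, ‖x j‖ ^ 2 / l j := by
  have h1 : ‖∑ j, x j‖ ^ 2 ≤ (∑ j, ‖x j‖) ^ 2 := by
    gcongr; exact norm_sum_le _ _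
  refine h1.trans (Finset.sum_sq_le_sum_mul_sum_of_sq_le_mul _ (fun j _ => (hl j).le)
    (fun j _ => div_nonneg (sq_nonneg _) (hl j).le) fun j _ => ?_)
  rw [mul_div_cancel₀ _ (hl j).ne']

/-- Used with d a first derivative of g, a one of χ, and s, t eigenvalues: the mixed term from
differentiating χ⁻¹ is absorbed into the third order term at the cost of s‖a‖²/t, which involves
only χ and the eigenvalues. -/
lemma complete_square (a d : ℂ) {s t : ℝ} (hs : 0 < s) (ht : 0 < t) :
    -(‖d‖ ^ 2 / (s * t)) + 2 * (a * conj d).re / t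
      = -(‖d - s * a‖ ^ 2 / (s * t)) + s * ‖a‖ ^ 2 / t := by
  rw [← Complex.normSq_eq_norm_sq, ← Complex.normSq_eq_norm_sq, ← Complex.normSq_eq_norm_sq]
  simp only [Complex.normSq_apply, Complex.mul_re, Complex.conj_re, Complex.conj_im,
    Complex.sub_re, Complex.sub_im, Complex.mul_im, Complex.ofReal_re, Complex.ofReal_im]
  field_simp
  ring

/-- Each eigenvalue is at most the trace. This trades a gradient norm measured by χ, divided by Tr
h, for the norm measured by g. -/
lemma div_le_trace_mul (l : Fin n → ℝ) (hl : ∀ j, 0 < l j) (c : Fin n → ℝ)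
    (hc : ∀ j, 0 ≤ c j) : ∑ j, c j ≤ (∑ j, l j) * ∑ j, c j / l j := by
  rw [Finset.mul_sum]
  refine Finset.sum_le_sum fun j _ => ?_
  have h : l j ≤ ∑ i, l i := Finset.single_le_sum (fun i _ => (hl i).le) (Finset.mem_univ j)
  calc c j = l j * (c j / l j) := by rw [mul_div_cancel₀ _ (hl j).ne']
    _ ≤ _ := by gcongr; exact div_nonneg (hc j) (hl j).le

/-- The combined third order terms: after completing the square, Cauchy-Schwarz leaves only the
torsion. -/
lemma third_order_bound (l : Fin n → ℝ) (hl : ∀ j, 0 < l j)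
    (a D : Fin n → Fin n → Fin n → ℂ)
    (hT : ∀ p j k, D p j k - D k j p = a p j k - a k j p) {C : ℝ} (hC : 0 ≤ C)
    (ha : ∀ p j k, ‖a p j k‖ ≤ C) (Sp : Fin n → ℂ)
    (hSp : ∀ p, Sp p = ∑ j, D p j j - ∑ j, a p j j * l j) :
    ∃ T : Fin n → ℂ, (∀ p, ‖T p‖ ≤ 2 * n * C) ∧
    -(∑ j, ∑ p, ∑ r, ‖D j p r‖ ^ 2 / (l p * l r))
        + 2 * ∑ p, (∑ j, ∑ k, (a p j k * conj (D p j k)).re) / l p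
      ≤ -((∑ p, ‖Sp p - T p‖ ^ 2 / l p) / ∑ j, l j)
        + (n * C ^ 2 * (∑ j, l j) + 4 * n ^ 2 * C ^ 2) * ∑ p, 1 / l p := by
  -- The correction is the trace of the torsion, which vanishes in the Kähler case.
  refine ⟨fun p => ∑ j, (a p j j - a j j p), fun p => ?_, ?_⟩
  · refine (norm_sum_le _ _).trans ((Finset.sum_le_sum (g := fun _ => 2 * C) fun j _ => ?_).trans ?_)
    · exact (norm_sub_le _ _).trans (by linarith [ha p j j, ha j j p])
    · simp; linarith
  set S := ∑ j, l j
  have hS : 0 ≤ S := Finset.sum_nonneg fun j _ => (hl j).le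
  have e1 : ∑ j, ∑ p, ∑ r, ‖D j p r‖ ^ 2 / (l p * l r)
      = ∑ p, ∑ j, ∑ k, ‖D k j p‖ ^ 2 / (l j * l p) := by
    calc _ = ∑ j, ∑ r, ∑ p, ‖D j p r‖ ^ 2 / (l p * l r) :=
          Finset.sum_congr rfl fun _ _ => Finset.sum_comm
      _ = ∑ r, ∑ j, ∑ p, ‖D j p r‖ ^ 2 / (l p * l r) := Finset.sum_comm
      _ = _ := Finset.sum_congr rfl fun _ _ => Finset.sum_comm
  -- The square is completed against D k j p rather than D p j k, with the torsion relation paying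
  -- for the swap. The weight is then l j * l p, so the entries with k = j can be summed over j by
  -- Cauchy-Schwarz for each fixed p.
  have e2 : -(∑ j, ∑ p, ∑ r, ‖D j p r‖ ^ 2 / (l p * l r))
        + 2 * ∑ p, (∑ j, ∑ k, (a p j k * conj (D p j k)).re) / l p
      = ∑ p, ∑ j, ∑ k, (-(‖D k j p - l j * a p j k‖ ^ 2 / (l j * l p))
          + l j * ‖a p j k‖ ^ 2 / l p + 2 * (a p j k * conj (a p j k - a k j p)).re / l p) := by
    rw [e1, Finset.mul_sum, ← Finset.sum_neg_distrib, ← Finset.sum_add_distrib]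
    refine Finset.sum_congr rfl fun p _ => ?_
    rw [Finset.sum_div, Finset.mul_sum, ← Finset.sum_neg_distrib, ← Finset.sum_add_distrib]
    refine Finset.sum_congr rfl fun j _ => ?_
    rw [Finset.sum_div, Finset.mul_sum, ← Finset.sum_neg_distrib, ← Finset.sum_add_distrib]
    refine Finset.sum_congr rfl fun k _ => ?_
    rw [← complete_square _ _ (hl j) (hl p), ← hT p j k]
    simp only [map_sub, mul_sub, Complex.sub_re]
    ring
  have b1 : ∀ p j k, 2 * (a p j k * conj (a p j k - a k j p)).re / l p ≤ 4 * C ^ 2 * (1 / l p) := by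
    intro p j k
    have h1 : (a p j k * conj (a p j k - a k j p)).re ≤ C * (2 * C) := by
      refine (Complex.re_le_norm _).trans ?_
      rw [norm_mul, RCLike.norm_conj]
      exact mul_le_mul (ha _ _ _) ((norm_sub_le _ _).trans (by linarith [ha p j k, ha k j p]))
        (norm_nonneg _) hC
    rw [mul_one_div]
    exact div_le_div_of_nonneg_right (by linarith) (hl p).le
  have b2 : ∀ p j k, l j * ‖a p j k‖ ^ 2 / l p ≤ C ^ 2 * l j * (1 / l p) := by
    intro p j k
    rw [mul_one_div]
    have := hl p
    have := hl j
    have := ha p j k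
    rw [mul_comm (C ^ 2)]
    gcongr
  -- Only the entries with k = j are kept; by the torsion relation they add up to Sp p minus the
  -- torsion trace.
  have b3 : ∀ p, -(∑ j, ∑ k, ‖D k j p - l j * a p j k‖ ^ 2 / (l j * l p))
      ≤ -(‖Sp p - ∑ j, (a p j j - a j j p)‖ ^ 2 / l p / S) := by
    intro p
    rw [neg_le_neg_iff]
    have h1 : Sp p - ∑ j, (a p j j - a j j p) = ∑ j, (D j j p - l j * a p j j) := by
      rw [hSp, ← Finset.sum_sub_distrib, ← Finset.sum_sub_distrib]
      exact Finset.sum_congr rfl fun j _ => by rw [← hT p j j]; ring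
    have h2 := norm_sq_sum_le l hl fun j => D j j p - l j * a p j j
    rw [h1]
    have h3 : ∑ j, ‖D j j p - l j * a p j j‖ ^ 2 / (l j * l p)
        ≤ ∑ j, ∑ k, ‖D k j p - l j * a p j k‖ ^ 2 / (l j * l p) := by
      refine Finset.sum_le_sum fun j _ => ?_
      exact Finset.single_le_sum (f := fun k => ‖D k j p - l j * a p j k‖ ^ 2 / (l j * l p))
        (fun k _ => div_nonneg (sq_nonneg _) (mul_pos (hl j) (hl p)).le) (Finset.mem_univ j)
    refine le_trans ?_ h3
    have h4 : ∑ j, ‖D j j p - l j * a p j j‖ ^ 2 / (l j * l p)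
        = (∑ j, ‖D j j p - l j * a p j j‖ ^ 2 / l j) / l p := by
      rw [Finset.sum_div]; exact Finset.sum_congr rfl fun j _ => by rw [div_div]
    rw [h4, div_right_comm]
    have := hl p
    gcongr
    refine div_le_of_le_mul₀ hS
      (Finset.sum_nonneg fun j _ => div_nonneg (sq_nonneg _) (hl j).le) ?_
    rwa [mul_comm]
  rw [e2]
  calc _ ≤ ∑ p, (-(‖Sp p - ∑ j, (a p j j - a j j p)‖ ^ 2 / l p / S)
        + (n * C ^ 2 * S + 4 * n ^ 2 * C ^ 2) * (1 / l p)) := by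
        refine Finset.sum_le_sum fun p _ => ?_
        simp only [Finset.sum_add_distrib]
        have h1 : ∑ j, ∑ k, l j * ‖a p j k‖ ^ 2 / l p ≤ n * C ^ 2 * S * (1 / l p) := by
          calc _ ≤ ∑ j, ∑ k : Fin n, C ^ 2 * l j * (1 / l p) :=
                Finset.sum_le_sum fun j _ => Finset.sum_le_sum fun k _ => b2 p j k
            _ = _ := by
                simp only [Finset.sum_const, Finset.card_univ, Fintype.card_fin, nsmul_eq_mul]
                rw [← Finset.mul_sum, ← Finset.sum_mul, ← Finset.mul_sum]; ring
        have h2 : ∑ j, ∑ k, 2 * (a p j k * conj (a p j k - a k j p)).re / l p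
            ≤ 4 * n ^ 2 * C ^ 2 * (1 / l p) := by
          calc _ ≤ ∑ j : Fin n, ∑ k : Fin n, 4 * C ^ 2 * (1 / l p) :=
                Finset.sum_le_sum fun j _ => Finset.sum_le_sum fun k _ => b1 p j k
            _ = _ := by
                simp only [Finset.sum_const, Finset.card_univ, Fintype.card_fin, nsmul_eq_mul]
                ring
        have h3 := b3 p
        simp only [Finset.sum_neg_distrib]
        linarith
    _ = _ := by
        rw [Finset.sum_add_distrib, ← Finset.mul_sum, Finset.sum_neg_distrib, Finset.sum_div]

/-- The torsion cross term, controlled by the good gradient terms at a maximum point. -/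
lemma cross_term_bound {S A B K C r P1 : ℝ} (hS : 1 ≤ S) (hC : 0 ≤ C) (hB : 0 ≤ B) (hK : 0 ≤ K)
    (hA : 0 ≤ A) (hr : 0 < r) (hSr : (A + 1) ^ 2 * r ^ 3 ≤ S ^ 2) (hP1 : |P1| ≤ A + 1)
    {s T y v : ℂ} {ud : ℝ} (hud : |ud| ≤ K) (hT : ‖T‖ ≤ 2 * C)
    (h : s / S + P1 * y + B * ud * v = 0) :
    ‖s‖ ^ 2 / S ^ 2 - ‖s - T‖ ^ 2 / S ^ 2
      ≤ 2 / r ^ 3 * ‖y‖ ^ 2 + ‖v‖ ^ 2 + (2 * C ^ 2 + (2 * C * B * K) ^ 2) := by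
  have hS0 : 0 < S := by linarith
  have h1 : ‖s‖ ^ 2 - ‖s - T‖ ^ 2 ≤ 2 * ‖s‖ * ‖T‖ := by
    have h2 : ‖s‖ - ‖T‖ ≤ ‖s - T‖ := norm_sub_norm_le _ _
    rcases le_total ‖T‖ ‖s‖ with h3 | h3
    · have : (‖s‖ - ‖T‖) ^ 2 ≤ ‖s - T‖ ^ 2 := by gcongr
      nlinarith [sq_nonneg ‖T‖]
    · nlinarith [norm_nonneg s, sq_nonneg ‖s - T‖]
  -- The first order condition replaces ∂ log Tr h by the gradients of the potential and of the
  -- speed, for which quadratic terms are available.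
  have h2 : ‖s‖ / S ≤ (A + 1) * ‖y‖ + B * K * ‖v‖ := by
    have e : s / S = -(P1 * y + B * ud * v) := by linear_combination h
    have : ‖s / S‖ = ‖s‖ / S := by
      rw [norm_div, Complex.norm_real, Real.norm_of_nonneg hS0.le]
    rw [← this, e, norm_neg]
    refine (norm_add_le _ _).trans ?_
    rw [norm_mul, norm_mul, norm_mul, Complex.norm_real, Complex.norm_real, Complex.norm_real,
      Real.norm_eq_abs, Real.norm_eq_abs, Real.norm_eq_abs, abs_of_nonneg hB]
    gcongr
  have h3 : ‖s‖ ^ 2 / S ^ 2 - ‖s - T‖ ^ 2 / S ^ 2 ≤ 4 * C / S * (‖s‖ / S) := by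
    rw [← sub_div, div_mul_div_comm, ← sq]
    gcongr
    nlinarith [norm_nonneg s]
  have h4 : 4 * C / S * (‖s‖ / S) ≤ 4 * C / S * ((A + 1) * ‖y‖ + B * K * ‖v‖) := by gcongr
  have h5 : 4 * C / S * (B * K * ‖v‖) ≤ ‖v‖ ^ 2 + (2 * C * B * K) ^ 2 := by
    have : 4 * C / S ≤ 4 * C := div_le_self (by positivity) hS
    have h6 : 4 * C / S * (B * K * ‖v‖) ≤ 4 * C * (B * K * ‖v‖) := by gcongr
    nlinarith [sq_nonneg (‖v‖ - 2 * C * B * K)]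
  have h6 : 4 * C / S * ((A + 1) * ‖y‖) ≤ 2 / r ^ 3 * ‖y‖ ^ 2 + 2 * C ^ 2 := by
    -- The lower bound on S says exactly that t² ≤ 1/r³, so the square of t‖y‖ fits inside the
    -- convexity term of the potential.
    set t := (A + 1) / S with ht
    have ht0 : 0 ≤ t := by positivity
    have ht2 : t ^ 2 ≤ 1 / r ^ 3 := by
      rw [ht, div_pow, div_le_div_iff₀ (by positivity) (by positivity)]; linarith
    have : 4 * C / S * ((A + 1) * ‖y‖) = 4 * C * (t * ‖y‖) := by rw [ht]; ring
    rw [this]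
    have h7 : 2 * t ^ 2 * ‖y‖ ^ 2 ≤ 2 / r ^ 3 * ‖y‖ ^ 2 := by
      have : 2 / r ^ 3 = 2 * (1 / r ^ 3) := by ring
      rw [this]; gcongr
    nlinarith [sq_nonneg (t * ‖y‖ - C)]
  linarith [mul_add (4 * C / S) ((A + 1) * ‖y‖) (B * K * ‖v‖)]

/-- The linear algebra of the second order estimate: at a maximum point of the test function, the
trace of the inverse metric is bounded. -/
lemma inverse_trace_bound (l : Fin n → ℝ) (hl : ∀ j, 0 < l j)
    (a D : Fin n → Fin n → Fin n → ℂ)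
    (hT : ∀ p j k, D p j k - D k j p = a p j k - a k j p)
    (g4 c4 n4 : Fin n → Fin n → ℝ) (h4 : ∀ p j, g4 p j - g4 j p = c4 p j - c4 j p)
    {C K A B Ψ₀ β₀ : ℝ} (hC : 0 ≤ C) (hK : 0 ≤ K) (hβ₀ : 0 < β₀)
    (ha : ∀ p j k, ‖a p j k‖ ≤ C) (hc4 : ∀ p j, |c4 p j| ≤ C) (hn4 : ∀ p j, |n4 p j| ≤ C)
    (b : Fin n → ℝ) (hb : ∀ j, |b j| ≤ C)
    (Sp y v : Fin n → ℂ) (S2 w : Fin n → ℝ) {Ψ β ud r P1 : ℝ}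
    (hΨ : |Ψ| ≤ Ψ₀) (hβ : β₀ ≤ β) (hud : |ud| ≤ K) (hr : 1 ≤ r)
    (hB : B = Ψ₀ / β₀ + 1)
    (hA : A = 2 * n * C + C + n * C ^ 2 + 4 * n ^ 2 * C ^ 2
      + (2 * (n * C) ^ 2 + (2 * (n * C) * B * K) ^ 2) + 1)
    (hP1 : P1 = -A - 1 / r ^ 2)
    (hS : 1 ≤ ∑ j, l j) (hSr : (A + 1) ^ 2 * r ^ 3 ≤ (∑ j, l j) ^ 2)
    (hSp : ∀ p, Sp p = ∑ j, D p j j - ∑ j, a p j j * l j)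
    (hS2 : ∀ p, S2 p = ∑ j, g4 p j - 2 * ∑ j, ∑ k, (a p j k * conj (D p j k)).re
      + ∑ j, n4 p j * l j)
    (hw : ∀ j, w j = Ψ * ‖v j‖ ^ 2 + β * (-(∑ p, ∑ r, ‖D j p r‖ ^ 2 / (l p * l r))
      + ∑ p, g4 j p / l p + b j))
    (M1 : ∀ p, Sp p / (∑ j, l j : ℝ) + P1 * y p + B * ud * v p = 0)
    (M2 : ∑ p, (S2 p / (∑ j, l j) - ‖Sp p‖ ^ 2 / (∑ j, l j) ^ 2 + P1 * (l p - 1)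
      + 2 / r ^ 3 * ‖y p‖ ^ 2 + B * ‖v p‖ ^ 2 + B * ud * w p) / l p ≤ 0)
    (M3 : -(2 * K * (A + 1)) ≤ (∑ j, w j) / (∑ j, l j) + B * ud * (β * ∑ p, w p / l p)) :
    ∑ p, 1 / l p ≤ n * C + (A + 1) * n + 2 * K * (A + 1) / β₀ := by
  obtain ⟨T, hTb, h3⟩ := third_order_bound l hl a D hT hC ha Sp hSp
  set S := ∑ j, l j with hSdef
  set τ := ∑ p, 1 / l p with hτ
  have hτ0 : 0 ≤ τ := Finset.sum_nonneg fun p _ => (one_div_pos.2 (hl p)).le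
  have hS0 : 0 < S := by linarith
  have hβ' : 0 < β := by linarith
  have hΨ₀ : 0 ≤ Ψ₀ := (abs_nonneg _).trans hΨ
  have hB0 : 0 ≤ B := by rw [hB]; positivity
  have hA0 : 0 ≤ A := by rw [hA]; positivity
  have hr0 : 0 < r := by linarith
  have hr2 : 1 / r ^ 2 ≤ 1 := by
    rw [div_le_one (by positivity)]; exact one_le_pow₀ hr
  have hr2' : 0 ≤ 1 / r ^ 2 := by positivity
  have hP1a : |P1| ≤ A + 1 := by rw [hP1, abs_le]; constructor <;> linarith
  set Q := ∑ j, ∑ p, ∑ r, ‖D j p r‖ ^ 2 / (l p * l r)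
  set R := ∑ p, (∑ j, ∑ k, (a p j k * conj (D p j k)).re) / l p with hR
  set G := ∑ j, ∑ p, g4 j p / l p with hG
  set G' := ∑ p, (∑ j, g4 p j) / l p with hG'
  set N4 := ∑ p, (∑ j, n4 p j * l j) / l p with hN4
  set Y := ∑ p, ‖y p‖ ^ 2 / l p with hY
  set V := ∑ p, ‖v p‖ ^ 2 / l p with hV
  set Z := ∑ p, ‖Sp p‖ ^ 2 / l p with hZ
  set Z' := ∑ p, ‖Sp p - T p‖ ^ 2 / l p with hZ'
  set W := ∑ p, w p / l p with hW
  have M2' : (G' - 2 * R + N4) / S - Z / S ^ 2 + P1 * (n - τ) + 2 / r ^ 3 * Y + B * V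
      + B * ud * W ≤ 0 := by
    have comb : ∀ x1 x2 x3 x4 x5 x6 x7 : Fin n → ℝ,
        (∑ p, x1 p / l p - 2 * ∑ p, x2 p / l p + ∑ p, x3 p / l p) / S
          - (∑ p, x4 p / l p) / S ^ 2 + P1 * (∑ p : Fin n, (1 : ℝ) - ∑ p, 1 / l p)
          + 2 / r ^ 3 * ∑ p, x5 p / l p + B * ∑ p, x6 p / l p + B * ud * ∑ p, x7 p / l p
        = ∑ p, ((x1 p - 2 * x2 p + x3 p) / S - x4 p / S ^ 2 + P1 * (l p - 1)
          + 2 / r ^ 3 * x5 p + B * x6 p + B * ud * x7 p) / l p := by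
      intro x1 x2 x3 x4 x5 x6 x7
      simp only [Finset.mul_sum, ← Finset.sum_add_distrib, ← Finset.sum_sub_distrib,
        Finset.sum_div]
      refine Finset.sum_congr rfl fun p _ => ?_
      have := (hl p).ne'
      field_simp
    have hn : (n : ℝ) = ∑ p : Fin n, (1 : ℝ) := by simp
    refine le_of_eq_of_le ?_ M2
    rw [hn, hτ]
    refine (comb _ _ _ _ _ _ _).trans (Finset.sum_congr rfl fun p _ => ?_)
    rw [hS2]
  have M3' : -(2 * K * (A + 1)) ≤ (Ψ * (∑ j, ‖v j‖ ^ 2) + β * (-Q + G + ∑ j, b j)) / S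
      + B * ud * (β * W) := by
    have : ∑ j, w j = Ψ * (∑ j, ‖v j‖ ^ 2) + β * (-Q + G + ∑ j, b j) := by
      simp only [hw, Finset.sum_add_distrib, ← Finset.mul_sum, Finset.sum_neg_distrib]
      rfl
    rwa [this] at M3
  -- Time inequality divided by β, minus the spatial one: this is the heat operator applied to the
  -- test function. The Hessian of the speed cancels, and the fourth order terms survive only as G -
  -- G'.
  have M4 : -(2 * K * (A + 1)) / β ≤ (Ψ / β * (∑ j, ‖v j‖ ^ 2) + (-Q + 2 * R + (G - G')
      + (∑ j, b j) - N4)) / S + Z / S ^ 2 - P1 * (n - τ) - 2 / r ^ 3 * Y - B * V := by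
    rw [div_le_iff₀ hβ']
    have h5 := mul_le_mul_of_nonneg_right M2' hβ'.le
    have e : ((Ψ / β * (∑ j, ‖v j‖ ^ 2) + (-Q + 2 * R + (G - G')
      + (∑ j, b j) - N4)) / S + Z / S ^ 2 - P1 * (n - τ) - 2 / r ^ 3 * Y - B * V) * β
      = (Ψ * (∑ j, ‖v j‖ ^ 2) + β * (-Q + G + ∑ j, b j)) / S
      + B * ud * (β * W) - ((G' - 2 * R + N4) / S - Z / S ^ 2 + P1 * (n - τ) + 2 / r ^ 3 * Y
      + B * V + B * ud * W) * β := by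
      field_simp
      ring
    rw [e]; linarith
  -- This consumes the part Ψ₀/β₀ of B; the remaining 1 in B is spent on the summand V in `k5`.
  have k1 : Ψ / β * (∑ j, ‖v j‖ ^ 2) / S ≤ Ψ₀ / β₀ * V := by
    have h5 : ∑ j, ‖v j‖ ^ 2 ≤ S * V := div_le_trace_mul l hl _ fun j => sq_nonneg _
    have h6 : Ψ / β ≤ Ψ₀ / β₀ := by
      have := le_abs_self Ψ
      gcongr
      linarith
    rw [div_le_iff₀ hS0]
    calc _ ≤ Ψ₀ / β₀ * ∑ j, ‖v j‖ ^ 2 :=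
          mul_le_mul_of_nonneg_right h6 (Finset.sum_nonneg fun _ _ => sq_nonneg _)
      _ ≤ Ψ₀ / β₀ * (S * V) := by gcongr
      _ = _ := by ring
  have k2 : G - G' ≤ 2 * n * C * τ := by
    have : G' = ∑ j, ∑ p, g4 p j / l p := by
      rw [hG', Finset.sum_comm]; exact Finset.sum_congr rfl fun p _ => Finset.sum_div _ _ _
    rw [this, hG, ← Finset.sum_sub_distrib, hτ]
    calc _ ≤ ∑ j : Fin n, ∑ p, 2 * C * (1 / l p) := by
          refine Finset.sum_le_sum fun j _ => ?_
          rw [← Finset.sum_sub_distrib]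
          refine Finset.sum_le_sum fun p _ => ?_
          rw [← sub_div, h4, mul_one_div]
          refine div_le_div_of_nonneg_right ?_ (hl p).le
          linarith [le_abs_self (c4 j p), neg_abs_le (c4 p j), hc4 j p, hc4 p j]
      _ = _ := by
          simp only [← Finset.mul_sum, Finset.sum_const, Finset.card_univ, Fintype.card_fin,
            nsmul_eq_mul]
          ring
  have k3 : ∑ j, b j ≤ n * C := by
    calc _ ≤ ∑ j : Fin n, C := Finset.sum_le_sum fun j _ => (le_abs_self _).trans (hb j)
      _ = _ := by simp
  have k4 : -N4 ≤ C * S * τ := by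
    rw [hN4, ← Finset.sum_neg_distrib, hτ, Finset.mul_sum]
    refine Finset.sum_le_sum fun p _ => ?_
    rw [mul_one_div, ← neg_div, hSdef, Finset.mul_sum, ← Finset.sum_neg_distrib]
    refine div_le_div_of_nonneg_right ?_ (hl p).le
    refine Finset.sum_le_sum fun j _ => ?_
    have h5 : -n4 p j ≤ C := (neg_le_abs _).trans (hn4 p j)
    have h6 := mul_le_mul_of_nonneg_right h5 (hl j).le
    linarith only [h6]
  have k5 : Z / S ^ 2 - Z' / S ^ 2
      ≤ 2 / r ^ 3 * Y + V + (2 * (n * C) ^ 2 + (2 * (n * C) * B * K) ^ 2) * τ := by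
    rw [hZ, hZ', hY, hV, hτ]
    simp only [Finset.mul_sum, ← Finset.sum_add_distrib, ← Finset.sum_sub_distrib,
      Finset.sum_div]
    refine Finset.sum_le_sum fun p _ => ?_
    have h5 := cross_term_bound (C := n * C) hS (by positivity) hB0 hK hA0 hr0 hSr hP1a hud
      (T := T p) (by linarith only [hTb p]) (M1 p)
    have h6 := div_le_div_of_nonneg_right h5 (hl p).le
    refine le_of_eq_of_le ?_ (h6.trans_eq ?_)
    · ring
    · ring
  have k6 : (-Q + 2 * R) / S ≤ -(Z' / S ^ 2) + (n * C ^ 2 + 4 * n ^ 2 * C ^ 2) * τ := by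
    rw [div_le_iff₀ hS0]
    refine h3.trans ?_
    have : Z' / S ^ 2 * S = Z' / S := by field_simp
    have h7 : 0 ≤ 4 * (n : ℝ) ^ 2 * C ^ 2 * τ * (S - 1) := by
      have : 0 ≤ S - 1 := by linarith only [hS]
      positivity
    linarith only [h7, this]
  have k7 : ((G - G') + (∑ j, b j) - N4) / S ≤ 2 * n * C * τ + n * C + C * τ := by
    rw [div_le_iff₀ hS0]
    have h7 : 0 ≤ (2 * n * C * τ + n * C) * (S - 1) := by
      have : 0 ≤ S - 1 := by linarith only [hS]
      positivity
    linarith only [h7, k2, k3, k4]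
  have k8 : -P1 * (n - τ) ≤ (A + 1) * n - A * τ := by
    rw [hP1]
    have : (0 : ℝ) ≤ n := Nat.cast_nonneg n
    linarith only [mul_nonneg hr2' hτ0, mul_le_mul_of_nonneg_right hr2 this]
  have k9 : -(2 * K * (A + 1) / β₀) ≤ -(2 * K * (A + 1)) / β := by
    rw [neg_div, neg_le_neg_iff]
    gcongr
  have e : (Ψ / β * (∑ j, ‖v j‖ ^ 2) + (-Q + 2 * R + (G - G') + (∑ j, b j) - N4)) / S
      = Ψ / β * (∑ j, ‖v j‖ ^ 2) / S + (-Q + 2 * R) / S + ((G - G') + (∑ j, b j) - N4) / S := by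
    ring
  rw [e] at M4
  have hBV : B * V = Ψ₀ / β₀ * V + V := by rw [hB]; ring
  -- The summands of A match the multiples of τ in `k5`, `k6` and `k7`; the extra 1 leaves a single
  -- τ, which is what gets bounded.
  have hAτ : A * τ = 2 * n * C * τ + C * τ + (n * C ^ 2 + 4 * n ^ 2 * C ^ 2) * τ
      + (2 * (n * C) ^ 2 + (2 * (n * C) * B * K) ^ 2) * τ + τ := by
    rw [hA]; ring
  linarith only [M4, k1, k5, k6, k7, k8, k9, hBV, hAτ]

end Algebra

/-! ### Second derivatives of determinants, traces and the speed. -/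

section SecondOrder

variable {E : Type*} [NormedAddCommGroup E] [NormedSpace ℝ E]
variable {m : Type*} [Fintype m] [DecidableEq m]
variable {ξ η : E × E} {p : E} {O : Set E} {M N g : E → Matrix m m ℂ}

lemma mdir_congrOn (hO : IsOpen O) (h : Set.EqOn M N O) (hp : p ∈ O) :
    mdir ξ M p = mdir ξ N p := by
  ext i j
  exact cdir_congrOn hO (fun q hq => by rw [h hq]) hp

lemma mdir_const (A : Matrix m m ℂ) : mdir ξ (fun _ : E => A) p = 0 := by
  ext i j; simp [mdir]

lemma mdir_add (hO : IsOpen O) (h : MSmoothOn M O) (h' : MSmoothOn N O) (hp : p ∈ O) :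
    mdir ξ (fun q => M q + N q) p = mdir ξ M p + mdir ξ N p := by
  ext i j
  exact cdir_add (h.diff hO hp i j) (h'.diff hO hp i j)

lemma mdir_smul_one {w : E → ℂ} :
    mdir ξ (fun q => w q • (1 : Matrix m m ℂ)) p = cdir ξ w p • (1 : Matrix m m ℂ) := by
  ext i j
  by_cases hij : i = j <;> simp [mdir, Matrix.one_apply, hij]

lemma MSmoothOn.add (h : MSmoothOn M O) (h' : MSmoothOn N O) :
    MSmoothOn (fun q => M q + N q) O := fun i j => (h i j).add (h' i j)

lemma msmoothOn_const (A : Matrix m m ℂ) : MSmoothOn (fun _ : E => A) O :=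
  fun _ _ => contDiffOn_const

lemma MSmoothOn.adjugate (h : MSmoothOn M O) : MSmoothOn (fun q => (M q).adjugate) O := by
  intro i j
  simp only [Matrix.adjugate_apply]
  refine MSmoothOn.det fun a b => ?_
  simp only [Matrix.updateRow_apply]
  split_ifs
  · exact contDiffOn_const
  · exact h _ _

lemma MSmoothOn.inv (h : MSmoothOn M O) (hd : ∀ q ∈ O, (M q).det ≠ 0) :
    MSmoothOn (fun q => (M q)⁻¹) O := by
  intro i j
  simp only [Matrix.inv_def, Ring.inverse_eq_inv', Matrix.smul_apply, smul_eq_mul]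
  exact (h.det.inv hd).mul (h.adjugate i j)

lemma cdir_det' (hO : IsOpen O) (hg : MSmoothOn g O) (hp : p ∈ O) (hd : (g p).det ≠ 0) :
    cdir ξ (fun q => (g q).det) p = (g p).det * ((g p)⁻¹ * mdir ξ g p).trace := by
  rw [cdir_det hO hg hp, Matrix.inv_def, Ring.inverse_eq_inv', Matrix.smul_mul, Matrix.trace_smul,
    smul_eq_mul, mul_inv_cancel_left₀ hd]

/-- Jacobi's formula is differentiated again; the derivative of the adjugate comes from
differentiating adj(g) g = det(g) 1. -/
lemma cdir_cdir_det (hO : IsOpen O) (hg : MSmoothOn g O) (hp : p ∈ O) (hd : (g p).det ≠ 0) :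
    cdir ξ (cdir η fun q => (g q).det) p = (g p).det *
      (((g p)⁻¹ * mdir ξ g p).trace * ((g p)⁻¹ * mdir η g p).trace
        - ((g p)⁻¹ * mdir ξ g p * (g p)⁻¹ * mdir η g p).trace
        + ((g p)⁻¹ * mdir ξ (mdir η g) p).trace) := by
  have hu : IsUnit (g p).det := isUnit_iff_ne_zero.2 hd
  have hadj : (g p).adjugate = (g p).det • (g p)⁻¹ := by
    rw [Matrix.inv_def, Ring.inverse_eq_inv', smul_smul, mul_inv_cancel₀ hd, one_smul]
  have h1 : mdir ξ (fun q => (g q).adjugate) p * g p + (g p).adjugate * mdir ξ g p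
      = cdir ξ (fun q => (g q).det) p • (1 : Matrix m m ℂ) := by
    rw [← mdir_mul hO hg.adjugate hg hp, ← mdir_smul_one]
    exact mdir_congrOn hO (fun q _ => Matrix.adjugate_mul _) hp
  have h2 : mdir ξ (fun q => (g q).adjugate) p
      = (cdir ξ (fun q => (g q).det) p • (1 : Matrix m m ℂ) - (g p).adjugate * mdir ξ g p)
        * (g p)⁻¹ := by
    rw [← h1, add_sub_cancel_right, Matrix.mul_assoc, Matrix.mul_nonsing_inv _ hu, Matrix.mul_one]
  rw [cdir_congrOn (w' := fun q => ((g q).adjugate * mdir η g q).trace) hO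
    (fun q hq => cdir_det hO hg hq) hp,
    cdir_trace hO (hg.adjugate.mul (hg.mdir hO)) hp, mdir_mul hO hg.adjugate (hg.mdir hO) hp, h2,
    hadj, cdir_det' hO hg hp hd]
  simp only [Matrix.smul_mul, Matrix.sub_mul, Matrix.one_mul, Matrix.trace_add, Matrix.trace_sub,
    Matrix.trace_smul, smul_eq_mul, Matrix.mul_assoc]
  ring

lemma cdir_trace_mul (hO : IsOpen O) (hN : MSmoothOn N O) (hg : MSmoothOn g O) (hp : p ∈ O) :
    cdir ξ (fun q => (N q * g q).trace) p = (mdir ξ N p * g p).trace + (N p * mdir ξ g p).trace := by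
  rw [cdir_trace hO (hN.mul hg) hp, mdir_mul hO hN hg hp, Matrix.trace_add]

lemma cdir_cdir_trace_mul (hO : IsOpen O) (hN : MSmoothOn N O) (hg : MSmoothOn g O) (hp : p ∈ O) :
    cdir ξ (cdir η fun q => (N q * g q).trace) p = (mdir ξ (mdir η N) p * g p).trace
      + (mdir η N p * mdir ξ g p).trace + (mdir ξ N p * mdir η g p).trace
      + (N p * mdir ξ (mdir η g) p).trace := by
  have hN' := hN.mdir (ξ := η) hO
  have hg' := hg.mdir (ξ := η) hO
  rw [cdir_congrOn (w' := fun q => (mdir η N q * g q).trace + (N q * mdir η g q).trace) hO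
    (fun q hq => cdir_trace_mul hO hN hg hq) hp,
    cdir_add (differentiableAt_of_contDiffOn hO (hN'.mul hg).trace hp)
      (differentiableAt_of_contDiffOn hO (hN.mul hg').trace hp),
    cdir_trace_mul hO hN' hg hp, cdir_trace_mul hO hN hg' hp]
  ring

/-- First derivative of `F(ρ det g)`. -/
lemma cdir_flow (hO : IsOpen O) (hg : MSmoothOn g O) {ρ : E → ℂ} (hρ : ContDiffOn ℝ ∞ ρ O)
    {e V : E → ℝ} {F : ℝ → ℝ} (hF : ContDiffOn ℝ ∞ F (Set.Ioi 0)) (he : ContDiffOn ℝ ∞ e O)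
    (hepos : ∀ q ∈ O, 0 < e q) (hedef : ∀ q ∈ O, ((e q : ℝ) : ℂ) = ρ q * (g q).det)
    (hV : ∀ q ∈ O, V q = F (e q)) (hp : p ∈ O) :
    cdir ξ (fun q => ((V q : ℝ) : ℂ)) p
      = (deriv F (e p) * e p : ℝ) * (((g p)⁻¹ * mdir ξ g p).trace + cdir ξ ρ p / ρ p) := by
  have h0 : ρ p * (g p).det ≠ 0 := by
    rw [← hedef p hp]; exact_mod_cast (hepos p hp).ne'
  have hρ0 : ρ p ≠ 0 := left_ne_zero_of_mul h0
  rw [cdir_congrOn (w' := fun q => ((F (e q) : ℝ) : ℂ)) hO (fun q hq => by rw [hV q hq]) hp,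
    cdir_comp_real (differentiableAt_of_contDiffOn hO he hp)
      (differentiableAt_of_contDiffOn isOpen_Ioi hF (hepos p hp)),
    cdir_congrOn hO hedef hp, cdir_mul (differentiableAt_of_contDiffOn hO hρ hp)
      (differentiableAt_of_contDiffOn hO hg.det hp), cdir_det' hO hg hp (right_ne_zero_of_mul h0)]
  push_cast
  rw [hedef p hp]
  field_simp
  ring

/-- Second derivatives of `F(ρ det g)`. -/
lemma cdir_cdir_flow (hO : IsOpen O) (hg : MSmoothOn g O) {ρ : E → ℂ} (hρ : ContDiffOn ℝ ∞ ρ O)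
    {e V : E → ℝ} {F : ℝ → ℝ} (hF : ContDiffOn ℝ ∞ F (Set.Ioi 0))
    (hF' : ∀ s, 0 < s → 0 < deriv F s) (he : ContDiffOn ℝ ∞ e O)
    (hepos : ∀ q ∈ O, 0 < e q) (hedef : ∀ q ∈ O, ((e q : ℝ) : ℂ) = ρ q * (g q).det)
    (hV : ∀ q ∈ O, V q = F (e q)) (hp : p ∈ O) :
    cdir ξ (cdir η (fun q => ((V q : ℝ) : ℂ))) p
      = ((deriv (deriv F) (e p) + deriv F (e p) / e p) / deriv F (e p) ^ 2 : ℝ)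
          * (cdir ξ (fun q => ((V q : ℝ) : ℂ)) p * cdir η (fun q => ((V q : ℝ) : ℂ)) p)
        + (deriv F (e p) * e p : ℝ) * (-((g p)⁻¹ * mdir ξ g p * (g p)⁻¹ * mdir η g p).trace
          + ((g p)⁻¹ * mdir ξ (mdir η g) p).trace
          + (cdir ξ (cdir η ρ) p / ρ p - cdir ξ ρ p * cdir η ρ p / ρ p ^ 2)) := by
  have h0 : ρ p * (g p).det ≠ 0 := by
    rw [← hedef p hp]; exact_mod_cast (hepos p hp).ne'
  have hρ0 : ρ p ≠ 0 := left_ne_zero_of_mul h0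
  have hd0 : (g p).det ≠ 0 := right_ne_zero_of_mul h0
  have hFp : ((deriv F (e p) : ℝ) : ℂ) ≠ 0 := by exact_mod_cast (hF' _ (hepos p hp)).ne'
  have hdρ := differentiableAt_of_contDiffOn hO hρ hp
  have hdg := differentiableAt_of_contDiffOn hO hg.det hp
  have hdρ' := differentiableAt_of_contDiffOn hO (contDiffOn_cdir (ξ := η) hO hρ) hp
  have hdg' := differentiableAt_of_contDiffOn hO (contDiffOn_cdir (ξ := η) hO hg.det) hp
  -- With X the logarithmic derivative of e, a derivative of V is F'(e) e X. The quadratic part (F''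
  -- e² + F' e) X_ξ X_η thus becomes a multiple of V_ξ V_η, with coefficient (F'' + F'/e)/F'².
  rw [cdir_flow hO hg hρ hF he hepos hedef hV hp, cdir_flow hO hg hρ hF he hepos hedef hV hp,
    cdir_congrOn (w' := cdir η fun q => ((F (e q) : ℝ) : ℂ)) hO
      (fun q hq => cdir_congrOn hO (fun q hq => by rw [hV q hq]) hq) hp,
    cdir_cdir_comp_real hO isOpen_Ioi he hF hepos hp,
    cdir_congrOn (w' := cdir η fun q => ρ q * (g q).det) hO
      (fun q hq => cdir_congrOn hO hedef hq) hp,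
    cdir_congrOn (ξ := ξ) hO hedef hp, cdir_congrOn (ξ := η) hO hedef hp,
    cdir_congrOn (w' := fun q => cdir η ρ q * (g q).det + ρ q * cdir η (fun q => (g q).det) q) hO
      (fun q hq => cdir_mul (differentiableAt_of_contDiffOn hO hρ hq)
        (differentiableAt_of_contDiffOn hO hg.det hq)) hp,
    cdir_add (hdρ'.fun_mul hdg) (hdρ.fun_mul hdg'), cdir_mul hdρ' hdg, cdir_mul hdρ hdg',
    cdir_mul hdρ hdg, cdir_mul hdρ hdg, cdir_det' hO hg hp hd0, cdir_det' hO hg hp hd0,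
    cdir_cdir_det hO hg hp hd0]
  push_cast
  rw [hedef p hp]
  field_simp
  ring

end SecondOrder

/-! ### The flow near a space-time point, in a diagonalizing frame. -/

section Model

variable {n : ℕ} {E : Type*} [NormedAddCommGroup E] [NormedSpace ℝ E]

/-- The complex Hessian `U_{k̄j}` with respect to the directions `d`. -/
def frameHessian (d : Fin n → E × E) (U : E → ℝ) (q : E) : Matrix (Fin n) (Fin n) ℂ :=
  Matrix.of fun k j => cdir (d j) (cdir (cbar (d k)) fun z => ((U z : ℝ) : ℂ)) q

/-- The flow near a space-time point `p`, in a frame of constant directions `d` that makes the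
reference metric `χ` the identity at `p` and the evolving metric diagonal there. -/
structure LocalModel (n : ℕ) {E : Type*} [NormedAddCommGroup E] [NormedSpace ℝ E]
    (F : ℝ → ℝ) (O : Set E) (p : E) where
  /-- the frame -/
  d : Fin n → E × E
  /-- the time direction -/
  τ : E
  /-- the solution -/
  U : E → ℝ
  /-- the speed of the flow -/
  V : E → ℝ
  /-- the argument of `F` in the flow equation -/
  e : E → ℝ
  /-- the trace of the evolving metric -/
  S : E → ℝ
  /-- the reference metric -/
  χ : E → Matrix (Fin n) (Fin n) ℂ
  /-- the inverse of the reference metric -/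
  N : E → Matrix (Fin n) (Fin n) ℂ
  /-- the density relating `e` to the determinant of the evolving metric -/
  ρ : E → ℂ
  /-- the eigenvalues of the evolving metric at `p` -/
  l : Fin n → ℝ
  isOpen : IsOpen O
  mem : p ∈ O
  smoothU : ContDiffOn ℝ ∞ U O
  smoothχ : MSmoothOn χ O
  smoothN : MSmoothOn N O
  smoothρ : ContDiffOn ℝ ∞ ρ O
  herm : ∀ q ∈ O, (χ q).IsHermitian
  N_mul : ∀ q ∈ O, N q * χ q = 1
  χ_p : χ p = 1
  g_p : χ p + frameHessian d U p = Matrix.diagonal fun j => (l j : ℂ)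
  l_pos : ∀ j, 0 < l j
  e_pos : ∀ q ∈ O, 0 < e q
  e_eq : ∀ q ∈ O, ((e q : ℝ) : ℂ) = ρ q * (χ q + frameHessian d U q).det
  V_eq : ∀ q ∈ O, V q = F (e q)
  S_eq : ∀ q ∈ O, ((S q : ℝ) : ℂ) = (N q * (χ q + frameHessian d U q)).trace
  flow : ∀ q ∈ O, fderiv ℝ U q τ = V q
  static_χ : mdir (τ, 0) χ p = 0
  static_N : mdir (τ, 0) N p = 0
  static_ρ : cdir (τ, 0) ρ p = 0

variable {F : ℝ → ℝ} {O : Set E} {p : E}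

lemma contDiffOn_ofReal {U : E → ℝ} (h : ContDiffOn ℝ ∞ U O) :
    ContDiffOn ℝ ∞ (fun z => ((U z : ℝ) : ℂ)) O := Complex.ofRealCLM.contDiff.comp_contDiffOn h

lemma contDiffOn_of_ofReal_eq {U : E → ℝ} {w : E → ℂ} (h : ContDiffOn ℝ ∞ w O)
    (hU : ∀ q ∈ O, ((U q : ℝ) : ℂ) = w q) : ContDiffOn ℝ ∞ U O :=
  (Complex.reCLM.contDiff.comp_contDiffOn h).congr fun q hq => by simp [← hU q hq]

namespace LocalModel

variable (M : LocalModel n F O p)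

/-- The evolving metric. -/
def g (q : E) : Matrix (Fin n) (Fin n) ℂ := M.χ q + frameHessian M.d M.U q

lemma smoothUc : ContDiffOn ℝ ∞ (fun z => ((M.U z : ℝ) : ℂ)) O := contDiffOn_ofReal M.smoothU

lemma smoothH : MSmoothOn (frameHessian M.d M.U) O := fun _ _ =>
  contDiffOn_cdir M.isOpen (contDiffOn_cdir M.isOpen M.smoothUc)

lemma smooth_g : MSmoothOn M.g O := M.smoothχ.add M.smoothH

lemma smooth_e : ContDiffOn ℝ ∞ M.e O :=
  contDiffOn_of_ofReal_eq (M.smoothρ.mul M.smooth_g.det) M.e_eq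

lemma smooth_S : ContDiffOn ℝ ∞ M.S O :=
  contDiffOn_of_ofReal_eq (M.smoothN.mul M.smooth_g).trace M.S_eq

lemma herm_g (q : E) (hq : q ∈ O) : (M.g q).IsHermitian := by
  refine (M.herm q hq).add (Matrix.IsHermitian.ext fun i j => ?_)
  simp only [frameHessian, Matrix.of_apply, Complex.star_def]
  rw [← cbar_cbar (ξ := M.d i), ← cdir_conj,
    cdir_comm M.isOpen M.smoothUc hq, cbar_cbar]
  refine cdir_congr (Filter.Eventually.of_forall fun z => ?_)
  simp only []
  rw [← cdir_cbar_real, cbar_cbar]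

lemma mdir_cbar (M : LocalModel n F O p) {A : E → Matrix (Fin n) (Fin n) ℂ} (hA : ∀ q ∈ O, (A q).IsHermitian)
    (ξ : E × E) (i j : Fin n) : mdir (cbar ξ) A p i j = conj (mdir ξ A p j i) := by
  simp only [mdir, Matrix.of_apply]
  rw [← cbar_cbar (ξ := ξ), ← cdir_conj, cbar_cbar]
  exact cdir_congrOn M.isOpen (fun q hq => ((hA q hq).apply i j).symm) M.mem

lemma N_p : M.N p = 1 := by
  have := M.N_mul p M.mem
  rwa [M.χ_p, Matrix.mul_one] at this

lemma g_p' : M.g p = Matrix.diagonal fun j => (M.l j : ℂ) := M.g_p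

lemma mdir_N (ξ : E × E) : mdir ξ M.N p = - mdir ξ M.χ p := by
  have h := mdir_mul M.isOpen M.smoothN M.smoothχ M.mem (ξ := ξ)
  rw [mdir_congrOn (N := fun _ => 1) M.isOpen M.N_mul M.mem, mdir_const, M.χ_p, M.N_p,
    Matrix.mul_one, Matrix.one_mul] at h
  exact eq_neg_of_add_eq_zero_left h.symm

lemma inv_g : (M.g p)⁻¹ = Matrix.diagonal fun j => ((1 / M.l j : ℝ) : ℂ) := by
  refine Matrix.inv_eq_left_inv ?_
  rw [M.g_p', Matrix.diagonal_mul_diagonal, ← Matrix.diagonal_one]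
  congr 1
  ext j
  have : (M.l j : ℂ) ≠ 0 := by exact_mod_cast (M.l_pos j).ne'
  push_cast
  field_simp

lemma mdir_g (ξ : E × E) {q : E} (hq : q ∈ O) :
    mdir ξ M.g q = mdir ξ M.χ q + mdir ξ (frameHessian M.d M.U) q :=
  mdir_add M.isOpen M.smoothχ M.smoothH hq

lemma mdir_mdir_g (ξ η : E × E) :
    mdir ξ (mdir η M.g) p
      = mdir ξ (mdir η M.χ) p + mdir ξ (mdir η (frameHessian M.d M.U)) p := by
  rw [mdir_congrOn (N := fun q => mdir η M.χ q + mdir η (frameHessian M.d M.U) q) M.isOpen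
    (fun q hq => M.mdir_g η hq) M.mem]
  exact mdir_add M.isOpen (M.smoothχ.mdir M.isOpen) (M.smoothH.mdir M.isOpen) M.mem

/-- The third derivatives of the potential are symmetric in the two holomorphic indices, so the
antisymmetric part of the first derivative of g is that of χ. -/
lemma torsion (r j k : Fin n) :
    mdir (M.d r) M.g p j k - mdir (M.d k) M.g p j r
      = mdir (M.d r) M.χ p j k - mdir (M.d k) M.χ p j r := by
  have : mdir (M.d r) (frameHessian M.d M.U) p j k = mdir (M.d k) (frameHessian M.d M.U) p j r :=
    cdir_comm M.isOpen (contDiffOn_cdir M.isOpen M.smoothUc) M.mem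
  rw [M.mdir_g _ M.mem, M.mdir_g _ M.mem, Matrix.add_apply, Matrix.add_apply, this]
  ring

/-- Fourth derivatives of the potential are symmetric, so exchanging the two index pairs costs only
second derivatives of χ. This lets the Laplacian of the trace be compared with the trace of the
Hessian of the speed. -/
lemma fourth_order (r j : Fin n) :
    mdir (M.d r) (mdir (cbar (M.d r)) M.g) p j j - mdir (M.d j) (mdir (cbar (M.d j)) M.g) p r r
      = mdir (M.d r) (mdir (cbar (M.d r)) M.χ) p j j
        - mdir (M.d j) (mdir (cbar (M.d j)) M.χ) p r r := by
  have hU := M.smoothUc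
  have hO := M.isOpen
  have : mdir (M.d r) (mdir (cbar (M.d r)) (frameHessian M.d M.U)) p j j
      = mdir (M.d j) (mdir (cbar (M.d j)) (frameHessian M.d M.U)) p r r := by
    have e1 : ∀ a b c d' : E × E, ∀ q ∈ O,
        cdir a (cdir b (cdir c (cdir d' fun z => ((M.U z : ℝ) : ℂ)))) q
        = cdir c (cdir d' (cdir a (cdir b fun z => ((M.U z : ℝ) : ℂ)))) q := by
      intro a b c d' q hq
      have s1 : ∀ a, ContDiffOn ℝ ∞ (cdir a fun z => ((M.U z : ℝ) : ℂ)) O := fun a =>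
        contDiffOn_cdir hO hU
      have s2 : ∀ a b, ContDiffOn ℝ ∞ (cdir a (cdir b fun z => ((M.U z : ℝ) : ℂ))) O :=
        fun a b => contDiffOn_cdir hO (s1 b)
      rw [cdir_congrOn hO (fun q hq => cdir_comm hO (s1 d') hq) hq,
        cdir_comm hO (s2 b d') hq]
      refine cdir_congrOn hO (fun q hq => ?_) hq
      rw [cdir_congrOn hO (fun q hq => cdir_comm hO hU hq) hq, cdir_comm hO (s1 b) hq]
    exact e1 _ _ _ _ p M.mem
  rw [M.mdir_mdir_g, M.mdir_mdir_g, Matrix.add_apply, Matrix.add_apply, this]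
  ring

lemma cdir_S (r : Fin n) :
    cdir (M.d r) (fun z => ((M.S z : ℝ) : ℂ)) p
      = ∑ j, mdir (M.d r) M.g p j j - ∑ j, mdir (M.d r) M.χ p j j * M.l j := by
  rw [cdir_congrOn M.isOpen M.S_eq M.mem]
  refine (cdir_trace_mul M.isOpen M.smoothN M.smooth_g M.mem).trans ?_
  rw [M.mdir_N, M.N_p, M.g_p', Matrix.one_mul, Matrix.neg_mul, Matrix.trace_neg]
  simp only [Matrix.trace, Matrix.diag, Matrix.mul_diagonal]
  ring

/-- Product rule for Tr(Ng). The two mixed terms are complex conjugates, and ∂N = -∂χ at p; the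
second derivative of N is left unexpanded because it is bounded as it stands. -/
lemma cdir_cdir_S (r : Fin n) :
    (cdir (M.d r) (cdir (cbar (M.d r)) (fun z => ((M.S z : ℝ) : ℂ))) p).re
      = ∑ j, (mdir (M.d r) (mdir (cbar (M.d r)) M.g) p j j).re
        - 2 * ∑ j, ∑ k, (mdir (M.d r) M.χ p j k * conj (mdir (M.d r) M.g p j k)).re
        + ∑ j, (mdir (M.d r) (mdir (cbar (M.d r)) M.N) p j j).re * M.l j := by
  rw [cdir_congrOn (w' := cdir (cbar (M.d r)) fun q => (M.N q * M.g q).trace) M.isOpen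
    (fun q hq => cdir_congrOn M.isOpen M.S_eq hq) M.mem,
    cdir_cdir_trace_mul M.isOpen M.smoothN M.smooth_g M.mem, M.mdir_N, M.mdir_N, M.N_p,
    Matrix.one_mul, M.g_p']
  have h1 : (-mdir (cbar (M.d r)) M.χ p * mdir (M.d r) M.g p).trace.re
      = - ∑ j, ∑ k, (mdir (M.d r) M.χ p j k * conj (mdir (M.d r) M.g p j k)).re := by
    rw [Matrix.neg_mul, Matrix.trace_neg, Complex.neg_re]
    simp only [Matrix.trace, Matrix.diag, Matrix.mul_apply, Complex.re_sum]
    rw [Finset.sum_comm]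
    congr 1
    refine Finset.sum_congr rfl fun j _ => Finset.sum_congr rfl fun k _ => ?_
    rw [M.mdir_cbar M.herm]
    simp [Complex.mul_re]
  have h2 : (-mdir (M.d r) M.χ p * mdir (cbar (M.d r)) M.g p).trace.re
      = - ∑ j, ∑ k, (mdir (M.d r) M.χ p j k * conj (mdir (M.d r) M.g p j k)).re := by
    rw [Matrix.neg_mul, Matrix.trace_neg, Complex.neg_re]
    simp only [Matrix.trace, Matrix.diag, Matrix.mul_apply, Complex.re_sum]
    congr 1
    refine Finset.sum_congr rfl fun j _ => Finset.sum_congr rfl fun k _ => ?_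
    rw [M.mdir_cbar M.herm_g]
  rw [Complex.add_re, Complex.add_re, Complex.add_re, h1, h2]
  simp only [Matrix.trace, Matrix.diag, Matrix.mul_diagonal, Complex.re_sum, Complex.re_mul_ofReal]
  ring

/-- The twice differentiated equation in the diagonal frame. Hermitian symmetry of g turns the
quadratic trace into a sum of squares, the good third order term. -/
lemma cdir_cdir_V (hF : ContDiffOn ℝ ∞ F (Set.Ioi 0)) (hF' : ∀ s, 0 < s → 0 < deriv F s)
    (j : Fin n) :
    (cdir (M.d j) (cdir (cbar (M.d j)) (fun z => ((M.V z : ℝ) : ℂ))) p).re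
      = ((deriv (deriv F) (M.e p) + deriv F (M.e p) / M.e p) / deriv F (M.e p) ^ 2)
          * ‖cdir (M.d j) (fun z => ((M.V z : ℝ) : ℂ)) p‖ ^ 2
        + (deriv F (M.e p) * M.e p)
          * (-(∑ r, ∑ s, ‖mdir (M.d j) M.g p r s‖ ^ 2 / (M.l r * M.l s))
          + ∑ r, (mdir (M.d j) (mdir (cbar (M.d j)) M.g) p r r).re / M.l r
          + (cdir (M.d j) (cdir (cbar (M.d j)) M.ρ) p / M.ρ p
            - cdir (M.d j) M.ρ p * cdir (cbar (M.d j)) M.ρ p / M.ρ p ^ 2).re) := by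
  rw [cdir_cdir_flow M.isOpen M.smooth_g M.smoothρ hF hF' M.smooth_e M.e_pos M.e_eq M.V_eq M.mem,
    cdir_cbar_real, Complex.mul_conj, Complex.normSq_eq_norm_sq, M.inv_g, Complex.add_re,
    ← Complex.ofReal_mul, Complex.ofReal_re, Complex.re_ofReal_mul, Complex.add_re, Complex.add_re,
    Complex.neg_re]
  congr 5
  · simp only [Matrix.trace, Matrix.diag, Complex.re_sum]
    refine Finset.sum_congr rfl fun r _ => ?_
    rw [Matrix.mul_apply, Complex.re_sum]
    refine Finset.sum_congr rfl fun s _ => ?_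
    rw [Matrix.mul_diagonal, Matrix.diagonal_mul, M.mdir_cbar M.herm_g]
    have : ((1 / M.l r : ℝ) : ℂ) * mdir (M.d j) M.g p r s * ((1 / M.l s : ℝ) : ℂ)
        * conj (mdir (M.d j) M.g p r s)
        = ((‖mdir (M.d j) M.g p r s‖ ^ 2 / (M.l r * M.l s) : ℝ) : ℂ) := by
      have h := Complex.mul_conj (mdir (M.d j) M.g p r s)
      rw [Complex.normSq_eq_norm_sq] at h
      push_cast at h ⊢
      linear_combination (1 / (M.l r : ℂ)) * (1 / (M.l s : ℂ)) * h
    rw [this, Complex.ofReal_re]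
  · simp only [Matrix.trace, Matrix.diag, Matrix.diagonal_mul, Complex.re_sum,
      Complex.re_ofReal_mul]
    exact Finset.sum_congr rfl fun r _ => by ring

/-- χ is static and the time derivative of the potential is the speed, so commuting derivatives
leaves the Hessian of the speed. -/
lemma mdir_time_g :
    mdir (M.τ, 0) M.g p = frameHessian M.d M.V p := by
  rw [M.mdir_g _ M.mem, M.static_χ, zero_add]
  ext k j
  simp only [mdir, frameHessian, Matrix.of_apply]
  have hO := M.isOpen
  have hU := M.smoothUc
  rw [cdir_comm hO (contDiffOn_cdir hO hU) M.mem]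
  refine cdir_congrOn hO (fun q hq => ?_) M.mem
  rw [cdir_comm hO hU hq]
  refine cdir_congrOn hO (fun z hz => ?_) hq
  have h1 : HasFDerivAt (fun q => ((M.U q : ℝ) : ℂ)) (Complex.ofRealCLM.comp (fderiv ℝ M.U z)) z :=
    Complex.ofRealCLM.hasFDerivAt.comp z
      (differentiableAt_of_contDiffOn hO M.smoothU hz).hasFDerivAt
  simp [cdir, h1.fderiv, M.flow z hz]

lemma cdir_time_S :
    (cdir (M.τ, 0) (fun z => ((M.S z : ℝ) : ℂ)) p).re
      = ∑ j, (cdir (M.d j) (cdir (cbar (M.d j)) (fun z => ((M.V z : ℝ) : ℂ))) p).re := by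
  rw [cdir_congrOn M.isOpen M.S_eq M.mem]
  have := cdir_trace_mul M.isOpen M.smoothN M.smooth_g M.mem (ξ := (M.τ, 0))
  refine (congrArg Complex.re this).trans ?_
  rw [M.static_N, M.N_p, Matrix.zero_mul, Matrix.one_mul, M.mdir_time_g, Matrix.trace_zero,
    zero_add, Matrix.trace, Complex.re_sum]
  rfl

/-- The linearized equation V_t = β g^{jk̄} V_{k̄j}; it has no zeroth order term since ρ is
independent of time. -/
lemma cdir_time_V (hF : ContDiffOn ℝ ∞ F (Set.Ioi 0)) :
    (cdir (M.τ, 0) (fun z => ((M.V z : ℝ) : ℂ)) p).re = (deriv F (M.e p) * M.e p)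
      * ∑ j, (cdir (M.d j) (cdir (cbar (M.d j)) (fun z => ((M.V z : ℝ) : ℂ))) p).re / M.l j := by
  rw [cdir_flow M.isOpen M.smooth_g M.smoothρ hF M.smooth_e M.e_pos M.e_eq M.V_eq M.mem,
    M.static_ρ, zero_div, add_zero, M.mdir_time_g, M.inv_g, Complex.re_ofReal_mul]
  simp only [Matrix.trace, Matrix.diag, Matrix.diagonal_mul, Complex.re_sum,
      Complex.re_ofReal_mul, frameHessian, Matrix.of_apply]
  congr 1
  exact Finset.sum_congr rfl fun r _ => by ring

lemma S_p : M.S p = ∑ j, M.l j := by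
  have := M.S_eq p M.mem
  rw [M.g_p, M.N_p, Matrix.one_mul, Matrix.trace_diagonal] at this
  exact_mod_cast this

end LocalModel

end Model

/-! ### First and second order conditions at a maximum, and the test function. -/

section MaximumPrinciple

variable {n : ℕ} {E : Type*} [NormedAddCommGroup E] [NormedSpace ℝ E]
variable {O : Set E} {p : E}

/-- A positive second derivative would make the critical point a local minimum too, hence f locally
constant with vanishing second derivative. -/
lemma deriv_deriv_nonpos_of_isLocalMax {f : ℝ → ℝ} {x : ℝ} (hc : ContinuousAt f x)
    (h : IsLocalMax f x) : deriv (deriv f) x ≤ 0 := by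
  by_contra! hpos
  have hmin := isLocalMin_of_deriv_deriv_pos hpos h.deriv_eq_zero hc
  have heq : f =ᶠ[nhds x] fun _ => f x := by
    filter_upwards [h, hmin] with y h1 h2 using le_antisymm h1 h2
  have h2 : deriv f =ᶠ[nhds x] fun _ => 0 := by
    filter_upwards [heq.eventuallyEq_nhds] with y hy
    rw [hy.deriv_eq]; simp
  rw [h2.deriv_eq] at hpos
  simp at hpos

lemma second_derivative_test (hO : IsOpen O) {H : E → ℝ} (hH : ContDiffOn ℝ ∞ H O) (hp : p ∈ O)
    {a : E} (hm : IsLocalMax (fun s : ℝ => H (p + s • a)) 0) :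
    fderiv ℝ H p a = 0 ∧ fderiv ℝ (fun q => fderiv ℝ H q a) p a ≤ 0 := by
  have hline : ∀ s : ℝ, HasDerivAt (fun s : ℝ => p + s • a) a s := fun s => by
    simpa using ((hasDerivAt_id s).smul_const a).const_add p
  have hcomp : ∀ {W : E → ℝ} {s : ℝ}, DifferentiableAt ℝ W (p + s • a) →
      HasDerivAt (fun s : ℝ => W (p + s • a)) (fderiv ℝ W (p + s • a) a) s := fun hW =>
    hW.hasFDerivAt.comp_hasDerivAt _ (hline _)
  have hp0 : p + (0 : ℝ) • a = p := by simp
  have hev : ∀ᶠ s : ℝ in nhds 0, p + s • a ∈ O :=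
    (hline 0).continuousAt.preimage_mem_nhds (by rw [hp0]; exact hO.mem_nhds hp)
  have hd1 : deriv (fun s : ℝ => H (p + s • a)) =ᶠ[nhds 0]
      fun s => fderiv ℝ H (p + s • a) a := by
    filter_upwards [hev] with s hs
    exact (hcomp (differentiableAt_of_contDiffOn hO hH hs)).deriv
  have hd2 : DifferentiableAt ℝ (fun q => fderiv ℝ H q a) (p + (0 : ℝ) • a) := by
    rw [hp0]
    exact differentiableAt_of_contDiffOn hO
      ((hH.fderiv_of_isOpen (m := ∞) hO (by simp)).clm_apply contDiffOn_const) hp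
  have hH0 : DifferentiableAt ℝ H (p + (0 : ℝ) • a) := by
    rw [hp0]; exact differentiableAt_of_contDiffOn hO hH hp
  constructor
  · have := hm.deriv_eq_zero
    rw [hd1.self_of_nhds] at this
    simpa using this
  · have := deriv_deriv_nonpos_of_isLocalMax (hcomp hH0).continuousAt hm
    rwa [hd1.deriv_eq, (hcomp hd2).deriv, hp0] at this

lemma fderiv_ofReal {H : E → ℝ} (h : DifferentiableAt ℝ H p) (a : E) :
    fderiv ℝ (fun q => ((H q : ℝ) : ℂ)) p a = (fderiv ℝ H p a : ℝ) := by
  have h1 : HasFDerivAt (fun q => ((H q : ℝ) : ℂ)) (Complex.ofRealCLM.comp (fderiv ℝ H p)) p :=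
    Complex.ofRealCLM.hasFDerivAt.comp p h.hasFDerivAt
  rw [h1.fderiv]; simp

/-- For ξ = a + ib the mixed derivative along ξ and its conjugate is D²H(a,a) + D²H(b,b), so
maximality along two real lines suffices. -/
lemma cdir_of_isLocalMax (hO : IsOpen O) {H : E → ℝ} (hH : ContDiffOn ℝ ∞ H O) (hp : p ∈ O)
    {ξ : E × E} (h1 : IsLocalMax (fun s : ℝ => H (p + s • ξ.1)) 0)
    (h2 : IsLocalMax (fun s : ℝ => H (p + s • ξ.2)) 0) :
    cdir ξ (fun q => ((H q : ℝ) : ℂ)) p = 0 ∧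
      (cdir ξ (cdir (cbar ξ) fun q => ((H q : ℝ) : ℂ)) p).re ≤ 0 := by
  have hd := differentiableAt_of_contDiffOn hO hH hp
  obtain ⟨a1, a2⟩ := second_derivative_test hO hH hp h1
  obtain ⟨b1, b2⟩ := second_derivative_test hO hH hp h2
  constructor
  · simp [cdir, fderiv_ofReal hd, a1, b1]
  · have hHc := contDiffOn_ofReal hH
    have key : ∀ a : E, fderiv ℝ (fderiv ℝ fun q => ((H q : ℝ) : ℂ)) p a a
        = (fderiv ℝ (fun q => fderiv ℝ H q a) p a : ℝ) := by
      intro a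
      rw [← fderiv_fderiv_apply hO hHc hp, ← fderiv_ofReal]
      · refine congrFun (congrArg DFunLike.coe (Filter.EventuallyEq.fderiv_eq ?_)) a
        filter_upwards [hO.mem_nhds hp] with q hq
        exact fderiv_ofReal (differentiableAt_of_contDiffOn hO hH hq) a
      · exact differentiableAt_of_contDiffOn hO
          ((hH.fderiv_of_isOpen (m := ∞) hO (by simp)).clm_apply contDiffOn_const) hp
    rw [cdir_cdir hO hHc hp]
    simp only [cbar, map_neg]
    rw [fderiv_fderiv_symm hO hHc hp ξ.1 ξ.2, key, key]
    simp
    linarith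

variable {F : ℝ → ℝ}

namespace LocalModel

variable (M : LocalModel n F O p)

lemma smooth_V (M : LocalModel n F O p) (hF : ContDiffOn ℝ ∞ F (Set.Ioi 0)) :
    ContDiffOn ℝ ∞ M.V O :=
  (hF.comp M.smooth_e M.e_pos).congr M.V_eq

lemma cdir_time_eq (M : LocalModel n F O p) {H : E → ℝ} (h : DifferentiableAt ℝ H p) :
    (cdir (M.τ, 0) (fun q => ((H q : ℝ) : ℂ)) p).re = fderiv ℝ H p M.τ := by
  simp [cdir, fderiv_ofReal h]

/-- The speed satisfies a linear parabolic equation, hence a maximum principle. -/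
lemma time_derivative_nonpos (hF : ContDiffOn ℝ ∞ F (Set.Ioi 0))
    (hF' : ∀ s, 0 < s → 0 < deriv F s) (σ : ℝ)
    (h1 : ∀ j, IsLocalMax (fun s : ℝ => σ * M.V (p + s • (M.d j).1)) 0)
    (h2 : ∀ j, IsLocalMax (fun s : ℝ => σ * M.V (p + s • (M.d j).2)) 0) :
    σ * fderiv ℝ M.V p M.τ ≤ 0 := by
  have hO := M.isOpen
  have hV := M.smooth_V hF
  rw [← M.cdir_time_eq (differentiableAt_of_contDiffOn hO hV M.mem), M.cdir_time_V hF,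
    mul_left_comm]
  refine mul_nonpos_of_nonneg_of_nonpos
    (mul_pos (hF' _ (M.e_pos _ M.mem)) (M.e_pos _ M.mem)).le ?_
  rw [Finset.mul_sum]
  refine Finset.sum_nonpos fun j _ => ?_
  rw [← mul_div_assoc]
  refine div_nonpos_of_nonpos_of_nonneg ?_ (M.l_pos j).le
  have h3 := (cdir_of_isLocalMax hO (contDiffOn_const.mul hV) M.mem (h1 j) (h2 j)).2
  have hVc := contDiffOn_ofReal hV
  have e : cdir (M.d j) (cdir (cbar (M.d j)) fun q => ((σ * M.V q : ℝ) : ℂ)) p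
      = σ * cdir (M.d j) (cdir (cbar (M.d j)) fun q => ((M.V q : ℝ) : ℂ)) p := by
    rw [← cdir_const_mul _ (differentiableAt_of_contDiffOn hO (contDiffOn_cdir hO hVc) M.mem)]
    refine cdir_congrOn hO (fun q hq => ?_) M.mem
    rw [← cdir_const_mul _ (differentiableAt_of_contDiffOn hO hVc hq)]
    simp
  rw [e, Complex.re_ofReal_mul] at h3
  exact h3

end LocalModel

/-- The function of the potential entering the test function. -/
def potentialTerm (A c y : ℝ) : ℝ := -A * (y - c) + 1 / (y - c + 1)

lemma hasDerivAt_potentialTerm (A c : ℝ) {y : ℝ} (hy : 0 < y - c + 1) :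
    HasDerivAt (potentialTerm A c) (-A - 1 / (y - c + 1) ^ 2) y := by
  have h1 : HasDerivAt (fun y : ℝ => y - c) 1 y := (hasDerivAt_id y).sub_const c
  have h2 := (h1.const_mul (-A)).add ((h1.add_const 1).inv hy.ne')
  refine (h2.congr_deriv ?_).congr_of_eventuallyEq (Filter.Eventually.of_forall fun z => ?_)
  · ring
  · simp [potentialTerm]

/-- This convexity is the purpose of the reciprocal summand: it supplies the positive multiple of
|∂u|² that absorbs the torsion. For y ≥ c the summand changes the slope by at most 1. -/
lemma deriv_deriv_potentialTerm (A c : ℝ) {y : ℝ} (hy : 0 < y - c + 1) :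
    deriv (deriv (potentialTerm A c)) y = 2 / (y - c + 1) ^ 3 := by
  have hev : deriv (potentialTerm A c) =ᶠ[nhds y] fun y => -A - ((y - c + 1) ^ 2)⁻¹ := by
    have : ∀ᶠ z in nhds y, 0 < z - c + 1 :=
      ContinuousAt.eventually_lt continuousAt_const (by fun_prop) hy
    filter_upwards [this] with z hz
    rw [(hasDerivAt_potentialTerm A c hz).deriv, one_div]
  rw [hev.deriv_eq]
  have h1 : HasDerivAt (fun y : ℝ => y - c + 1) 1 y := ((hasDerivAt_id y).sub_const c).add_const 1
  have h2 := ((h1.fun_pow 2).fun_inv (pow_ne_zero 2 hy.ne')).const_sub (-A)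
  rw [h2.deriv]
  push_cast
  field_simp

lemma contDiffOn_potentialTerm (A c : ℝ) :
    ContDiffOn ℝ ∞ (potentialTerm A c) {y | 0 < y - c + 1} := by
  unfold potentialTerm
  refine ContDiffOn.add (by fun_prop) (contDiffOn_const.div (by fun_prop) fun y hy => ?_)
  exact (ne_of_gt hy)

namespace LocalModel

variable (M : LocalModel n F O p)

/-- The second order estimate at a maximum point of the test function. -/
theorem inverse_trace_le (hF : ContDiffOn ℝ ∞ F (Set.Ioi 0))
    (hF' : ∀ s, 0 < s → 0 < deriv F s) {C K A B Ψ₀ β₀ c : ℝ} (hC : 0 ≤ C) (hK : 0 ≤ K)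
    (hβ₀ : 0 < β₀)
    (hχ : ∀ r j k, ‖mdir (M.d r) M.χ p j k‖ ≤ C)
    (hχ' : ∀ r j, ‖mdir (M.d r) (mdir (cbar (M.d r)) M.χ) p j j‖ ≤ C)
    (hN : ∀ r j, ‖mdir (M.d r) (mdir (cbar (M.d r)) M.N) p j j‖ ≤ C)
    (hρ : ∀ j, ‖cdir (M.d j) (cdir (cbar (M.d j)) M.ρ) p / M.ρ p
      - cdir (M.d j) M.ρ p * cdir (cbar (M.d j)) M.ρ p / M.ρ p ^ 2‖ ≤ C)
    (hΨ : |(deriv (deriv F) (M.e p) + deriv F (M.e p) / M.e p) / deriv F (M.e p) ^ 2| ≤ Ψ₀)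
    (hβ : β₀ ≤ deriv F (M.e p) * M.e p) (hV : |M.V p| ≤ K)
    (hB : B = Ψ₀ / β₀ + 1)
    (hA : A = 2 * n * C + C + n * C ^ 2 + 4 * n ^ 2 * C ^ 2
      + (2 * (n * C) ^ 2 + (2 * (n * C) * B * K) ^ 2) + 1)
    (hSpos : ∀ q ∈ O, 0 < M.S q) (hc : ∀ q ∈ O, 0 < M.U q - c + 1) (hc' : c ≤ M.U p)
    (hS : 1 ≤ M.S p) (hSr : (A + 1) ^ 2 * (M.U p - c + 1) ^ 3 ≤ M.S p ^ 2)
    (hmax : ∀ a : E, (∃ j, a = (M.d j).1 ∨ a = (M.d j).2) →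
      IsLocalMax (fun s : ℝ => Real.log (M.S (p + s • a)) + potentialTerm A c (M.U (p + s • a))
        + B / 2 * M.V (p + s • a) ^ 2) 0)
    (htime : -(2 * K * (A + 1)) ≤
      fderiv ℝ (fun q => Real.log (M.S q) + B / 2 * M.V q ^ 2) p M.τ) :
    ∑ j, 1 / M.l j ≤ n * C + (A + 1) * n + 2 * K * (A + 1) / β₀ := by
  have hO := M.isOpen
  have hp := M.mem
  have sS := M.smooth_S
  have sU := M.smoothU
  have sV := M.smooth_V hF
  have slog : ContDiffOn ℝ ∞ Real.log (Set.Ioi 0) := fun x hx =>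
    (Real.contDiffAt_log.2 (ne_of_gt hx)).contDiffWithinAt
  have sP := contDiffOn_potentialTerm A c
  have oP : IsOpen {y : ℝ | 0 < y - c + 1} := isOpen_lt continuous_const (by fun_prop)
  have sQ : ContDiffOn ℝ ∞ (fun v : ℝ => B / 2 * v ^ 2) Set.univ := by fun_prop
  have hQ' : ∀ v : ℝ, deriv (fun v : ℝ => B / 2 * v ^ 2) v = B * v := fun v => by
    have := ((hasDerivAt_id v).fun_pow 2).const_mul (B / 2)
    rw [show (fun v : ℝ => B / 2 * v ^ 2) = fun v => B / 2 * id v ^ 2 from rfl, this.deriv]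
    simp; ring
  have hQ'' : ∀ v : ℝ, deriv (deriv (fun v : ℝ => B / 2 * v ^ 2)) v = B := fun v => by
    rw [funext hQ']; simp
  have mQ : Set.MapsTo M.V O Set.univ := fun _ _ => Set.mem_univ _
  have c1 : ContDiffOn ℝ ∞ (fun q => Real.log (M.S q)) O := slog.comp sS hSpos
  have c2 : ContDiffOn ℝ ∞ (fun q => potentialTerm A c (M.U q)) O := sP.comp sU hc
  have c3 : ContDiffOn ℝ ∞ (fun q => B / 2 * M.V q ^ 2) O := sQ.comp sV mQ
  have d1 := contDiffOn_ofReal c1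
  have d2 := contDiffOn_ofReal c2
  have d3 := contDiffOn_ofReal c3
  have dd : ∀ {w : E → ℂ}, ContDiffOn ℝ ∞ w O → ∀ q ∈ O, DifferentiableAt ℝ w q :=
    fun h q hq => differentiableAt_of_contDiffOn hO h hq
  have split1 : ∀ ξ : E × E, ∀ q ∈ O, cdir ξ (fun q => ((Real.log (M.S q)
      + potentialTerm A c (M.U q) + B / 2 * M.V q ^ 2 : ℝ) : ℂ)) q
      = cdir ξ (fun q => ((Real.log (M.S q) : ℝ) : ℂ)) q
        + cdir ξ (fun q => ((potentialTerm A c (M.U q) : ℝ) : ℂ)) q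
        + cdir ξ (fun q => ((B / 2 * M.V q ^ 2 : ℝ) : ℂ)) q := by
    intro ξ q hq
    rw [← cdir_add (dd d1 q hq) (dd d2 q hq), ← cdir_add (dd (d1.add d2) q hq) (dd d3 q hq)]
    simp
  have split2 : ∀ ξ : E × E, cdir ξ (cdir (cbar ξ) (fun q => ((Real.log (M.S q)
      + potentialTerm A c (M.U q) + B / 2 * M.V q ^ 2 : ℝ) : ℂ))) p
      = cdir ξ (cdir (cbar ξ) (fun q => ((Real.log (M.S q) : ℝ) : ℂ))) p
        + cdir ξ (cdir (cbar ξ) (fun q => ((potentialTerm A c (M.U q) : ℝ) : ℂ))) p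
        + cdir ξ (cdir (cbar ξ) (fun q => ((B / 2 * M.V q ^ 2 : ℝ) : ℂ))) p := by
    intro ξ
    have k1 := contDiffOn_cdir (ξ := cbar ξ) hO d1
    have k2 := contDiffOn_cdir (ξ := cbar ξ) hO d2
    have k3 := contDiffOn_cdir (ξ := cbar ξ) hO d3
    rw [cdir_congrOn hO (fun q hq => split1 (cbar ξ) q hq) hp,
      ← cdir_add (dd k1 p hp) (dd k2 p hp), ← cdir_add (dd (k1.add k2) p hp) (dd k3 p hp)]
  have f1 : ∀ ξ, cdir ξ (fun q => ((Real.log (M.S q) : ℝ) : ℂ)) p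
      = cdir ξ (fun q => ((M.S q : ℝ) : ℂ)) p / (M.S p : ℝ) := fun ξ => by
    rw [cdir_comp_real (differentiableAt_of_contDiffOn hO sS hp)
      (differentiableAt_of_contDiffOn isOpen_Ioi slog (hSpos p hp)), Real.deriv_log]
    push_cast; ring
  have f2 : ∀ ξ, cdir ξ (fun q => ((potentialTerm A c (M.U q) : ℝ) : ℂ)) p
      = ((-A - 1 / (M.U p - c + 1) ^ 2 : ℝ) : ℂ) * cdir ξ (fun q => ((M.U q : ℝ) : ℂ)) p :=
    fun ξ => by
    rw [cdir_comp_real (differentiableAt_of_contDiffOn hO sU hp)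
      (hasDerivAt_potentialTerm A c (hc p hp)).differentiableAt,
      (hasDerivAt_potentialTerm A c (hc p hp)).deriv]
  have f3 : ∀ ξ, cdir ξ (fun q => ((B / 2 * M.V q ^ 2 : ℝ) : ℂ)) p
      = B * M.V p * cdir ξ (fun q => ((M.V q : ℝ) : ℂ)) p := fun ξ => by
    rw [cdir_comp_real (H := fun v => B / 2 * v ^ 2) (differentiableAt_of_contDiffOn hO sV hp)
      (by fun_prop), hQ']
    push_cast; ring
  have nsq : ∀ (ξ : E × E) (W : E → ℝ), cdir ξ (fun q => ((W q : ℝ) : ℂ)) p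
      * cdir (cbar ξ) (fun q => ((W q : ℝ) : ℂ)) p
      = ((‖cdir ξ (fun q => ((W q : ℝ) : ℂ)) p‖ ^ 2 : ℝ) : ℂ) := fun ξ W => by
    rw [cdir_cbar_real, Complex.mul_conj, Complex.normSq_eq_norm_sq]
  have s1 : ∀ ξ, (cdir ξ (cdir (cbar ξ) (fun q => ((Real.log (M.S q) : ℝ) : ℂ))) p).re
      = (cdir ξ (cdir (cbar ξ) (fun q => ((M.S q : ℝ) : ℂ))) p).re / M.S p
        - ‖cdir ξ (fun q => ((M.S q : ℝ) : ℂ)) p‖ ^ 2 / M.S p ^ 2 := fun ξ => by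
    rw [cdir_cdir_comp_real hO isOpen_Ioi sS slog hSpos hp, mul_assoc, nsq, Complex.add_re,
      Complex.re_ofReal_mul, Complex.re_ofReal_mul, Complex.ofReal_re, Real.deriv_log,
      Real.deriv_log', deriv_inv]
    ring
  have s2 : ∀ ξ, (cdir ξ (cdir (cbar ξ) (fun q => ((potentialTerm A c (M.U q) : ℝ) : ℂ))) p).re
      = 2 / (M.U p - c + 1) ^ 3 * ‖cdir ξ (fun q => ((M.U q : ℝ) : ℂ)) p‖ ^ 2
        + (-A - 1 / (M.U p - c + 1) ^ 2)
          * (cdir ξ (cdir (cbar ξ) (fun q => ((M.U q : ℝ) : ℂ))) p).re := fun ξ => by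
    rw [cdir_cdir_comp_real hO oP sU sP hc hp, mul_assoc, nsq, Complex.add_re,
      Complex.re_ofReal_mul, Complex.re_ofReal_mul, Complex.ofReal_re,
      (hasDerivAt_potentialTerm A c (hc p hp)).deriv, deriv_deriv_potentialTerm A c (hc p hp)]
  have s3 : ∀ ξ, (cdir ξ (cdir (cbar ξ) (fun q => ((B / 2 * M.V q ^ 2 : ℝ) : ℂ))) p).re
      = B * ‖cdir ξ (fun q => ((M.V q : ℝ) : ℂ)) p‖ ^ 2
        + B * M.V p * (cdir ξ (cdir (cbar ξ) (fun q => ((M.V q : ℝ) : ℂ))) p).re := fun ξ => by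
    rw [cdir_cdir_comp_real (H := fun v => B / 2 * v ^ 2) hO isOpen_univ sV sQ mQ hp, mul_assoc,
      nsq, Complex.add_re, Complex.re_ofReal_mul, Complex.re_ofReal_mul, Complex.ofReal_re, hQ',
      hQ'']
  have hess : ∀ j, (cdir (M.d j) (cdir (cbar (M.d j)) (fun q => ((M.U q : ℝ) : ℂ))) p).re
      = M.l j - 1 := fun j => by
    have h := congrFun (congrFun M.g_p j) j
    rw [Matrix.add_apply, M.χ_p, Matrix.one_apply_eq, Matrix.diagonal_apply_eq] at h
    have h' : cdir (M.d j) (cdir (cbar (M.d j)) (fun q => ((M.U q : ℝ) : ℂ))) p = M.l j - 1 := by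
      rw [← h]; simp [frameHessian]
    rw [h']; simp
  have hH : ContDiffOn ℝ ∞ (fun q => Real.log (M.S q) + potentialTerm A c (M.U q)
      + B / 2 * M.V q ^ 2) O := (c1.add c2).add c3
  have hmx : ∀ j, _ ∧ _ := fun j => cdir_of_isLocalMax hO hH hp (ξ := M.d j)
    (hmax _ ⟨j, Or.inl rfl⟩) (hmax _ ⟨j, Or.inr rfl⟩)
  rw [M.S_p] at hS hSr
  refine inverse_trace_bound M.l M.l_pos (fun r j k => mdir (M.d r) M.χ p j k)
    (fun r j k => mdir (M.d r) M.g p j k) M.torsion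
    (fun r j => (mdir (M.d r) (mdir (cbar (M.d r)) M.g) p j j).re)
    (fun r j => (mdir (M.d r) (mdir (cbar (M.d r)) M.χ) p j j).re)
    (fun r j => (mdir (M.d r) (mdir (cbar (M.d r)) M.N) p j j).re)
    (fun r j => ?_) hC hK hβ₀ hχ (fun r j => (Complex.abs_re_le_norm _).trans (hχ' r j))
    (fun r j => (Complex.abs_re_le_norm _).trans (hN r j)) _
    (fun j => (Complex.abs_re_le_norm _).trans (hρ j))
    (fun r => cdir (M.d r) (fun z => ((M.S z : ℝ) : ℂ)) p)
    (fun r => cdir (M.d r) (fun z => ((M.U z : ℝ) : ℂ)) p)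
    (fun r => cdir (M.d r) (fun z => ((M.V z : ℝ) : ℂ)) p)
    (fun r => (cdir (M.d r) (cdir (cbar (M.d r)) (fun z => ((M.S z : ℝ) : ℂ))) p).re)
    (fun r => (cdir (M.d r) (cdir (cbar (M.d r)) (fun z => ((M.V z : ℝ) : ℂ))) p).re)
    hΨ hβ hV (r := M.U p - c + 1) (by linarith) hB hA rfl hS hSr M.cdir_S M.cdir_cdir_S
    (M.cdir_cdir_V hF hF') (fun r => ?_) (Finset.sum_nonpos fun r _ => ?_) ?_
  · rw [← Complex.sub_re, M.fourth_order, Complex.sub_re]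
  · have h := (hmx r).1
    rw [split1 _ p hp, f1, f2, f3, M.S_p] at h
    exact h
  · refine div_nonpos_of_nonpos_of_nonneg ?_ (M.l_pos r).le
    have h := (hmx r).2
    rw [split2, Complex.add_re, Complex.add_re, s1, s2, s3, hess, M.S_p] at h
    linarith only [h]
  -- Only the trace and the speed are differentiated in time; the contribution of the potential has
  -- already been bounded and sits on the left of `htime`.
  · have hd : DifferentiableAt ℝ (fun q => Real.log (M.S q) + B / 2 * M.V q ^ 2) p :=
      differentiableAt_of_contDiffOn hO (c1.add c3) hp
    rw [← M.cdir_time_eq hd] at htime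
    have e : cdir (M.τ, 0) (fun q => ((Real.log (M.S q) + B / 2 * M.V q ^ 2 : ℝ) : ℂ)) p
        = cdir (M.τ, 0) (fun q => ((Real.log (M.S q) : ℝ) : ℂ)) p
          + cdir (M.τ, 0) (fun q => ((B / 2 * M.V q ^ 2 : ℝ) : ℂ)) p := by
      rw [← cdir_add (dd d1 p hp) (dd d3 p hp)]; simp
    rw [e, f1, f3, Complex.add_re, Complex.div_ofReal_re, ← Complex.ofReal_mul,
      Complex.re_ofReal_mul, M.cdir_time_S, M.cdir_time_V hF, M.S_p] at htime
    exact htime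

end LocalModel

end MaximumPrinciple

/-! ### Smoothness in charts, and Wirtinger derivatives under holomorphic maps. -/

section Charts

variable {n : ℕ} {X : Type*} [TopologicalSpace X] [ChartedSpace (Cn n) X]

lemma isManifold_real [IsManifold 𝓘(ℂ, Cn n) ω X] : IsManifold 𝓘(ℝ, Cn n) ∞ X := by
  refine isManifold_of_contDiffOn _ _ _ fun e e' he he' => ?_
  have h := (contDiffGroupoid ω 𝓘(ℂ, Cn n)).compatible he he'
  have h2 := mem_groupoid_of_pregroupoid.1
    ((contDiffGroupoid_le (m := (∞ : WithTop ℕ∞)) (n := ω) le_top) h)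
  have h3 := h2.1
  simp only [contDiffPregroupoid, modelWithCornersSelf_coe, modelWithCornersSelf_coe_symm,
    Set.range_id, Set.inter_univ, Function.id_comp, Function.comp_id, Set.preimage_id] at h3 ⊢
  exact h3.restrict_scalars ℝ

lemma contDiffOn_transition [IsManifold 𝓘(ℂ, Cn n) ω X]
    {e e' : OpenPartialHomeomorph X (Cn n)} (he : e ∈ atlas (Cn n) X) (he' : e' ∈ atlas (Cn n) X) :
    ContDiffOn ℂ ∞ (fun z => e (e'.symm z)) (e'.symm ≫ₕ e).source := by
  have h := (contDiffGroupoid ω 𝓘(ℂ, Cn n)).compatible he' he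
  have h2 := mem_groupoid_of_pregroupoid.1
    ((contDiffGroupoid_le (m := (∞ : WithTop ℕ∞)) (n := ω) le_top) h)
  have h3 := h2.1
  simp only [contDiffPregroupoid, modelWithCornersSelf_coe, modelWithCornersSelf_coe_symm,
    Set.range_id, Set.inter_univ, Function.id_comp, Function.comp_id, Set.preimage_id] at h3
  exact h3

lemma contDiffOn_spacetime_chart [IsManifold 𝓘(ℂ, Cn n) ω X] {I : Set ℝ} {u : ℝ → X → ℝ}
    (hu : ContMDiffOn (𝓘(ℝ, ℝ).prod 𝓘(ℝ, Cn n)) 𝓘(ℝ, ℝ) ∞ (fun p : ℝ × X => u p.1 p.2)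
      (I ×ˢ Set.univ))
    {e : OpenPartialHomeomorph X (Cn n)} (he : e ∈ atlas (Cn n) X) :
    ContDiffOn ℝ ∞ (fun q : ℝ × Cn n => u q.1 (e.symm q.2)) (I ×ˢ e.target) := by
  have := isManifold_real (n := n) (X := X)
  have h1 : ContMDiffOn 𝓘(ℝ, Cn n) 𝓘(ℝ, Cn n) ∞ e.symm e.target :=
    contMDiffOn_symm_of_mem_maximalAtlas
      (IsManifold.subset_maximalAtlas (I := 𝓘(ℝ, Cn n)) (n := ∞) he)
  have h2 : ContMDiffOn (𝓘(ℝ, ℝ).prod 𝓘(ℝ, Cn n)) (𝓘(ℝ, ℝ).prod 𝓘(ℝ, Cn n)) ∞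
      (Prod.map id e.symm) (I ×ˢ e.target) := contMDiffOn_id.prodMap h1
  have h3 := hu.comp h2 (fun q hq => ⟨hq.1, Set.mem_univ _⟩)
  rw [← modelWithCornersSelf_prod, chartedSpaceSelf_prod] at h3
  exact contMDiffOn_iff_contDiffOn.1 h3

lemma contDiffOn_chart [IsManifold 𝓘(ℂ, Cn n) ω X] {v : X → ℝ}
    (hv : ContMDiff 𝓘(ℝ, Cn n) 𝓘(ℝ, ℝ) ∞ v)
    {e : OpenPartialHomeomorph X (Cn n)} (he : e ∈ atlas (Cn n) X) :
    ContDiffOn ℝ ∞ (fun z => v (e.symm z)) e.target := by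
  have := isManifold_real (n := n) (X := X)
  have h1 : ContMDiffOn 𝓘(ℝ, Cn n) 𝓘(ℝ, Cn n) ∞ e.symm e.target :=
    contMDiffOn_symm_of_mem_maximalAtlas
      (IsManifold.subset_maximalAtlas (I := 𝓘(ℝ, Cn n)) (n := ∞) he)
  exact contMDiffOn_iff_contDiffOn.1 (hv.comp_contMDiffOn h1)

/-- The complexified direction `∂/∂z` along `v`. -/
def hol (v : Cn n) : Cn n × Cn n := ((1 / 2 : ℝ) • v, -((1 / 2 : ℝ) • (Complex.I • v)))

lemma fderiv_half (w : Cn n → ℂ) (z v : Cn n) :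
    fderiv ℝ w z ((1 / 2 : ℝ) • v) = (1 / 2 : ℂ) * fderiv ℝ w z v := by
  rw [map_smul, Complex.real_smul]; push_cast; ring

lemma dz_eq (j : Fin n) (w : Cn n → ℂ) (z : Cn n) : dz j w z = cdir (hol (stdVec j)) w z := by
  simp only [dz, cdir, hol, map_neg, fderiv_half]; ring

lemma dzbar_eq (j : Fin n) (w : Cn n → ℂ) (z : Cn n) :
    dzbar j w z = cdir (cbar (hol (stdVec j))) w z := by
  simp only [dzbar, cdir, hol, cbar, neg_neg, fderiv_half]; ring

lemma hessianMatrix_apply (v : X → ℝ) (e : OpenPartialHomeomorph X (Cn n)) (z : Cn n)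
    (k j : Fin n) : hessianMatrix v e z k j = cdir (hol (stdVec j))
      (cdir (cbar (hol (stdVec k))) fun y => ((v (e.symm y) : ℝ) : ℂ)) z := by
  rw [hessianMatrix, Matrix.of_apply, dz_eq]
  congr 1
  ext z
  exact dzbar_eq _ _ _

lemma vec_eq_sum (v : Cn n) : v = ∑ a, v a • stdVec a := by
  ext i
  simp [stdVec, Pi.single_apply]

lemma fderiv_smul_complex (w : Cn n → ℂ) (z v : Cn n) (c : ℂ) :
    fderiv ℝ w z (c • v) = c.re * fderiv ℝ w z v + c.im * fderiv ℝ w z (Complex.I • v) := by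
  have : c • v = c.re • v + c.im • (Complex.I • v) := by
    conv_lhs => rw [← Complex.re_add_im c]
    rw [add_smul, mul_smul, Complex.coe_smul, Complex.coe_smul]
  rw [this, map_add, map_smul, map_smul, Complex.real_smul, Complex.real_smul]

lemma cdir_hol (w : Cn n → ℂ) (z v : Cn n) : cdir (hol v) w z
    = (1 / 2) * (fderiv ℝ w z v - Complex.I * fderiv ℝ w z (Complex.I • v)) := by
  simp only [cdir, hol, map_neg, fderiv_half]; ring

lemma cdir_cbar_hol (w : Cn n → ℂ) (z v : Cn n) : cdir (cbar (hol v)) w z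
    = (1 / 2) * (fderiv ℝ w z v + Complex.I * fderiv ℝ w z (Complex.I • v)) := by
  simp only [cdir, hol, cbar, neg_neg, fderiv_half]; ring

lemma cdir_hol_smul (w : Cn n → ℂ) (z v : Cn n) (c : ℂ) :
    cdir (hol (c • v)) w z = c * cdir (hol v) w z := by
  rw [cdir_hol, cdir_hol, smul_smul, fderiv_smul_complex w z v c,
    fderiv_smul_complex w z v (Complex.I * c)]
  obtain ⟨a, b⟩ := c
  simp only [Complex.mul_re, Complex.mul_im, Complex.I_re, Complex.I_im]
  rw [Complex.mk_eq_add_mul_I]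
  push_cast
  linear_combination (1 / 2) * b * (fderiv ℝ w z (Complex.I • v)) * Complex.I_sq

lemma cdir_cbar_hol_smul (w : Cn n → ℂ) (z v : Cn n) (c : ℂ) :
    cdir (cbar (hol (c • v))) w z = conj c * cdir (cbar (hol v)) w z := by
  rw [cdir_cbar_hol, cdir_cbar_hol, smul_smul, fderiv_smul_complex w z v c,
    fderiv_smul_complex w z v (Complex.I * c)]
  obtain ⟨a, b⟩ := c
  simp only [Complex.mul_re, Complex.mul_im, Complex.I_re, Complex.I_im]
  rw [Complex.mk_eq_add_mul_I]
  simp only [map_add, map_mul, Complex.conj_ofReal, Complex.conj_I]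
  push_cast
  linear_combination (1 / 2) * b * (fderiv ℝ w z (Complex.I • v)) * Complex.I_sq

lemma cdir_hol_sum {ι : Type*} (s : Finset ι) (w : Cn n → ℂ) (z : Cn n) (v : ι → Cn n) :
    cdir (hol (∑ a ∈ s, v a)) w z = ∑ a ∈ s, cdir (hol (v a)) w z := by
  simp only [cdir_hol, Finset.smul_sum, map_sum, ← Finset.sum_sub_distrib, Finset.mul_sum]

lemma cdir_cbar_hol_sum {ι : Type*} (s : Finset ι) (w : Cn n → ℂ) (z : Cn n) (v : ι → Cn n) :
    cdir (cbar (hol (∑ a ∈ s, v a))) w z = ∑ a ∈ s, cdir (cbar (hol (v a))) w z := by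
  simp only [cdir_cbar_hol, Finset.smul_sum, map_sum, ← Finset.sum_add_distrib, Finset.mul_sum]

lemma cdir_hol_eq_sum (w : Cn n → ℂ) (z v : Cn n) :
    cdir (hol v) w z = ∑ a, v a * cdir (hol (stdVec a)) w z := by
  conv_lhs => rw [vec_eq_sum v]
  rw [cdir_hol_sum]
  exact Finset.sum_congr rfl fun a _ => cdir_hol_smul _ _ _ _

lemma cdir_cbar_hol_eq_sum (w : Cn n → ℂ) (z v : Cn n) :
    cdir (cbar (hol v)) w z = ∑ a, conj (v a) * cdir (cbar (hol (stdVec a))) w z := by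
  conv_lhs => rw [vec_eq_sum v]
  rw [cdir_cbar_hol_sum]
  exact Finset.sum_congr rfl fun a _ => cdir_cbar_hol_smul _ _ _ _

lemma fderiv_real_eq {G : Type*} [NormedAddCommGroup G] [NormedSpace ℂ G] {τ : Cn n → G}
    {z : Cn n} (h : DifferentiableAt ℂ τ z) (v : Cn n) : fderiv ℝ τ z v = fderiv ℂ τ z v := by
  rw [h.fderiv_restrictScalars ℝ]; rfl

lemma cdir_hol_comp {w : Cn n → ℂ} {τ : Cn n → Cn n} {z : Cn n} (hτ : DifferentiableAt ℂ τ z)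
    (hw : DifferentiableAt ℝ w (τ z)) (v : Cn n) :
    cdir (hol v) (fun y => w (τ y)) z = cdir (hol (fderiv ℂ τ z v)) w (τ z) := by
  have h : ∀ a, fderiv ℝ (fun y => w (τ y)) z a = fderiv ℝ w (τ z) (fderiv ℂ τ z a) := fun a => by
    rw [show (fun y => w (τ y)) = w ∘ τ from rfl, fderiv_comp z hw (hτ.restrictScalars ℝ),
      ContinuousLinearMap.comp_apply, fderiv_real_eq hτ]
  rw [cdir_hol, cdir_hol, h, h, map_smul]

lemma cdir_cbar_hol_comp {w : Cn n → ℂ} {τ : Cn n → Cn n} {z : Cn n}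
    (hτ : DifferentiableAt ℂ τ z) (hw : DifferentiableAt ℝ w (τ z)) (v : Cn n) :
    cdir (cbar (hol v)) (fun y => w (τ y)) z = cdir (cbar (hol (fderiv ℂ τ z v))) w (τ z) := by
  have h : ∀ a, fderiv ℝ (fun y => w (τ y)) z a = fderiv ℝ w (τ z) (fderiv ℂ τ z a) := fun a => by
    rw [show (fun y => w (τ y)) = w ∘ τ from rfl, fderiv_comp z hw (hτ.restrictScalars ℝ),
      ContinuousLinearMap.comp_apply, fderiv_real_eq hτ]
  rw [cdir_cbar_hol, cdir_cbar_hol, h, h, map_smul]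

/-- The Cauchy-Riemann equations. -/
lemma cdir_cbar_hol_holomorphic {w : Cn n → ℂ} {z : Cn n} (hw : DifferentiableAt ℂ w z)
    (v : Cn n) : cdir (cbar (hol v)) w z = 0 := by
  rw [cdir_cbar_hol, fderiv_real_eq hw, fderiv_real_eq hw, map_smul, smul_eq_mul]
  linear_combination (1 / 2) * fderiv ℂ w z v * Complex.I_sq

/-- The complex Jacobian matrix of a map `ℂⁿ → ℂⁿ`. -/
def jac (τ : Cn n → Cn n) (z : Cn n) : Matrix (Fin n) (Fin n) ℂ :=
  Matrix.of fun a k => (fderiv ℂ τ z (stdVec k)) a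

/-- The first derivative brings out the conjugate Jacobian, which is antiholomorphic, so the
holomorphic derivative does not hit it. No first order term appears and the complex Hessian is
tensorial. -/
lemma hessian_comp {w : Cn n → ℂ} {τ : Cn n → Cn n} {O O' : Set (Cn n)} (hO : IsOpen O)
    (hO' : IsOpen O') (hτ : ContDiffOn ℂ ∞ τ O) (hw : ContDiffOn ℝ ∞ w O') (hm : Set.MapsTo τ O O')
    {z : Cn n} (hz : z ∈ O) (k j : Fin n) :
    cdir (hol (stdVec j)) (cdir (cbar (hol (stdVec k))) fun y => w (τ y)) z
      = ∑ a, ∑ b, conj (jac τ z a k) * jac τ z b j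
        * cdir (hol (stdVec b)) (cdir (cbar (hol (stdVec a))) w) (τ z) := by
  have dτ : ∀ y ∈ O, DifferentiableAt ℂ τ y := fun y hy =>
    (hτ.contDiffAt (hO.mem_nhds hy)).differentiableAt (by simp)
  have dJ : ∀ a, DifferentiableAt ℂ (fun y => jac τ y a k) z := fun a => by
    have h1 : ContDiffOn ℂ ∞ (fderiv ℂ τ) O := hτ.fderiv_of_isOpen hO (by simp)
    have h2 : DifferentiableAt ℂ (fun y => fderiv ℂ τ y (stdVec k)) z :=
      ((h1.clm_apply contDiffOn_const).contDiffAt (hO.mem_nhds hz)).differentiableAt (by simp)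
    exact (EuclideanSpace.proj a : Cn n →L[ℂ] ℂ).differentiableAt.comp z h2
  have dW : ∀ a, DifferentiableAt ℝ (cdir (cbar (hol (stdVec a))) w) (τ z) := fun a =>
    differentiableAt_of_contDiffOn hO' (contDiffOn_cdir hO' hw) (hm hz)
  have dWτ : ∀ a, DifferentiableAt ℝ (fun y => cdir (cbar (hol (stdVec a))) w (τ y)) z := fun a =>
    (dW a).comp z ((dτ z hz).restrictScalars ℝ)
  have dJc : ∀ a, DifferentiableAt ℝ (fun y => conj (jac τ y a k)) z := fun a =>
    Complex.conjCLE.differentiableAt.comp z ((dJ a).restrictScalars ℝ)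
  have e : Set.EqOn (cdir (cbar (hol (stdVec k))) fun y => w (τ y))
      (fun y => ∑ a, conj (jac τ y a k) * cdir (cbar (hol (stdVec a))) w (τ y)) O := fun y hy => by
    rw [cdir_cbar_hol_comp (dτ y hy) (differentiableAt_of_contDiffOn hO' hw (hm hy)),
      cdir_cbar_hol_eq_sum]
    rfl
  rw [cdir_congrOn hO e hz, cdir_sum _ fun a _ => (dJc a).fun_mul (dWτ a)]
  refine Finset.sum_congr rfl fun a _ => ?_
  rw [cdir_mul (dJc a) (dWτ a), cdir_conj, cdir_cbar_hol_holomorphic (dJ a),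
    cdir_hol_comp (dτ z hz) (dW a), cdir_hol_eq_sum, map_zero, zero_mul, zero_add, Finset.mul_sum]
  exact Finset.sum_congr rfl fun b _ => by rw [mul_assoc]; rfl

end Charts

/-! ### Independence of the chart for trace, determinant and positivity. -/

section ChartChange

variable {n : ℕ} {X : Type*} [TopologicalSpace X] [ChartedSpace (Cn n) X]
variable (χ : HermitianMetric n X)

/-- The Hermitian form of `χ` at `x`, as a form on the model space. -/
def modelForm (x : X) : Cn n →ₗ⋆[ℂ] Cn n →ₗ[ℂ] ℂ := χ.form x

/-- The derivative of the inverse of a chart, between model spaces. -/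
def symmDeriv (e : OpenPartialHomeomorph X (Cn n)) (z : Cn n) : Cn n →L[ℂ] Cn n :=
  mfderiv 𝓘(ℂ, Cn n) 𝓘(ℂ, Cn n) e.symm z

lemma metricMatrix_apply (e : OpenPartialHomeomorph X (Cn n)) (z : Cn n) (k j : Fin n) :
    metricMatrix χ e z k j
      = modelForm χ (e.symm z) (symmDeriv e z (stdVec k)) (symmDeriv e z (stdVec j)) := rfl

lemma modelForm_symmDeriv (e : OpenPartialHomeomorph X (Cn n)) (z : Cn n) (v w : Cn n) :
    modelForm χ (e.symm z) (symmDeriv e z v) (symmDeriv e z w)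
      = ∑ a, ∑ b, conj (v a) * w b * metricMatrix χ e z a b := by
  have h : ∀ v : Cn n, symmDeriv e z v = ∑ a, v a • symmDeriv e z (stdVec a) := fun v => by
    conv_lhs => rw [vec_eq_sum v]
    rw [map_sum]
    exact Finset.sum_congr rfl fun a _ => map_smul _ _ _
  rw [h v, h w, map_sum (modelForm χ (e.symm z)), LinearMap.sum_apply]
  refine Finset.sum_congr rfl fun a _ => ?_
  rw [map_sum]
  refine Finset.sum_congr rfl fun b _ => ?_
  rw [map_smulₛₗ (modelForm χ (e.symm z)), LinearMap.smul_apply, map_smul, smul_eq_mul,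
    smul_eq_mul, mul_assoc, metricMatrix_apply]

lemma metricMatrix_isHermitian (e : OpenPartialHomeomorph X (Cn n)) (z : Cn n) :
    (metricMatrix χ e z).IsHermitian :=
  Matrix.IsHermitian.ext fun _ _ => χ.conj_symm _ _ _

variable [IsManifold 𝓘(ℂ, Cn n) ω X]

lemma metricMatrix_posDef {e : OpenPartialHomeomorph X (Cn n)} (he : e ∈ atlas (Cn n) X)
    {z : Cn n} (hz : z ∈ e.target) : (metricMatrix χ e z).PosDef := by
  have : IsManifold 𝓘(ℂ, Cn n) 1 X := IsManifold.of_le (n := ω) le_top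
  have hinj : Function.Injective (symmDeriv e z) :=
    (mdifferentiable_of_mem_atlas (I := 𝓘(ℂ, Cn n)) he).symm.mfderiv_injective hz
  refine Matrix.posDef_iff_dotProduct_mulVec.2 ⟨metricMatrix_isHermitian χ e z, fun x hx => ?_⟩
  set v : Cn n := WithLp.toLp 2 x
  have hv : v ≠ 0 := fun h => hx (by simpa [v] using h)
  have hdv : symmDeriv e z v ≠ 0 := fun h => hv (hinj (h.trans (map_zero _).symm))
  have e1 : star x ⬝ᵥ (metricMatrix χ e z).mulVec x
      = modelForm χ (e.symm z) (symmDeriv e z v) (symmDeriv e z v) := by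
    rw [modelForm_symmDeriv]
    simp only [dotProduct, Matrix.mulVec, Finset.mul_sum]
    refine Finset.sum_congr rfl fun a _ => Finset.sum_congr rfl fun b _ => ?_
    simp [v]; ring
  rw [e1, Complex.pos_iff]
  exact ⟨χ.pos_def _ _ hdv, (Complex.conj_eq_iff_im.1 (χ.conj_symm (e.symm z) _ _)).symm⟩

section Transition

variable {e e' : OpenPartialHomeomorph X (Cn n)}

lemma isOpen_transition_source : IsOpen (e'.symm ≫ₕ e).source := (e'.symm ≫ₕ e).open_source

lemma metricMatrix_transition (he : e ∈ atlas (Cn n) X) (he' : e' ∈ atlas (Cn n) X)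
    {x : X} (hx : x ∈ e.source) (hx' : x ∈ e'.source) :
    metricMatrix χ e' (e' x) = (jac (fun z => e (e'.symm z)) (e' x)).conjTranspose
      * metricMatrix χ e (e x) * jac (fun z => e (e'.symm z)) (e' x) := by
  have : IsManifold 𝓘(ℂ, Cn n) 1 X := IsManifold.of_le (n := ω) le_top
  have hz : e' x ∈ (e'.symm ≫ₕ e).source := by
    simp [hx', hx]
  have hτ : DifferentiableAt ℂ (fun z => e (e'.symm z)) (e' x) :=
    ((contDiffOn_transition he he').contDiffAt
      (isOpen_transition_source.mem_nhds hz)).differentiableAt (by simp)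
  have hτx : e (e'.symm (e' x)) = e x := by rw [e'.left_inv hx']
  have hD : symmDeriv e' (e' x) = (symmDeriv e (e x)).comp
      (fderiv ℂ (fun z => e (e'.symm z)) (e' x)) := by
    have h1 : MDifferentiableAt 𝓘(ℂ, Cn n) 𝓘(ℂ, Cn n) e.symm ((fun z => e (e'.symm z)) (e' x)) := by
      refine mdifferentiableAt_atlas_symm he ?_
      simp only [hτx]; exact e.map_source hx
    have h2 : (e'.symm : Cn n → X) =ᶠ[nhds (e' x)] e.symm ∘ fun z => e (e'.symm z) := by
      filter_upwards [isOpen_transition_source.mem_nhds hz] with y hy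
      have hy' : e'.symm y ∈ e.source := by
        have := hy; simp at this; exact this.2
      simp [e.left_inv hy']
    have h3 := mfderiv_comp (I := 𝓘(ℂ, Cn n)) (I' := 𝓘(ℂ, Cn n)) (I'' := 𝓘(ℂ, Cn n)) (e' x) h1
      hτ.mdifferentiableAt
    have h4 : symmDeriv e (e x) = symmDeriv e (e (e'.symm (e' x))) := by rw [hτx]
    rw [h4]
    refine h2.mfderiv_eq.trans (h3.trans ?_)
    rw [mfderiv_eq_fderiv]
    rfl
  have hform : modelForm χ (e'.symm (e' x)) = modelForm χ (e.symm (e x)) := by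
    rw [e'.left_inv hx', e.left_inv hx]
  ext k j
  rw [metricMatrix_apply, hform, hD, ContinuousLinearMap.comp_apply,
    ContinuousLinearMap.comp_apply, modelForm_symmDeriv]
  simp only [Matrix.mul_apply, Matrix.conjTranspose_apply, Finset.sum_mul]
  rw [Finset.sum_comm]
  refine Finset.sum_congr rfl fun b _ => Finset.sum_congr rfl fun a _ => ?_
  simp only [jac, Matrix.of_apply, Complex.star_def]
  ring

lemma hessianMatrix_transition (he : e ∈ atlas (Cn n) X) (he' : e' ∈ atlas (Cn n) X)
    {x : X} (hx : x ∈ e.source) (hx' : x ∈ e'.source) {v : X → ℝ}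
    (hv : ContDiffOn ℝ ∞ (fun z => v (e.symm z)) e.target) :
    hessianMatrix v e' (e' x) = (jac (fun z => e (e'.symm z)) (e' x)).conjTranspose
      * hessianMatrix v e (e x) * jac (fun z => e (e'.symm z)) (e' x) := by
  have hz : e' x ∈ (e'.symm ≫ₕ e).source := by
    simp [hx', hx]
  have hτx : e (e'.symm (e' x)) = e x := by rw [e'.left_inv hx']
  have hsrc : ∀ y ∈ (e'.symm ≫ₕ e).source, e'.symm y ∈ e.source := fun y hy => by
    have := hy; simp at this; exact this.2
  have hm : Set.MapsTo (fun z => e (e'.symm z)) (e'.symm ≫ₕ e).source e.target := fun y hy =>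
    e.map_source (hsrc y hy)
  have hvc := contDiffOn_ofReal hv
  ext k j
  have h1 := hessian_comp isOpen_transition_source e.open_target (contDiffOn_transition he he')
    hvc hm hz k j
  rw [hessianMatrix_apply]
  have h2 : cdir (hol (stdVec j)) (cdir (cbar (hol (stdVec k)))
      fun y => ((v (e'.symm y) : ℝ) : ℂ)) (e' x)
      = cdir (hol (stdVec j)) (cdir (cbar (hol (stdVec k)))
      fun y => ((v (e.symm (e (e'.symm y))) : ℝ) : ℂ)) (e' x) := by
    refine cdir_congrOn isOpen_transition_source (fun y hy => ?_) hz
    refine cdir_congrOn isOpen_transition_source (fun y hy => ?_) hy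
    simp only [e.left_inv (hsrc y hy)]
  rw [h2, h1]
  simp only [Matrix.mul_apply, Matrix.conjTranspose_apply, Finset.sum_mul, hτx]
  rw [Finset.sum_comm]
  refine Finset.sum_congr rfl fun b _ => Finset.sum_congr rfl fun a _ => ?_
  rw [hessianMatrix_apply, Complex.star_def]
  ring

end Transition

/-- The endomorphism `h` in the chart `e` at the coordinate `z`. -/
def chartH (v : X → ℝ) (e : OpenPartialHomeomorph X (Cn n)) (z : Cn n) :
    Matrix (Fin n) (Fin n) ℂ :=
  1 + (metricMatrix χ e z)⁻¹ * hessianMatrix v e z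

lemma one_add_inv_mul_conjugate {J A H : Matrix (Fin n) (Fin n) ℂ} (hJ : IsUnit J.det) :
    1 + (J.conjTranspose * A * J)⁻¹ * (J.conjTranspose * H * J) = J⁻¹ * (1 + A⁻¹ * H) * J := by
  have hJH : IsUnit J.conjTranspose.det := by
    rw [Matrix.det_conjTranspose]; exact hJ.star
  rw [Matrix.mul_inv_rev, Matrix.mul_inv_rev, Matrix.mul_add, Matrix.add_mul, Matrix.mul_one,
    Matrix.nonsing_inv_mul _ hJ]
  congr 1
  simp only [Matrix.mul_assoc]
  rw [← Matrix.mul_assoc J.conjTranspose⁻¹, Matrix.nonsing_inv_mul _ hJH, Matrix.one_mul]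

/-- The statement uses the preferred chart at each point, while the analysis needs one chart near a
point. Under a chart change g undergoes a congruence and h a similarity by the Jacobian. -/
lemma hMatrix_similar {e : OpenPartialHomeomorph X (Cn n)} (he : e ∈ atlas (Cn n) X) {x : X}
    (hx : x ∈ e.source) {v : X → ℝ} (hv : ContDiffOn ℝ ∞ (fun z => v (e.symm z)) e.target) :
    ∃ J : Matrix (Fin n) (Fin n) ℂ, IsUnit J.det ∧ hMatrix χ v x = J⁻¹ * chartH χ v e (e x) * J
      ∧ gMatrix χ v x = J.conjTranspose
        * (metricMatrix χ e (e x) + hessianMatrix v e (e x)) * J := by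
  have he' : chartAt (Cn n) x ∈ atlas (Cn n) X := chart_mem_atlas _ _
  have hx' : x ∈ (chartAt (Cn n) x).source := mem_chart_source _ _
  have hχ := metricMatrix_transition χ he he' hx hx'
  have hH := hessianMatrix_transition he he' hx hx' hv
  have d' := (metricMatrix_posDef χ he' ((chartAt (Cn n) x).map_source hx')).det_pos.ne'
  rw [hMatrix, gMatrix]
  generalize jac (fun z => e ((chartAt (Cn n) x).symm z)) ((chartAt (Cn n) x) x) = J at hχ hH
  -- Invertibility of the Jacobian is read off from the nonvanishing determinant of the transformed
  -- metric.
  rw [hχ] at d'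
  have hJ : IsUnit J.det := by
    rw [isUnit_iff_ne_zero]
    intro h0
    rw [Matrix.det_mul] at d'
    exact d' (by rw [h0, mul_zero])
  refine ⟨J, hJ, ?_, ?_⟩
  · rw [hχ, hH]
    exact one_add_inv_mul_conjugate hJ
  · rw [hχ, hH, Matrix.mul_add, Matrix.add_mul]

lemma trace_hMatrix {e : OpenPartialHomeomorph X (Cn n)} (he : e ∈ atlas (Cn n) X) {x : X}
    (hx : x ∈ e.source) {v : X → ℝ} (hv : ContDiffOn ℝ ∞ (fun z => v (e.symm z)) e.target) :
    (hMatrix χ v x).trace = (chartH χ v e (e x)).trace := by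
  obtain ⟨J, hJ, h, -⟩ := hMatrix_similar χ he hx hv
  rw [h, Matrix.trace_mul_comm, ← Matrix.mul_assoc, Matrix.mul_nonsing_inv _ hJ, Matrix.one_mul]

lemma det_hMatrix {e : OpenPartialHomeomorph X (Cn n)} (he : e ∈ atlas (Cn n) X) {x : X}
    (hx : x ∈ e.source) {v : X → ℝ} (hv : ContDiffOn ℝ ∞ (fun z => v (e.symm z)) e.target) :
    (hMatrix χ v x).det = (chartH χ v e (e x)).det := by
  obtain ⟨J, hJ, h, -⟩ := hMatrix_similar χ he hx hv
  rw [h, Matrix.det_mul, Matrix.det_mul, mul_right_comm, ← Matrix.det_mul,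
    Matrix.nonsing_inv_mul _ hJ, Matrix.det_one, one_mul]

lemma posDef_gMatrix_iff {e : OpenPartialHomeomorph X (Cn n)} (he : e ∈ atlas (Cn n) X) {x : X}
    (hx : x ∈ e.source) {v : X → ℝ} (hv : ContDiffOn ℝ ∞ (fun z => v (e.symm z)) e.target) :
    (gMatrix χ v x).PosDef ↔ (metricMatrix χ e (e x) + hessianMatrix v e (e x)).PosDef := by
  obtain ⟨J, hJ, -, h⟩ := hMatrix_similar χ he hx hv
  rw [h]
  have hU : IsUnit J := (Matrix.isUnit_iff_isUnit_det J).2 hJ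
  exact Matrix.IsUnit.posDef_star_left_conjugate_iff hU

end ChartChange

/-! ### Spatial derivatives of functions on space-time. -/

section Spacetime

variable {n : ℕ}

/-- A complexified spatial direction, as a direction in space-time. -/
def spatial (ξ : Cn n × Cn n) : (ℝ × Cn n) × (ℝ × Cn n) := ((0, ξ.1), (0, ξ.2))

lemma cbar_spatial (ξ : Cn n × Cn n) : cbar (spatial ξ) = spatial (cbar ξ) := by
  simp [cbar, spatial]

lemma fderiv_slice {I : Set ℝ} {Ω : Set (Cn n)} (hΩ : IsOpen Ω) {W : ℝ × Cn n → ℂ}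
    (hW : ContDiffOn ℝ ∞ W (I ×ˢ Ω)) {q : ℝ × Cn n} (hq : q ∈ I ×ˢ Ω) (v : Cn n) :
    fderiv ℝ (fun z => W (q.1, z)) q.2 v = fderivWithin ℝ W (I ×ˢ Ω) q (0, v) := by
  have h1 : HasFDerivWithinAt W (fderivWithin ℝ W (I ×ˢ Ω) q) (I ×ˢ Ω) (q.1, q.2) :=
    ((hW q hq).differentiableWithinAt (by simp)).hasFDerivWithinAt
  have h2 : HasFDerivWithinAt (fun z : Cn n => (q.1, z)) (ContinuousLinearMap.inr ℝ ℝ (Cn n)) Ω q.2 :=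
    (hasFDerivAt_prodMk_right q.1 q.2).hasFDerivWithinAt
  have h3 := h1.comp q.2 h2 (fun z hz => ⟨hq.1, hz⟩)
  have h4 := h3.hasFDerivAt (hΩ.mem_nhds hq.2)
  have h5 : fderiv ℝ (fun z => W (q.1, z)) q.2
    = (fderivWithin ℝ W (I ×ˢ Ω) q).comp (ContinuousLinearMap.inr ℝ ℝ (Cn n)) := h4.fderiv
  rw [h5]; simp

/-- Joint smoothness of spatial derivatives up to the ends of the time interval: the slice
derivative is a component of the derivative within I × Ω, which is smooth there. -/
lemma contDiffOn_cdir_slice {I : Set ℝ} (hI : UniqueDiffOn ℝ I) {Ω : Set (Cn n)} (hΩ : IsOpen Ω)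
    {W : ℝ × Cn n → ℂ} (hW : ContDiffOn ℝ ∞ W (I ×ˢ Ω)) (ξ : Cn n × Cn n) :
    ContDiffOn ℝ ∞ (fun q => cdir ξ (fun z => W (q.1, z)) q.2) (I ×ˢ Ω) := by
  have h1 : ContDiffOn ℝ ∞ (fderivWithin ℝ W (I ×ˢ Ω)) (I ×ˢ Ω) :=
    hW.fderivWithin (hI.prod hΩ.uniqueDiffOn) (by simp)
  have h2 : ContDiffOn ℝ ∞ (fun q => fderivWithin ℝ W (I ×ˢ Ω) q (0, ξ.1)
      + Complex.I * fderivWithin ℝ W (I ×ˢ Ω) q (0, ξ.2)) (I ×ˢ Ω) :=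
    (h1.clm_apply contDiffOn_const).add
      (contDiffOn_const.mul (h1.clm_apply contDiffOn_const))
  refine h2.congr fun q hq => ?_
  simp only [cdir, fderiv_slice hΩ hW hq]

lemma cdir_spatial {W : ℝ × Cn n → ℂ} {q : ℝ × Cn n} (hW : DifferentiableAt ℝ W q)
    (ξ : Cn n × Cn n) : cdir (spatial ξ) W q = cdir ξ (fun z => W (q.1, z)) q.2 := by
  have h : ∀ v, fderiv ℝ (fun z => W (q.1, z)) q.2 v = fderiv ℝ W q (0, v) := fun v => by
    have h1 : HasFDerivAt W (fderiv ℝ W q) (q.1, q.2) := hW.hasFDerivAt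
    have h3 := h1.comp q.2 (hasFDerivAt_prodMk_right (𝕜 := ℝ) q.1 q.2)
    have h5 : fderiv ℝ (fun z => W (q.1, z)) q.2
      = (fderiv ℝ W q).comp (ContinuousLinearMap.inr ℝ ℝ (Cn n)) := h3.fderiv
    rw [h5]; simp
  simp only [cdir, spatial, h]

end Spacetime

/-! ### Persistence of positivity, and simultaneous diagonalization. -/

section Positivity

variable {m : Type*} [Fintype m] [DecidableEq m]

lemma continuous_quadratic {Y : Type*} [TopologicalSpace Y] {M : Y → Matrix m m ℂ}
    (hM : Continuous M) :
    Continuous fun p : Y × (m → ℂ) => (star p.2 ⬝ᵥ (M p.1).mulVec p.2).re := by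
  refine Complex.continuous_re.comp ?_
  exact (continuous_snd.star).dotProduct ((hM.comp continuous_fst).matrix_mulVec continuous_snd)

lemma im_quadratic_eq_zero {A : Matrix m m ℂ} (hA : A.IsHermitian) (x : m → ℂ) :
    (star x ⬝ᵥ A.mulVec x).im = 0 := by
  rw [← Complex.conj_eq_iff_im, ← Complex.star_def]
  conv_rhs => rw [Matrix.star_dotProduct, Matrix.star_mulVec, hA.eq, ← Matrix.dotProduct_mulVec]

lemma posDef_iff_sphere {A : Matrix m m ℂ} (hA : A.IsHermitian) :
    A.PosDef ↔ ∀ x ∈ Metric.sphere (0 : m → ℂ) 1, 0 < (star x ⬝ᵥ A.mulVec x).re := by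
  constructor
  · intro h x hx
    have hx0 : x ≠ 0 := by rintro rfl; simp at hx
    exact (Complex.pos_iff.1 (h.dotProduct_mulVec_pos hx0)).1
  · intro h
    refine Matrix.posDef_iff_dotProduct_mulVec.2 ⟨hA, fun x hx => ?_⟩
    have hn : ‖x‖ ≠ 0 := norm_ne_zero_iff.2 hx
    have h1 := h (((‖x‖⁻¹ : ℝ) : ℂ) • x) (by simp [norm_smul, hn])
    have him := im_quadratic_eq_zero hA x
    rw [Matrix.mulVec_smul, star_smul, smul_dotProduct, dotProduct_smul, smul_eq_mul, smul_eq_mul,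
      Complex.star_def, Complex.conj_ofReal, Complex.re_ofReal_mul, Complex.re_ofReal_mul] at h1
    rw [Complex.pos_iff]
    refine ⟨?_, him.symm⟩
    have h2 : 0 < ‖x‖⁻¹ := by positivity
    exact pos_of_mul_pos_right (pos_of_mul_pos_right h1 h2.le) h2.le

/-- A continuous path of invertible Hermitian matrices stays positive definite. -/
lemma posDef_of_path {I : Set ℝ} (hI : IsPreconnected I) {M : ℝ → Matrix m m ℂ}
    (hc : ContinuousOn M I) (hh : ∀ t ∈ I, (M t).IsHermitian) (hd : ∀ t ∈ I, (M t).det ≠ 0)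
    {t₀ : ℝ} (ht₀ : t₀ ∈ I) (h₀ : (M t₀).PosDef) : ∀ t ∈ I, (M t).PosDef := by
  have : PreconnectedSpace I := isPreconnected_iff_preconnectedSpace.1 hI
  have hc' : Continuous fun t : I => M t := continuousOn_iff_continuous_domRestrict.1 hc
  have hq := continuous_quadratic hc'
  have hclopen : IsClopen {t : I | (M t).PosDef} := by
    constructor
    -- Closedness: semidefiniteness is a closed condition, and it upgrades to definiteness because
    -- the determinant is nonzero.
    · have : {t : I | (M t).PosDef} = ⋂ x : m → ℂ, {t : I | 0 ≤ (star x ⬝ᵥ (M t).mulVec x).re} := by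
        ext t
        simp only [Set.mem_ofPred_eq, Set.mem_iInter]
        constructor
        · intro h x
          exact (Complex.nonneg_iff.1 (h.posSemidef.dotProduct_mulVec_nonneg x)).1
        · intro h
          have hps : (M t).PosSemidef := by
            refine Matrix.posSemidef_iff_dotProduct_mulVec.2 ⟨hh t t.2, fun x => ?_⟩
            have him := im_quadratic_eq_zero (hh t t.2) x
            rw [Complex.nonneg_iff]
            exact ⟨h x, him.symm⟩
          exact hps.posDef_iff_det_ne_zero.2 (hd t t.2)
      rw [this]
      exact isClosed_iInter fun x => isClosed_le continuous_const
        (hq.comp (continuous_id.prodMk continuous_const))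
    -- Openness: positivity on the compact unit sphere is stable under small changes of t.
    · rw [isOpen_iff_mem_nhds]
      intro t ht
      have h1 := (posDef_iff_sphere (hh t t.2)).1 ht
      have h2 : ∀ᶠ s : I in nhds t, ∀ x ∈ Metric.sphere (0 : m → ℂ) 1,
          0 < (star x ⬝ᵥ (M s).mulVec x).re := by
        refine IsCompact.eventually_forall_of_forall_eventually (isCompact_sphere _ _)
          fun x hx => ?_
        exact continuousAt_const.eventually_lt hq.continuousAt (h1 x hx)
      filter_upwards [h2] with s hs
      exact (posDef_iff_sphere (hh s s.2)).2 hs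
  have huniv := hclopen.eq_univ ⟨⟨t₀, ht₀⟩, h₀⟩
  intro t ht
  have : (⟨t, ht⟩ : I) ∈ {t : I | (M t).PosDef} := huniv ▸ Set.mem_univ _
  exact this

/-- Simultaneous diagonalization of a metric and a positive Hermitian form. -/
lemma exists_diagonalizing_frame {A G : Matrix m m ℂ} (hA : A.PosDef) (hG : G.PosDef) :
    ∃ (P : Matrix m m ℂ) (l : m → ℝ), IsUnit P.det ∧ P.conjTranspose * A * P = 1
      ∧ P.conjTranspose * G * P = Matrix.diagonal (fun j => (l j : ℂ)) ∧ ∀ j, 0 < l j := by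
  -- A is first normalized to the identity by rescaling its eigenvectors; a unitary then
  -- diagonalizes G without disturbing this.
  obtain ⟨Q, hQ, hAQ⟩ : ∃ Q : Matrix m m ℂ, IsUnit Q.det ∧ Q.conjTranspose * A * Q = 1 := by
    let W := hA.1.eigenvectorUnitary
    let D : Matrix m m ℂ := Matrix.diagonal fun j => ((Real.sqrt (hA.1.eigenvalues j))⁻¹ : ℝ)
    have hev := hA.eigenvalues_pos
    have h1 : (W : Matrix m m ℂ).conjTranspose * A * W
        = Matrix.diagonal fun j => (hA.1.eigenvalues j : ℂ) := by
      have := hA.1.conjStarAlgAut_star_eigenvectorUnitary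
      rw [Unitary.conjStarAlgAut_apply] at this
      simpa [Matrix.star_eq_conjTranspose, Function.comp_def] using this
    have hD : D.conjTranspose = D := by
      simp only [D, Matrix.diagonal_conjTranspose]
      congr 1; ext j; simp
    have h2 : ((W : Matrix m m ℂ) * D).conjTranspose * A * (W * D) = 1 := by
      rw [Matrix.conjTranspose_mul, hD]
      calc D * (W : Matrix m m ℂ).conjTranspose * A * (W * D)
          = D * ((W : Matrix m m ℂ).conjTranspose * A * W) * D := by simp only [Matrix.mul_assoc]
        _ = 1 := by
          rw [h1, Matrix.diagonal_mul_diagonal, Matrix.diagonal_mul_diagonal,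
            ← Matrix.diagonal_one]
          congr 1; ext j
          have hs := Real.mul_self_sqrt (hev j).le
          have hp : Real.sqrt (hA.1.eigenvalues j) ≠ 0 := (Real.sqrt_pos.2 (hev j)).ne'
          norm_cast
          field_simp
          linarith
    refine ⟨W * D, ?_, h2⟩
    have h3 := congrArg Matrix.det h2
    rw [Matrix.det_mul, Matrix.det_one] at h3
    exact IsUnit.of_mul_eq_one_right _ h3
  have hGQ : (Q.conjTranspose * G * Q).PosDef :=
    (Matrix.IsUnit.posDef_star_left_conjugate_iff
      ((Matrix.isUnit_iff_isUnit_det Q).2 hQ)).2 hG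
  let W := hGQ.1.eigenvectorUnitary
  have h1 : (W : Matrix m m ℂ).conjTranspose * (Q.conjTranspose * G * Q) * W
      = Matrix.diagonal fun j => (hGQ.1.eigenvalues j : ℂ) := by
    have := hGQ.1.conjStarAlgAut_star_eigenvectorUnitary
    rw [Unitary.conjStarAlgAut_apply] at this
    simpa [Matrix.star_eq_conjTranspose, Function.comp_def] using this
  have hW : (W : Matrix m m ℂ).conjTranspose * W = 1 := Unitary.coe_star_mul_self W
  refine ⟨Q * W, hGQ.1.eigenvalues, ?_, ?_, ?_, hGQ.eigenvalues_pos⟩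
  · rw [Matrix.det_mul]
    refine hQ.mul ?_
    have h3 := congrArg Matrix.det hW
    rw [Matrix.det_mul, Matrix.det_one] at h3
    exact IsUnit.of_mul_eq_one_right _ h3
  · rw [Matrix.conjTranspose_mul]
    calc (W : Matrix m m ℂ).conjTranspose * Q.conjTranspose * A * (Q * W)
        = (W : Matrix m m ℂ).conjTranspose * (Q.conjTranspose * A * Q) * W := by
          simp only [Matrix.mul_assoc]
      _ = 1 := by rw [hAQ, Matrix.mul_one, hW]
  · rw [← h1, Matrix.conjTranspose_mul]
    simp only [Matrix.mul_assoc]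

end Positivity

/-! ### Bounds in a frame from bounds in coordinates. -/

section FrameBounds

variable {n : ℕ}

section

variable {E : Type*} [NormedAddCommGroup E] [NormedSpace ℝ E] {O : Set E} {p : E}
variable {m : Type*} [Fintype m] [DecidableEq m]

lemma MSmoothOn.const_mul_mul_const {A : E → Matrix m m ℂ} (hA : MSmoothOn A O)
    (P Q : Matrix m m ℂ) : MSmoothOn (fun q => P * A q * Q) O :=
  ((msmoothOn_const P).mul hA).mul (msmoothOn_const Q)

lemma mdir_const_mul_mul_const (hO : IsOpen O) {A : E → Matrix m m ℂ} (hA : MSmoothOn A O)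
    (P Q : Matrix m m ℂ) (hp : p ∈ O) (ξ : E × E) :
    mdir ξ (fun q => P * A q * Q) p = P * mdir ξ A p * Q := by
  rw [mdir_mul (M := fun q => P * A q) hO ((msmoothOn_const P).mul hA) (msmoothOn_const Q) hp,
    mdir_mul (M := fun _ => P) hO (msmoothOn_const P) hA hp, mdir_const, mdir_const]
  simp

lemma mdir_mdir_const_mul_mul_const (hO : IsOpen O) {A : E → Matrix m m ℂ} (hA : MSmoothOn A O)
    (P Q : Matrix m m ℂ) (hp : p ∈ O) (ξ η : E × E) :
    mdir ξ (mdir η fun q => P * A q * Q) p = P * mdir ξ (mdir η A) p * Q := by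
  rw [mdir_congrOn hO (fun q hq => mdir_const_mul_mul_const hO hA P Q hq η) hp,
    mdir_const_mul_mul_const hO (hA.mdir hO) P Q hp]

end

lemma norm_sum_mul_le (c w : Fin n → ℂ) {K L : ℝ} (hK : 0 ≤ K) (hc : ∀ a, ‖c a‖ ≤ K)
    (hw : ∀ a, ‖w a‖ ≤ L) : ‖∑ a, c a * w a‖ ≤ n * (K * L) := by
  refine (norm_sum_le _ _).trans ((Finset.sum_le_sum (g := fun _ => K * L) fun a _ => ?_).trans ?_)
  · rw [norm_mul]
    exact mul_le_mul (hc a) (hw a) (norm_nonneg _) hK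
  · simp

lemma norm_mul_mul_le {P A Q : Matrix (Fin n) (Fin n) ℂ} {K L : ℝ} (hK : 0 ≤ K)
    (hP : ∀ i j, ‖P i j‖ ≤ K) (hQ : ∀ i j, ‖Q i j‖ ≤ K) (hA : ∀ i j, ‖A i j‖ ≤ L) (i j : Fin n) :
    ‖(P * A * Q) i j‖ ≤ n * (K * (n * (K * L))) := by
  rw [Matrix.mul_apply]
  simp only [mul_comm ((P * A) i _)]
  refine norm_sum_mul_le _ _ hK (fun a => hQ a j) fun a => ?_
  rw [Matrix.mul_apply]
  exact norm_sum_mul_le _ _ hK (fun b => hP i b) fun b => hA b a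

/-- The diagonal entries of PP* are the squared norms of the rows of P. Applied to χ⁻¹ and χ, this
bounds the frame and its inverse whatever the eigenvalues of g are. -/
lemma norm_entry_le {P A : Matrix (Fin n) (Fin n) ℂ} (h : A = P * P.conjTranspose) {K : ℝ}
    (hK : 1 ≤ K) (hA : ∀ a, ‖A a a‖ ≤ K) (a j : Fin n) : ‖P a j‖ ≤ K := by
  have h1 : A a a = ((∑ b, ‖P a b‖ ^ 2 : ℝ) : ℂ) := by
    rw [h, Matrix.mul_apply]
    push_cast
    refine Finset.sum_congr rfl fun b _ => ?_
    rw [Matrix.conjTranspose_apply, Complex.star_def, Complex.mul_conj, Complex.normSq_eq_norm_sq]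
    push_cast; rfl
  have h2 : ‖P a j‖ ^ 2 ≤ ∑ b, ‖P a b‖ ^ 2 :=
    Finset.single_le_sum (f := fun b => ‖P a b‖ ^ 2) (fun b _ => sq_nonneg _) (Finset.mem_univ j)
  have h3 : ∑ b, ‖P a b‖ ^ 2 ≤ K := by
    have := hA a
    rw [h1, Complex.norm_real] at this
    exact (le_abs_self _).trans this
  nlinarith [norm_nonneg (P a j)]

variable {Ω : Set (Cn n)} {z : Cn n}

lemma norm_cdir_hol_le {w : Cn n → ℂ} {v : Cn n} {K L : ℝ} (hK : 0 ≤ K) (hv : ∀ a, ‖v a‖ ≤ K)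
    (hw : ∀ a, ‖cdir (hol (stdVec a)) w z‖ ≤ L) : ‖cdir (hol v) w z‖ ≤ n * (K * L) := by
  rw [cdir_hol_eq_sum]
  exact norm_sum_mul_le _ _ hK hv hw

lemma cdir_hol_cdir_cbar_eq_sum (hΩ : IsOpen Ω) {w : Cn n → ℂ} (hw : ContDiffOn ℝ ∞ w Ω)
    (hz : z ∈ Ω) (v v' : Cn n) :
    cdir (hol v) (cdir (cbar (hol v')) w) z
      = ∑ a, conj (v' a) * ∑ b, v b * cdir (hol (stdVec b)) (cdir (cbar (hol (stdVec a))) w) z := by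
  have hd : ∀ a, DifferentiableAt ℝ (cdir (cbar (hol (stdVec a))) w) z := fun a =>
    differentiableAt_of_contDiffOn hΩ (contDiffOn_cdir hΩ hw) hz
  rw [cdir_congrOn hΩ (fun y _ => cdir_cbar_hol_eq_sum w y v') hz,
    cdir_sum (W := fun a y => conj (v' a) * cdir (cbar (hol (stdVec a))) w y) _
      fun a _ => (hd a).const_mul _]
  refine Finset.sum_congr rfl fun a _ => ?_
  rw [cdir_const_mul _ (hd a), cdir_hol_eq_sum]

lemma norm_cdir_hol_cdir_cbar_le (hΩ : IsOpen Ω) {w : Cn n → ℂ} (hw : ContDiffOn ℝ ∞ w Ω)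
    (hz : z ∈ Ω) {v : Cn n} {K L : ℝ} (hK : 0 ≤ K) (hv : ∀ a, ‖v a‖ ≤ K)
    (hL : ∀ a b, ‖cdir (hol (stdVec b)) (cdir (cbar (hol (stdVec a))) w) z‖ ≤ L) :
    ‖cdir (hol v) (cdir (cbar (hol v)) w) z‖ ≤ n * (K * (n * (K * L))) := by
  rw [cdir_hol_cdir_cbar_eq_sum hΩ hw hz]
  refine norm_sum_mul_le _ _ hK (fun a => by rw [RCLike.norm_conj]; exact hv a) fun a => ?_
  exact norm_sum_mul_le _ _ hK hv fun b => hL a b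

/-- The logarithmic second derivative of a density. -/
def logHessian (ξ η : Cn n × Cn n) (w : Cn n → ℂ) (z : Cn n) : ℂ :=
  cdir ξ (cdir η w) z / w z - cdir ξ w z * cdir η w z / w z ^ 2

lemma norm_logHessian_le (hΩ : IsOpen Ω) {w : Cn n → ℂ} (hw : ContDiffOn ℝ ∞ w Ω)
    (hz : z ∈ Ω) {v : Cn n} {K L : ℝ} (hK : 0 ≤ K) (hv : ∀ a, ‖v a‖ ≤ K)
    (hL : ∀ a b, ‖logHessian (hol (stdVec b)) (cbar (hol (stdVec a))) w z‖ ≤ L) :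
    ‖logHessian (hol v) (cbar (hol v)) w z‖ ≤ n * (K * (n * (K * L))) := by
  have : logHessian (hol v) (cbar (hol v)) w z = ∑ a, conj (v a) * ∑ b, v b
      * logHessian (hol (stdVec b)) (cbar (hol (stdVec a))) w z := by
    simp only [logHessian]
    rw [cdir_hol_cdir_cbar_eq_sum hΩ hw hz, cdir_hol_eq_sum, cdir_cbar_hol_eq_sum,
      Finset.sum_mul_sum, Finset.sum_div, Finset.sum_comm, Finset.sum_div,
      ← Finset.sum_sub_distrib]
    refine Finset.sum_congr rfl fun a _ => ?_
    rw [Finset.sum_div, mul_div_assoc, Finset.sum_div, Finset.mul_sum, Finset.mul_sum,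
      ← Finset.sum_sub_distrib]
    exact Finset.sum_congr rfl fun b _ => by ring
  rw [this]
  refine norm_sum_mul_le _ _ hK (fun a => by rw [RCLike.norm_conj]; exact hv a) fun a => ?_
  exact norm_sum_mul_le _ _ hK hv fun b => hL a b

end FrameBounds

/-! ### Time-independent functions on space-time. -/

section Static

variable {n : ℕ} {Ω : Set (Cn n)}

lemma contDiffOn_comp_snd {w : Cn n → ℂ} (hw : ContDiffOn ℝ ∞ w Ω) {O : Set (ℝ × Cn n)}
    (hO : ∀ q ∈ O, q.2 ∈ Ω) : ContDiffOn ℝ ∞ (fun q : ℝ × Cn n => w q.2) O :=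
  hw.comp contDiffOn_snd hO

lemma cdir_snd {w : Cn n → ℂ} {q : ℝ × Cn n} (hw : DifferentiableAt ℝ w q.2) (ξ : Cn n × Cn n) :
    cdir (spatial ξ) (fun q : ℝ × Cn n => w q.2) q = cdir ξ w q.2 :=
  cdir_spatial (W := fun q => w q.2) (hw.comp q differentiableAt_snd) ξ

lemma cdir_cdir_snd (hΩ : IsOpen Ω) {w : Cn n → ℂ} (hw : ContDiffOn ℝ ∞ w Ω) {q : ℝ × Cn n}
    (hq : q.2 ∈ Ω) (ξ η : Cn n × Cn n) :
    cdir (spatial ξ) (cdir (spatial η) fun q : ℝ × Cn n => w q.2) q = cdir ξ (cdir η w) q.2 := by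
  have hO : IsOpen (Prod.snd ⁻¹' Ω : Set (ℝ × Cn n)) := hΩ.preimage continuous_snd
  rw [cdir_congrOn (w' := fun q : ℝ × Cn n => cdir η w q.2) hO
    (fun y hy => cdir_snd (differentiableAt_of_contDiffOn hΩ hw hy) η) hq,
    cdir_snd (differentiableAt_of_contDiffOn hΩ (contDiffOn_cdir hΩ hw) hq)]

lemma cdir_time_snd {w : Cn n → ℂ} {q : ℝ × Cn n} (hw : DifferentiableAt ℝ w q.2) :
    cdir ((1, 0), 0) (fun q : ℝ × Cn n => w q.2) q = 0 := by
  have h1 : HasFDerivAt (fun q : ℝ × Cn n => w q.2)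
      ((fderiv ℝ w q.2).comp (ContinuousLinearMap.snd ℝ ℝ (Cn n))) q :=
    hw.hasFDerivAt.comp q hasFDerivAt_snd
  simp [cdir, h1.fderiv]

end Static

/-! ### Uniform bounds for the background geometry by compactness. -/

section Geometry

variable {n : ℕ} {X : Type*} [TopologicalSpace X] [ChartedSpace (Cn n) X]
variable [IsManifold 𝓘(ℂ, Cn n) ω X] (χ : HermitianMetric n X) (f : X → ℝ)

lemma metricMatrix_smooth {e : OpenPartialHomeomorph X (Cn n)} (he : e ∈ atlas (Cn n) X) :
    MSmoothOn (metricMatrix χ e) e.target := fun k j => χ.smooth e he k j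

lemma metricMatrix_det_ne_zero {e : OpenPartialHomeomorph X (Cn n)} (he : e ∈ atlas (Cn n) X)
    {z : Cn n} (hz : z ∈ e.target) : (metricMatrix χ e z).det ≠ 0 :=
  (metricMatrix_posDef χ he hz).det_pos.ne'

lemma metricMatrix_inv_smooth {e : OpenPartialHomeomorph X (Cn n)} (he : e ∈ atlas (Cn n) X) :
    MSmoothOn (fun z => (metricMatrix χ e z)⁻¹) e.target :=
  (metricMatrix_smooth χ he).inv fun _ hz => metricMatrix_det_ne_zero χ he hz

/-- The density `e^{-f} / det χ` in a chart. -/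
def chartDensity (e : OpenPartialHomeomorph X (Cn n)) (z : Cn n) : ℂ :=
  ((Real.exp (-f (e.symm z)) : ℝ) : ℂ) * ((metricMatrix χ e z).det)⁻¹

variable {f}

lemma chartDensity_ne_zero {e : OpenPartialHomeomorph X (Cn n)} (he : e ∈ atlas (Cn n) X)
    {z : Cn n} (hz : z ∈ e.target) : chartDensity χ f e z ≠ 0 :=
  mul_ne_zero (by exact_mod_cast (Real.exp_pos _).ne')
    (inv_ne_zero (metricMatrix_det_ne_zero χ he hz))

lemma chartDensity_smooth (hf : ContMDiff 𝓘(ℝ, Cn n) 𝓘(ℝ, ℝ) ∞ f)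
    {e : OpenPartialHomeomorph X (Cn n)} (he : e ∈ atlas (Cn n) X) :
    ContDiffOn ℝ ∞ (chartDensity χ f e) e.target :=
  (contDiffOn_ofReal (Real.contDiff_exp.comp_contDiffOn (contDiffOn_chart hf he).neg)).mul
    ((metricMatrix_smooth χ he).det.inv fun _ hz => metricMatrix_det_ne_zero χ he hz)

variable (f)

/-- The geometry of `χ` and `f` in the chart `e` at `z` is bounded by `K`. -/
structure GeometryBound (e : OpenPartialHomeomorph X (Cn n)) (z : Cn n) (K : ℝ) : Prop where
  one_le : 1 ≤ K
  metric : ∀ a b, ‖metricMatrix χ e z a b‖ ≤ K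
  inverse : ∀ a b, ‖(metricMatrix χ e z)⁻¹ a b‖ ≤ K
  first : ∀ c a b, ‖mdir (hol (stdVec c)) (metricMatrix χ e) z a b‖ ≤ K
  second : ∀ c d a b, ‖mdir (hol (stdVec c)) (mdir (cbar (hol (stdVec d))) (metricMatrix χ e))
    z a b‖ ≤ K
  second_inverse : ∀ c d a b, ‖mdir (hol (stdVec c)) (mdir (cbar (hol (stdVec d)))
    (fun z => (metricMatrix χ e z)⁻¹)) z a b‖ ≤ K
  density : ∀ c d, ‖logHessian (hol (stdVec c)) (cbar (hol (stdVec d))) (chartDensity χ f e) z‖ ≤ K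

lemma GeometryBound.mono {e : OpenPartialHomeomorph X (Cn n)} {z : Cn n} {K L : ℝ}
    (h : GeometryBound χ f e z K) (hKL : K ≤ L) : GeometryBound χ f e z L where
  one_le := h.one_le.trans hKL
  metric a b := (h.metric a b).trans hKL
  inverse a b := (h.inverse a b).trans hKL
  first c a b := (h.first c a b).trans hKL
  second c d a b := (h.second c d a b).trans hKL
  second_inverse c d a b := (h.second_inverse c d a b).trans hKL
  density c d := (h.density c d).trans hKL

lemma exists_eventually_norm_le {ι Y : Type*} [Fintype ι] [TopologicalSpace Y] {w : ι → Y → ℂ}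
    {y : Y} (h : ∀ i, ContinuousAt (w i) y) : ∃ K : ℝ, ∀ᶠ z in nhds y, ∀ i, ‖w i z‖ ≤ K := by
  have hc : ContinuousAt (fun z i => w i z) y := continuousAt_pi.2 h
  refine ⟨‖fun i => w i y‖ + 1, ?_⟩
  filter_upwards [hc.norm.eventually_lt_const (lt_add_one _)] with z hz i
  exact (norm_le_pi_norm (fun i => w i z) i).trans hz.le

variable {f}

lemma eventually_geometryBound (hf : ContMDiff 𝓘(ℝ, Cn n) 𝓘(ℝ, ℝ) ∞ f)
    {e : OpenPartialHomeomorph X (Cn n)} (he : e ∈ atlas (Cn n) X) {z : Cn n} (hz : z ∈ e.target) :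
    ∃ K, ∀ᶠ y in nhds z, GeometryBound χ f e y K := by
  have hO := e.open_target
  have hc : ∀ {w : Cn n → ℂ}, ContDiffOn ℝ ∞ w e.target → ContinuousAt w z := fun h =>
    h.continuousOn.continuousAt (hO.mem_nhds hz)
  have sA := metricMatrix_smooth χ he
  have sN := metricMatrix_inv_smooth χ he
  have sρ := chartDensity_smooth χ hf he
  obtain ⟨K1, h1⟩ := exists_eventually_norm_le
    (w := fun (i : Fin n × Fin n) y => metricMatrix χ e y i.1 i.2) (y := z)
    fun i => hc (sA i.1 i.2)
  obtain ⟨K2, h2⟩ := exists_eventually_norm_le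
    (w := fun (i : Fin n × Fin n) y => (metricMatrix χ e y)⁻¹ i.1 i.2) (y := z)
    fun i => hc (sN i.1 i.2)
  obtain ⟨K3, h3⟩ := exists_eventually_norm_le
    (w := fun (i : Fin n × Fin n × Fin n) y =>
      mdir (hol (stdVec i.1)) (metricMatrix χ e) y i.2.1 i.2.2) (y := z)
    fun i => hc (sA.mdir hO i.2.1 i.2.2)
  obtain ⟨K4, h4⟩ := exists_eventually_norm_le
    (w := fun (i : Fin n × Fin n × Fin n × Fin n) y => mdir (hol (stdVec i.1))
      (mdir (cbar (hol (stdVec i.2.1))) (metricMatrix χ e)) y i.2.2.1 i.2.2.2) (y := z)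
    fun i => hc ((sA.mdir hO).mdir hO i.2.2.1 i.2.2.2)
  obtain ⟨K5, h5⟩ := exists_eventually_norm_le
    (w := fun (i : Fin n × Fin n × Fin n × Fin n) y => mdir (hol (stdVec i.1))
      (mdir (cbar (hol (stdVec i.2.1))) (fun z => (metricMatrix χ e z)⁻¹)) y i.2.2.1 i.2.2.2)
    (y := z) fun i => hc ((sN.mdir hO).mdir hO i.2.2.1 i.2.2.2)
  obtain ⟨K6, h6⟩ := exists_eventually_norm_le
    (w := fun (i : Fin n × Fin n) y => logHessian (hol (stdVec i.1)) (cbar (hol (stdVec i.2)))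
      (chartDensity χ f e) y) (y := z)
    fun i => by
      have k0 := chartDensity_ne_zero χ he hz (f := f)
      exact ((hc (contDiffOn_cdir hO (contDiffOn_cdir hO sρ))).div (hc sρ) k0).sub
        (((hc (contDiffOn_cdir hO sρ)).mul (hc (contDiffOn_cdir hO sρ))).div ((hc sρ).pow 2)
          (pow_ne_zero 2 k0))
  refine ⟨max 1 (max K1 (max K2 (max K3 (max K4 (max K5 K6))))), ?_⟩
  filter_upwards [h1, h2, h3, h4, h5, h6] with y y1 y2 y3 y4 y5 y6
  constructor
  · exact le_max_left _ _
  · exact fun a b => (y1 (a, b)).trans (by simp)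
  · exact fun a b => (y2 (a, b)).trans (by simp)
  · exact fun c a b => (y3 (c, a, b)).trans (by simp)
  · exact fun c d a b => (y4 (c, d, a, b)).trans (by simp)
  · exact fun c d a b => (y5 (c, d, a, b)).trans (by simp)
  · exact fun c d => (y6 (c, d)).trans (by simp)

/-- On a compact manifold the geometry is uniformly bounded. -/
lemma exists_geometryBound [CompactSpace X] (hf : ContMDiff 𝓘(ℝ, Cn n) 𝓘(ℝ, ℝ) ∞ f) :
    ∃ K, ∀ x : X, ∃ e ∈ atlas (Cn n) X, x ∈ e.source ∧ GeometryBound χ f e (e x) K := by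
  have key : ∃ K, ∀ x ∈ (Set.univ : Set X),
      ∃ e ∈ atlas (Cn n) X, x ∈ e.source ∧ GeometryBound χ f e (e x) K := by
    refine isCompact_univ.induction_on (p := fun s => ∃ K, ∀ x ∈ s,
      ∃ e ∈ atlas (Cn n) X, x ∈ e.source ∧ GeometryBound χ f e (e x) K) ?_ ?_ ?_ ?_
    · exact ⟨0, fun x hx => hx.elim⟩
    · rintro s t hst ⟨K, hK⟩
      exact ⟨K, fun x hx => hK x (hst hx)⟩
    · rintro s t ⟨K, hK⟩ ⟨L, hL⟩
      refine ⟨max K L, ?_⟩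
      rintro x (hx | hx)
      · obtain ⟨e, h1, h2, h3⟩ := hK x hx
        exact ⟨e, h1, h2, h3.mono χ f (le_max_left _ _)⟩
      · obtain ⟨e, h1, h2, h3⟩ := hL x hx
        exact ⟨e, h1, h2, h3.mono χ f (le_max_right _ _)⟩
    · intro x _
      have he := chart_mem_atlas (Cn n) x
      have hx := mem_chart_source (Cn n) x
      obtain ⟨K, hK⟩ := eventually_geometryBound χ hf he ((chartAt (Cn n) x).map_source hx)
      have hev := ((chartAt (Cn n) x).continuousAt hx).eventually hK
      refine ⟨_, mem_nhdsWithin_of_mem_nhds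
        (Filter.inter_mem hev ((chartAt (Cn n) x).open_source.mem_nhds hx)), K, ?_⟩
      rintro y ⟨hy1, hy2⟩
      exact ⟨_, he, hy2, hy1⟩
  obtain ⟨K, hK⟩ := key
  exact ⟨K, fun x => hK x (Set.mem_univ x)⟩

end Geometry

/-! ### The time interval and its interior. -/

section TimeInterval

lemma convex_timeInterval (T : EReal) : Convex ℝ (timeInterval T) := by
  have : (timeInterval T).OrdConnected := ⟨fun a ha b hb c hc =>
    ⟨ha.1.trans hc.1, le_trans (EReal.coe_le_coe_iff.2 hc.2) hb.2⟩⟩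
  exact this.convex

/-- The open time interval `(0, T)`. -/
def openTime (T : EReal) : Set ℝ := {t : ℝ | 0 < t ∧ (t : EReal) < T}

lemma isOpen_openTime (T : EReal) : IsOpen (openTime T) :=
  (isOpen_lt continuous_const continuous_id).inter
    (isOpen_lt continuous_coe_real_ereal continuous_const)

lemma openTime_subset (T : EReal) : openTime T ⊆ timeInterval T := fun _ h => ⟨h.1.le, h.2.le⟩

lemma timeInterval_mem_nhds {T : EReal} {t : ℝ} (ht : t ∈ openTime T) : timeInterval T ∈ nhds t :=
  Filter.mem_of_superset ((isOpen_openTime T).mem_nhds ht) (openTime_subset T)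

lemma uniqueDiffOn_timeInterval {T : EReal} (hT : 0 < T) : UniqueDiffOn ℝ (timeInterval T) := by
  obtain ⟨r, h0, hr⟩ := EReal.lt_iff_exists_real_btwn.1 hT
  refine uniqueDiffOn_convex (convex_timeInterval T) ⟨r, ?_⟩
  rw [mem_interior_iff_mem_nhds]
  exact timeInterval_mem_nhds ⟨by exact_mod_cast h0, hr⟩

lemma zero_mem_timeInterval {T : EReal} (hT : 0 < T) : (0 : ℝ) ∈ timeInterval T :=
  ⟨le_rfl, by exact_mod_cast hT.le⟩

end TimeInterval

/-! ### Regularity and positivity of the evolving metric. -/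

section Solution

variable {n : ℕ} {X : Type*} [TopologicalSpace X] [ChartedSpace (Cn n) X]
variable [IsManifold 𝓘(ℂ, Cn n) ω X] {χ : HermitianMetric n X} {f : X → ℝ} {F : ℝ → ℝ}
  {u₀ : X → ℝ} {T : EReal} {u : ℝ → X → ℝ}
variable {e : OpenPartialHomeomorph X (Cn n)}

lemma hessianMatrix_isHermitian {v : X → ℝ} (hv : ContDiffOn ℝ ∞ (fun z => v (e.symm z)) e.target)
    {z : Cn n} (hz : z ∈ e.target) : (hessianMatrix v e z).IsHermitian := by
  refine Matrix.IsHermitian.ext fun i j => ?_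
  rw [hessianMatrix_apply, hessianMatrix_apply, Complex.star_def,
    ← cbar_cbar (ξ := hol (stdVec i)), ← cdir_conj,
    cdir_comm e.open_target (contDiffOn_ofReal hv) hz, cbar_cbar]
  refine cdir_congr (Filter.Eventually.of_forall fun y => ?_)
  simp only []
  rw [← cdir_cbar_real, cbar_cbar]

lemma metricMatrix_mul_chartH (he : e ∈ atlas (Cn n) X) {z : Cn n} (hz : z ∈ e.target)
    (v : X → ℝ) :
    metricMatrix χ e z * chartH χ v e z = metricMatrix χ e z + hessianMatrix v e z := by
  rw [chartH, Matrix.mul_add, Matrix.mul_one, ← Matrix.mul_assoc, Matrix.mul_nonsing_inv _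
    (isUnit_iff_ne_zero.2 (metricMatrix_det_ne_zero χ he hz)), Matrix.one_mul]

lemma chartH_eq (he : e ∈ atlas (Cn n) X) {z : Cn n} (hz : z ∈ e.target) (v : X → ℝ) :
    chartH χ v e z = (metricMatrix χ e z)⁻¹ * (metricMatrix χ e z + hessianMatrix v e z) := by
  rw [← metricMatrix_mul_chartH he hz, ← Matrix.mul_assoc, Matrix.nonsing_inv_mul _
    (isUnit_iff_ne_zero.2 (metricMatrix_det_ne_zero χ he hz)), Matrix.one_mul]

lemma hermitian_conj_det {A : Matrix (Fin n) (Fin n) ℂ} (hA : A.IsHermitian) :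
    ((A.det.re : ℝ) : ℂ) = A.det := by
  rw [← Complex.conj_eq_iff_re, ← Complex.star_def, ← Matrix.det_conjTranspose, hA.eq]

/-- Taking real parts loses nothing: h is χ⁻¹ times a Hermitian matrix, and both factors have real
determinant. -/
lemma detH_eq (he : e ∈ atlas (Cn n) X) {x : X} (hx : x ∈ e.source) {v : X → ℝ}
    (hv : ContDiffOn ℝ ∞ (fun z => v (e.symm z)) e.target) :
    ((detH χ v x : ℝ) : ℂ) = (chartH χ v e (e x)).det := by
  rw [detH, det_hMatrix χ he hx hv, chartH_eq he (e.map_source hx), Matrix.det_mul]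
  have h1 := metricMatrix_isHermitian χ e (e x)
  rw [← hermitian_conj_det h1.inv,
    ← hermitian_conj_det (h1.add (hessianMatrix_isHermitian hv (e.map_source hx))),
    ← Complex.ofReal_mul, Complex.ofReal_re]

lemma traceH_eq (he : e ∈ atlas (Cn n) X) {x : X} (hx : x ∈ e.source) {v : X → ℝ}
    (hv : ContDiffOn ℝ ∞ (fun z => v (e.symm z)) e.target) :
    ((traceH χ v x : ℝ) : ℂ) = (chartH χ v e (e x)).trace := by
  rw [traceH, trace_hMatrix χ he hx hv, ← Complex.conj_eq_iff_re, ← Complex.star_def,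
    ← Matrix.trace_conjTranspose, chartH_eq he (e.map_source hx), Matrix.conjTranspose_mul,
    (metricMatrix_isHermitian χ e (e x)).inv.eq,
    ((metricMatrix_isHermitian χ e (e x)).add
      (hessianMatrix_isHermitian hv (e.map_source hx))).eq, Matrix.trace_mul_comm]

namespace IsSolution

variable (h : IsSolution χ f F u₀ T u)

include h

lemma spacetime_smooth (he : e ∈ atlas (Cn n) X) :
    ContDiffOn ℝ ∞ (fun q : ℝ × Cn n => u q.1 (e.symm q.2)) (timeInterval T ×ˢ e.target) :=
  contDiffOn_spacetime_chart h.smooth he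

lemma slice_smooth (he : e ∈ atlas (Cn n) X) {t : ℝ} (ht : t ∈ timeInterval T) :
    ContDiffOn ℝ ∞ (fun z => u t (e.symm z)) e.target :=
  (h.spacetime_smooth he).comp (contDiff_prodMk_right t).contDiffOn fun _ hz => ⟨ht, hz⟩

lemma hessian_smooth (hT : 0 < T) (he : e ∈ atlas (Cn n) X) :
    MSmoothOn (fun q : ℝ × Cn n => hessianMatrix (u q.1) e q.2) (timeInterval T ×ˢ e.target) := by
  intro k j
  have h1 := contDiffOn_ofReal (h.spacetime_smooth he)
  have hI := uniqueDiffOn_timeInterval hT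
  have h2 := contDiffOn_cdir_slice hI e.open_target h1 (cbar (hol (stdVec k)))
  refine (contDiffOn_cdir_slice hI e.open_target h2 (hol (stdVec j))).congr fun q _ => ?_
  exact hessianMatrix_apply _ _ _ _ _

lemma chartH_smooth (hT : 0 < T) (he : e ∈ atlas (Cn n) X) :
    MSmoothOn (fun q : ℝ × Cn n => chartH χ (u q.1) e q.2) (timeInterval T ×ˢ e.target) := by
  have h1 : MSmoothOn (fun q : ℝ × Cn n => (metricMatrix χ e q.2)⁻¹)
      (timeInterval T ×ˢ e.target) := fun k j =>
    contDiffOn_comp_snd (metricMatrix_inv_smooth χ he k j) fun q hq => hq.2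
  exact (msmoothOn_const 1).add (h1.mul (h.hessian_smooth hT he))

lemma traceH_eq (he : e ∈ atlas (Cn n) X) {q : ℝ × Cn n} (hq : q ∈ timeInterval T ×ˢ e.target) :
    ((traceH χ (u q.1) (e.symm q.2) : ℝ) : ℂ) = (chartH χ (u q.1) e q.2).trace := by
  have := HermitianFlow.traceH_eq (χ := χ) he (e.map_target hq.2) (h.slice_smooth he hq.1)
  rwa [e.right_inv hq.2] at this

lemma detH_eq (he : e ∈ atlas (Cn n) X) {q : ℝ × Cn n} (hq : q ∈ timeInterval T ×ˢ e.target) :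
    ((detH χ (u q.1) (e.symm q.2) : ℝ) : ℂ) = (chartH χ (u q.1) e q.2).det := by
  have := HermitianFlow.detH_eq (χ := χ) he (e.map_target hq.2) (h.slice_smooth he hq.1)
  rwa [e.right_inv hq.2] at this

lemma continuousOn_of_charts {w : ℝ → X → ℝ}
    (hw : ∀ e ∈ atlas (Cn n) X, ContinuousOn (fun q : ℝ × Cn n => w q.1 (e.symm q.2))
      (timeInterval T ×ˢ e.target)) :
    ContinuousOn (fun p : ℝ × X => w p.1 p.2) (timeInterval T ×ˢ Set.univ) := by
  rintro ⟨t, x⟩ hp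
  have ht : t ∈ timeInterval T := hp.1
  have hx := mem_chart_source (Cn n) x
  set e := chartAt (Cn n) x
  have h1 := hw e (chart_mem_atlas _ _)
  have hopen : Prod.snd ⁻¹' e.source ∈ nhds ((t, x) : ℝ × X) :=
    (e.open_source.preimage continuous_snd).mem_nhds hx
  have h2 : ContinuousWithinAt (fun p : ℝ × X => (p.1, e p.2))
      ((timeInterval T ×ˢ Set.univ) ∩ Prod.snd ⁻¹' e.source) (t, x) :=
    (continuous_fst.continuousAt.prodMk ((e.continuousAt hx).comp (x := ((t, x) : ℝ × X))
      continuous_snd.continuousAt)).continuousWithinAt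
  have h3 := (h1.continuousWithinAt (Set.mk_mem_prod ht (e.map_source hx))).comp (x := ((t, x) : ℝ × X)) h2
    (show Set.MapsTo (fun p : ℝ × X => (p.1, e p.2))
      ((timeInterval T ×ˢ Set.univ) ∩ Prod.snd ⁻¹' e.source) (timeInterval T ×ˢ e.target) from
      fun p hp => ⟨hp.1.1, e.map_source hp.2⟩)
  rw [← continuousWithinAt_inter hopen]
  refine h3.congr (fun p hp => ?_) ?_
  · simp [e.left_inv hp.2]
  · simp [e.left_inv hx]

lemma continuousOn_traceH (hT : 0 < T) :
    ContinuousOn (fun p : ℝ × X => traceH χ (u p.1) p.2) (timeInterval T ×ˢ Set.univ) :=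
  h.continuousOn_of_charts (w := fun t => traceH χ (u t)) fun _ he =>
    (contDiffOn_of_ofReal_eq (h.chartH_smooth hT he).trace fun _ hq => h.traceH_eq he hq).continuousOn

lemma continuousOn_detH (hT : 0 < T) :
    ContinuousOn (fun p : ℝ × X => detH χ (u p.1) p.2) (timeInterval T ×ˢ Set.univ) :=
  h.continuousOn_of_charts (w := fun t => detH χ (u t)) fun _ he =>
    (contDiffOn_of_ofReal_eq (h.chartH_smooth hT he).det fun _ hq => h.detH_eq he hq).continuousOn

/-- The metric stays positive along the flow. -/
lemma posDef (hT : 0 < T) (hpos : IsPositive χ u₀) (he : e ∈ atlas (Cn n) X) {t : ℝ}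
    (ht : t ∈ timeInterval T) {z : Cn n} (hz : z ∈ e.target) :
    (metricMatrix χ e z + hessianMatrix (u t) e z).PosDef := by
  have hc : ContinuousOn (fun t => hessianMatrix (u t) e z) (timeInterval T) := by
    refine continuousOn_pi.2 fun k => continuousOn_pi.2 fun j => ?_
    have h1 : ContinuousOn (fun q : ℝ × Cn n => hessianMatrix (u q.1) e q.2 k j)
      (timeInterval T ×ˢ e.target) := (h.hessian_smooth hT he k j).continuousOn
    exact h1.comp (f := fun t : ℝ => (t, z)) (continuous_id.prodMk continuous_const).continuousOn
      fun s hs => ⟨hs, hz⟩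
  have hc' : ContinuousOn (fun t => metricMatrix χ e z + hessianMatrix (u t) e z)
    (timeInterval T) := continuousOn_const.add hc
  refine posDef_of_path (convex_timeInterval T).isPreconnected hc'
    (fun s hs => (metricMatrix_isHermitian χ e z).add
      (hessianMatrix_isHermitian (h.slice_smooth he hs) hz)) (fun s hs => ?_)
    (zero_mem_timeInterval hT) ?_ t ht
  · rw [← metricMatrix_mul_chartH he hz, Matrix.det_mul]
    refine mul_ne_zero (metricMatrix_det_ne_zero χ he hz) ?_
    rw [← h.detH_eq (q := (s, z)) he ⟨hs, hz⟩]
    exact_mod_cast (h.det_pos s hs _).ne'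
  · have h0 : u 0 = u₀ := funext h.initial
    have hv := h.slice_smooth he (zero_mem_timeInterval hT)
    have h1 := posDef_gMatrix_iff χ he (e.map_target hz) hv
    rw [e.right_inv hz] at h1
    rw [← h1, h0]
    exact hpos _

end IsSolution

end Solution

/-! ### Construction of the local model from a solution. -/

section ModelConstruction

variable {n : ℕ} {X : Type*} [TopologicalSpace X] [ChartedSpace (Cn n) X]
variable [IsManifold 𝓘(ℂ, Cn n) ω X] {χ : HermitianMetric n X} {f : X → ℝ} {F : ℝ → ℝ}
  {u₀ : X → ℝ} {T : EReal} {u : ℝ → X → ℝ}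
variable {e : OpenPartialHomeomorph X (Cn n)}

/-- The vector whose coordinates are a column of `P`. -/
def columnVec (P : Matrix (Fin n) (Fin n) ℂ) (j : Fin n) : Cn n := WithLp.toLp 2 fun a => P a j

lemma frameHessian_columnVec {O : Set (ℝ × Cn n)} (hO : IsOpen O) (hOe : ∀ q ∈ O, q.2 ∈ e.target)
    (hU : ContDiffOn ℝ ∞ (fun q : ℝ × Cn n => u q.1 (e.symm q.2)) O)
    (hs : ∀ q ∈ O, ContDiffOn ℝ ∞ (fun z => u q.1 (e.symm z)) e.target)
    (P : Matrix (Fin n) (Fin n) ℂ) {q : ℝ × Cn n} (hq : q ∈ O) :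
    frameHessian (fun j => spatial (hol (columnVec P j))) (fun q => u q.1 (e.symm q.2)) q
      = P.conjTranspose * hessianMatrix (u q.1) e q.2 * P := by
  ext k j
  have hUc := contDiffOn_ofReal hU
  have h1 : cdir (spatial (hol (columnVec P j))) (cdir (cbar (spatial (hol (columnVec P k))))
      fun q : ℝ × Cn n => ((u q.1 (e.symm q.2) : ℝ) : ℂ)) q
      = cdir (hol (columnVec P j)) (cdir (cbar (hol (columnVec P k)))
        fun z => ((u q.1 (e.symm z) : ℝ) : ℂ)) q.2 := by
    rw [cdir_spatial (differentiableAt_of_contDiffOn hO (contDiffOn_cdir hO hUc) hq)]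
    have hO2 : IsOpen {z : Cn n | (q.1, z) ∈ O} :=
      hO.preimage (continuous_const.prodMk continuous_id)
    refine cdir_congrOn hO2 (fun z hz => ?_) hq
    rw [cbar_spatial]
    exact cdir_spatial (differentiableAt_of_contDiffOn hO hUc hz) _
  simp only [frameHessian, Matrix.of_apply]
  rw [h1, cdir_hol_cdir_cbar_eq_sum e.open_target (contDiffOn_ofReal (hs q hq)) (hOe q hq)]
  simp only [Matrix.mul_apply, Matrix.conjTranspose_apply, Finset.sum_mul, Finset.mul_sum]
  rw [Finset.sum_comm]
  refine Finset.sum_congr rfl fun b _ => Finset.sum_congr rfl fun a _ => ?_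
  rw [hessianMatrix_apply, Complex.star_def]
  simp only [columnVec]
  ring

lemma mdir_comp_snd {O : Set (Cn n)} (hO : IsOpen O) {A : Cn n → Matrix (Fin n) (Fin n) ℂ}
    (hA : MSmoothOn A O) {q : ℝ × Cn n} (hq : q.2 ∈ O) (ξ : Cn n × Cn n) :
    mdir (spatial ξ) (fun q : ℝ × Cn n => A q.2) q = mdir ξ A q.2 := by
  ext i j
  exact cdir_snd (hA.diff hO hq i j) ξ

lemma mdir_mdir_comp_snd {O : Set (Cn n)} (hO : IsOpen O) {A : Cn n → Matrix (Fin n) (Fin n) ℂ}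
    (hA : MSmoothOn A O) {q : ℝ × Cn n} (hq : q.2 ∈ O) (ξ η : Cn n × Cn n) :
    mdir (spatial ξ) (mdir (spatial η) fun q : ℝ × Cn n => A q.2) q = mdir ξ (mdir η A) q.2 := by
  ext i j
  exact cdir_cdir_snd hO (hA i j) hq ξ η

lemma mdir_time_comp_snd {O : Set (Cn n)} (hO : IsOpen O) {A : Cn n → Matrix (Fin n) (Fin n) ℂ}
    (hA : MSmoothOn A O) {q : ℝ × Cn n} (hq : q.2 ∈ O) :
    mdir ((1, 0), 0) (fun q : ℝ × Cn n => A q.2) q = 0 := by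
  ext i j
  exact cdir_time_snd (hA.diff hO hq i j)

/-- The constant bounding the geometry in a normal frame. -/
def frameConstant (n : ℕ) (K : ℝ) : ℝ := ((n : ℝ) + 1) ^ 4 * K ^ 5

/-- The three products are n²K³, n³K⁴ and n⁴K⁵; the base n + 1 keeps the powers monotone also for n
= 0. -/
lemma frameConstant_bounds {K : ℝ} (hK : 1 ≤ K) :
    0 ≤ frameConstant n K ∧ n * (K * (n * (K * K))) ≤ frameConstant n K ∧
    n * (K * (n * (K * (n * (K * K))))) ≤ frameConstant n K ∧
    n * (K * (n * (K * (n * (K * (n * (K * K))))))) ≤ frameConstant n K := by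
  have hn : (0 : ℝ) ≤ n := Nat.cast_nonneg n
  have hK0 : 0 ≤ K := by linarith
  have key : ∀ i j : ℕ, i ≤ 4 → j ≤ 5 → (n : ℝ) ^ i * K ^ j ≤ frameConstant n K := by
    intro i j hi hj
    refine mul_le_mul ?_ (pow_le_pow_right₀ hK hj) (by positivity) (by positivity)
    calc (n : ℝ) ^ i ≤ ((n : ℝ) + 1) ^ i := by gcongr; linarith
      _ ≤ _ := pow_le_pow_right₀ (by linarith) hi
  refine ⟨by unfold frameConstant; positivity, ?_, ?_, ?_⟩
  · exact le_of_eq_of_le (by ring) (key 2 3 (by norm_num) (by norm_num))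
  · exact le_of_eq_of_le (by ring) (key 3 4 (by norm_num) (by norm_num))
  · exact le_of_eq_of_le (by ring) (key 4 5 (by norm_num) (by norm_num))

namespace IsSolution

variable (h : IsSolution χ f F u₀ T u)

include h

/-- Near every interior point of space-time, the flow has a local model in a normal frame, with
bounded geometry. -/
theorem exists_localModel (hT : 0 < T) (hpos : IsPositive χ u₀)
    (hf : ContMDiff 𝓘(ℝ, Cn n) 𝓘(ℝ, ℝ) ∞ f) (he : e ∈ atlas (Cn n) X) {x : X}
    (hx : x ∈ e.source) {t : ℝ} (ht : t ∈ openTime T) {O' : Set (ℝ × Cn n)} (hO' : IsOpen O')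
    (hp' : (t, e x) ∈ O') {K : ℝ} (hK : GeometryBound χ f e (e x) K) :
    ∃ (O : Set (ℝ × Cn n)) (M : LocalModel n F O (t, e x)), O ⊆ O' ∧ O ⊆ openTime T ×ˢ e.target ∧
      M.τ = (1, 0) ∧ (∀ j, (M.d j).1.1 = 0 ∧ (M.d j).2.1 = 0) ∧
      M.U = (fun q => u q.1 (e.symm q.2)) ∧
      M.e = (fun q => Real.exp (-f (e.symm q.2)) * detH χ (u q.1) (e.symm q.2)) ∧
      M.V = (fun q => F (M.e q)) ∧
      M.S = (fun q => traceH χ (u q.1) (e.symm q.2)) ∧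
      ∏ j, M.l j = detH χ (u t) x ∧
      (∀ r j k, ‖mdir (M.d r) M.χ (t, e x) j k‖ ≤ frameConstant n K) ∧
      (∀ r j, ‖mdir (M.d r) (mdir (cbar (M.d r)) M.χ) (t, e x) j j‖ ≤ frameConstant n K) ∧
      (∀ r j, ‖mdir (M.d r) (mdir (cbar (M.d r)) M.N) (t, e x) j j‖ ≤ frameConstant n K) ∧
      (∀ j, ‖cdir (M.d j) (cdir (cbar (M.d j)) M.ρ) (t, e x) / M.ρ (t, e x)
        - cdir (M.d j) M.ρ (t, e x) * cdir (cbar (M.d j)) M.ρ (t, e x) / M.ρ (t, e x) ^ 2‖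
          ≤ frameConstant n K) := by
  have hz : e x ∈ e.target := e.map_source hx
  have hA := metricMatrix_posDef χ he hz
  obtain ⟨P, l, hP, hPA, hPG, hl⟩ := exists_diagonalizing_frame hA
    (h.posDef hT hpos he (openTime_subset T ht) hz)
  set O : Set (ℝ × Cn n) := (openTime T ×ˢ e.target) ∩ O'
  have hOo : IsOpen O := ((isOpen_openTime T).prod e.open_target).inter hO'
  have hpO : (t, e x) ∈ O := ⟨⟨ht, hz⟩, hp'⟩
  have hOe : ∀ q ∈ O, q.2 ∈ e.target := fun q hq => hq.1.2
  have hOt : ∀ q ∈ O, q.1 ∈ timeInterval T := fun q hq => openTime_subset T hq.1.1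
  have hOI : O ⊆ timeInterval T ×ˢ e.target := fun q hq => ⟨hOt q hq, hOe q hq⟩
  have sA := metricMatrix_smooth χ he
  have sN := metricMatrix_inv_smooth χ he
  have sρ := chartDensity_smooth χ hf he
  have snd : ∀ {A : Cn n → Matrix (Fin n) (Fin n) ℂ}, MSmoothOn A e.target →
      MSmoothOn (fun q : ℝ × Cn n => A q.2) O := fun hA k j => contDiffOn_comp_snd (hA k j) hOe
  have sU : ContDiffOn ℝ ∞ (fun q : ℝ × Cn n => u q.1 (e.symm q.2)) O :=
    (h.spacetime_smooth he).mono hOI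
  have hess : ∀ q ∈ O, frameHessian (fun j => spatial (hol (columnVec P j)))
      (fun q => u q.1 (e.symm q.2)) q = P.conjTranspose * hessianMatrix (u q.1) e q.2 * P :=
    fun q hq => frameHessian_columnVec hOo hOe sU (fun q hq => h.slice_smooth he (hOt q hq)) P hq
  have hg : ∀ q ∈ O, P.conjTranspose * metricMatrix χ e q.2 * P
      + frameHessian (fun j => spatial (hol (columnVec P j))) (fun q => u q.1 (e.symm q.2)) q
      = P.conjTranspose * (metricMatrix χ e q.2 + hessianMatrix (u q.1) e q.2) * P :=
    fun q hq => by rw [hess q hq, Matrix.mul_add, Matrix.add_mul]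
  have hPH : IsUnit P.conjTranspose.det := by rw [Matrix.det_conjTranspose]; exact hP.star
  have hPi : P⁻¹.conjTranspose * P.conjTranspose = 1 := by
    rw [← Matrix.conjTranspose_mul, Matrix.mul_nonsing_inv _ hP, Matrix.conjTranspose_one]
  set c : ℂ := P.conjTranspose.det⁻¹ * P.det⁻¹ with hc
  have hc0 : c ≠ 0 := mul_ne_zero (inv_ne_zero hPH.ne_zero) (inv_ne_zero hP.ne_zero)
  let M : LocalModel n F O (t, e x) :=
    { d := fun j => spatial (hol (columnVec P j))
      τ := (1, 0)
      U := fun q => u q.1 (e.symm q.2)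
      V := fun q => F (Real.exp (-f (e.symm q.2)) * detH χ (u q.1) (e.symm q.2))
      e := fun q => Real.exp (-f (e.symm q.2)) * detH χ (u q.1) (e.symm q.2)
      S := fun q => traceH χ (u q.1) (e.symm q.2)
      χ := fun q => P.conjTranspose * metricMatrix χ e q.2 * P
      N := fun q => P⁻¹ * (metricMatrix χ e q.2)⁻¹ * P⁻¹.conjTranspose
      ρ := fun q => c * chartDensity χ f e q.2
      l := l
      isOpen := hOo
      mem := hpO
      smoothU := sU
      smoothχ := (snd sA).const_mul_mul_const _ _
      smoothN := (snd sN).const_mul_mul_const _ _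
      smoothρ := contDiffOn_const.mul (contDiffOn_comp_snd sρ hOe)
      herm := fun q _ => Matrix.isHermitian_conjTranspose_mul_mul P
        (metricMatrix_isHermitian χ e q.2)
      N_mul := fun q hq => by
        have hu := isUnit_iff_ne_zero.2 (metricMatrix_det_ne_zero χ he (hOe q hq))
        calc P⁻¹ * (metricMatrix χ e q.2)⁻¹ * P⁻¹.conjTranspose
              * (P.conjTranspose * metricMatrix χ e q.2 * P)
            = P⁻¹ * ((metricMatrix χ e q.2)⁻¹ * ((P⁻¹.conjTranspose * P.conjTranspose)
              * metricMatrix χ e q.2)) * P := by simp only [Matrix.mul_assoc]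
          _ = 1 := by
            rw [hPi, Matrix.one_mul, Matrix.nonsing_inv_mul _ hu, Matrix.mul_one,
              Matrix.nonsing_inv_mul _ hP]
      χ_p := hPA
      g_p := (hg _ hpO).trans hPG
      l_pos := hl
      e_pos := fun q hq => mul_pos (Real.exp_pos _) (h.det_pos _ (hOt q hq) _)
      e_eq := fun q hq => by
        have h1 := hPH.ne_zero
        have h2 := hP.ne_zero
        rw [hg q hq, Matrix.det_mul, Matrix.det_mul, chartDensity, Complex.ofReal_mul,
          h.detH_eq he (hOI hq), chartH_eq he (hOe q hq), Matrix.det_mul, Matrix.det_nonsing_inv,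
          Ring.inverse_eq_inv', hc]
        field_simp
      V_eq := fun q _ => rfl
      S_eq := fun q hq => by
        rw [hg q hq, h.traceH_eq he (hOI hq), chartH_eq he (hOe q hq)]
        have : P⁻¹ * (metricMatrix χ e q.2)⁻¹ * P⁻¹.conjTranspose
            * (P.conjTranspose * (metricMatrix χ e q.2 + hessianMatrix (u q.1) e q.2) * P)
            = P⁻¹ * ((metricMatrix χ e q.2)⁻¹ * ((P⁻¹.conjTranspose * P.conjTranspose)
              * (metricMatrix χ e q.2 + hessianMatrix (u q.1) e q.2))) * P := by
          simp only [Matrix.mul_assoc]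
        rw [this, hPi, Matrix.one_mul]
        conv_rhs => rw [Matrix.trace_mul_comm, ← Matrix.mul_assoc,
          Matrix.mul_nonsing_inv _ hP, Matrix.one_mul]
      -- Times in `openTime T` are interior, so the one-sided derivative of the equation is a
      -- genuine one.
      flow := fun q hq => by
        have h1 : HasFDerivAt (fun q : ℝ × Cn n => u q.1 (e.symm q.2)) _ (q.1, q.2) :=
          (differentiableAt_of_contDiffOn hOo sU hq).hasFDerivAt
        have h2 : HasDerivAt (fun s : ℝ => (s, q.2)) ((1 : ℝ), (0 : Cn n)) q.1 :=
          (hasDerivAt_id q.1).prodMk (hasDerivAt_const q.1 q.2)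
        have h3 := h1.comp_hasDerivAt q.1 h2
        have h4 := (h.flow q.1 (hOt q hq) (e.symm q.2)).hasDerivAt
          (timeInterval_mem_nhds hq.1.1)
        exact h3.unique h4
      static_χ := by
        rw [mdir_const_mul_mul_const hOo (snd sA) _ _ hpO,
          mdir_time_comp_snd e.open_target sA hz, Matrix.mul_zero, Matrix.zero_mul]
      static_N := by
        rw [mdir_const_mul_mul_const hOo (snd sN) _ _ hpO,
          mdir_time_comp_snd e.open_target sN hz, Matrix.mul_zero, Matrix.zero_mul]
      static_ρ := by
        rw [cdir_const_mul _ (differentiableAt_of_contDiffOn hOo (contDiffOn_comp_snd sρ hOe) hpO),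
          cdir_time_snd (differentiableAt_of_contDiffOn e.open_target sρ hz), mul_zero] }
  have hK1 := hK.one_le
  have hK0 : 0 ≤ K := by linarith
  obtain ⟨-, hC2, hC3, hC4⟩ := frameConstant_bounds (n := n) hK1
  have hu := isUnit_iff_ne_zero.2 (metricMatrix_det_ne_zero χ he hz)
  -- This identity and the next express χ⁻¹ and χ through P and P⁻¹, which bounds the frame by the
  -- geometry of χ alone.
  have hPP : (metricMatrix χ e (e x))⁻¹ = P * P.conjTranspose := by
    refine Matrix.inv_eq_left_inv ?_
    have : P * (P.conjTranspose * metricMatrix χ e (e x) * P) * P⁻¹ = 1 := by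
      rw [hPA, Matrix.mul_one, Matrix.mul_nonsing_inv _ hP]
    simpa only [Matrix.mul_assoc, Matrix.mul_nonsing_inv _ hP, Matrix.mul_one] using this
  have hRR : metricMatrix χ e (e x) = P⁻¹.conjTranspose * P⁻¹.conjTranspose.conjTranspose := by
    rw [Matrix.conjTranspose_conjTranspose]
    have : P⁻¹.conjTranspose * (P.conjTranspose * metricMatrix χ e (e x) * P) * P⁻¹
        = P⁻¹.conjTranspose * P⁻¹ := by rw [hPA, Matrix.mul_one]
    rw [← this]
    calc metricMatrix χ e (e x) = (P⁻¹.conjTranspose * P.conjTranspose) * metricMatrix χ e (e x)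
          * (P * P⁻¹) := by rw [hPi, Matrix.mul_nonsing_inv _ hP, Matrix.one_mul, Matrix.mul_one]
      _ = _ := by simp only [Matrix.mul_assoc]
  have nP : ∀ a j, ‖P a j‖ ≤ K := norm_entry_le hPP hK1 fun a => hK.inverse a a
  have nR : ∀ a j, ‖P⁻¹.conjTranspose a j‖ ≤ K := norm_entry_le hRR hK1 fun a => hK.metric a a
  have nPH : ∀ a j, ‖P.conjTranspose a j‖ ≤ K := fun a j => by
    rw [Matrix.conjTranspose_apply, norm_star]; exact nP j a
  have nI : ∀ a j, ‖P⁻¹ a j‖ ≤ K := fun a j => by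
    have := nR j a
    rwa [Matrix.conjTranspose_apply, norm_star] at this
  have nv : ∀ j a, ‖columnVec P j a‖ ≤ K := fun j a => nP a j
  refine ⟨O, M, fun q hq => hq.2, fun q hq => hq.1, rfl, fun j => ⟨rfl, rfl⟩, rfl, rfl, rfl, rfl,
    ?_, fun r j k => ?_, fun r j => ?_, fun r j => ?_, fun j => ?_⟩
  · have h1 := congrArg Matrix.det hPG
    have h2 := congrArg Matrix.det hPA
    have h3 := h.detH_eq (q := (t, e x)) he (hOI hpO)
    rw [Matrix.det_one] at h2
    rw [Matrix.det_diagonal] at h1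
    have h4 : ((∏ j, l j : ℝ) : ℂ) = ((detH χ (u t) x : ℝ) : ℂ) := by
      simp only [e.left_inv hx] at h3
      rw [h3, Complex.ofReal_prod, ← h1, ← metricMatrix_mul_chartH he hz]
      simp only [Matrix.det_mul] at h2 ⊢
      linear_combination (chartH χ (u t) e (e x)).det * h2
    exact_mod_cast h4
  · change ‖mdir (spatial (hol (columnVec P r))) (fun q : ℝ × Cn n =>
      P.conjTranspose * metricMatrix χ e q.2 * P) (t, e x) j k‖ ≤ _
    rw [mdir_const_mul_mul_const hOo (snd sA) _ _ hpO, mdir_comp_snd e.open_target sA hz]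
    exact (norm_mul_mul_le hK0 nPH nP
      (fun a b => norm_cdir_hol_le hK0 (nv r) fun c => hK.first c a b) j k).trans hC3
  · change ‖mdir (spatial (hol (columnVec P r))) (mdir (cbar (spatial (hol (columnVec P r))))
      fun q : ℝ × Cn n => P.conjTranspose * metricMatrix χ e q.2 * P) (t, e x) j j‖ ≤ _
    rw [cbar_spatial, mdir_mdir_const_mul_mul_const hOo (snd sA) _ _ hpO,
      mdir_mdir_comp_snd e.open_target sA hz]
    exact (norm_mul_mul_le hK0 nPH nP (fun a b => norm_cdir_hol_cdir_cbar_le e.open_target (sA a b)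
      hz hK0 (nv r) fun d c => hK.second c d a b) j j).trans hC4
  · change ‖mdir (spatial (hol (columnVec P r))) (mdir (cbar (spatial (hol (columnVec P r))))
      fun q : ℝ × Cn n => P⁻¹ * (metricMatrix χ e q.2)⁻¹ * P⁻¹.conjTranspose) (t, e x) j j‖ ≤ _
    rw [cbar_spatial, mdir_mdir_const_mul_mul_const hOo (snd sN) _ _ hpO,
      mdir_mdir_comp_snd e.open_target sN hz]
    exact (norm_mul_mul_le hK0 nI nR (fun a b => norm_cdir_hol_cdir_cbar_le e.open_target (sN a b)
      hz hK0 (nv r) fun d c => hK.second_inverse c d a b) j j).trans hC4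
  · change ‖cdir (spatial (hol (columnVec P j))) (cdir (cbar (spatial (hol (columnVec P j))))
      fun q : ℝ × Cn n => c * chartDensity χ f e q.2) (t, e x) / (c * chartDensity χ f e (e x))
      - cdir (spatial (hol (columnVec P j))) (fun q : ℝ × Cn n => c * chartDensity χ f e q.2)
          (t, e x)
        * cdir (cbar (spatial (hol (columnVec P j))))
          (fun q : ℝ × Cn n => c * chartDensity χ f e q.2) (t, e x)
        / (c * chartDensity χ f e (e x)) ^ 2‖ ≤ _
    have sρ' := contDiffOn_comp_snd sρ hOe
    have hd := fun q hq => differentiableAt_of_contDiffOn (p := q) hOo sρ' hq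
    have hdz := differentiableAt_of_contDiffOn e.open_target sρ hz
    rw [cbar_spatial, cdir_congrOn hOo (fun q hq => cdir_const_mul c (hd q hq)) hpO,
      cdir_const_mul c (differentiableAt_of_contDiffOn hOo (contDiffOn_cdir hOo sρ') hpO),
      cdir_const_mul c (hd _ hpO), cdir_const_mul c (hd _ hpO),
      cdir_cdir_snd e.open_target sρ hz, cdir_snd hdz, cdir_snd hdz]
    -- A logarithmic Hessian ignores constant factors, so the determinant of the frame needs no
    -- bound.
    have e1 : ∀ a b d r : ℂ, c * a / (c * r) - c * b * (c * d) / (c * r) ^ 2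
        = a / r - b * d / r ^ 2 := fun a b d r => by
      rw [mul_div_mul_left _ _ hc0, mul_pow, sq c, mul_mul_mul_comm,
        mul_div_mul_left _ _ (mul_ne_zero hc0 hc0)]
    rw [e1]
    exact (norm_logHessian_le e.open_target sρ hz hK0 (nv j) fun d c => hK.density c d).trans hC2

end IsSolution

end ModelConstruction

/-! ### Elementary real estimates. -/

section RealLemmas

/-- If `g` decreases at most at the rate `c` to the left of `t`, its derivative is at least `-c`. -/
lemma neg_le_deriv_of_left {g : ℝ → ℝ} {g' t c : ℝ} (hg : HasDerivAt g g' t) (ht : 0 < t)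
    (h : ∀ s, 0 < s → s < t → g s - g t ≤ c * (t - s)) : -c ≤ g' := by
  have h1 : Filter.Tendsto (slope g t) (nhdsWithin t (Set.Iio t)) (nhds g') :=
    (hasDerivAt_iff_tendsto_slope.1 hg).mono_left
      (nhdsWithin_mono _ fun s hs => ne_of_lt hs)
  refine ge_of_tendsto h1 ?_
  filter_upwards [Ioo_mem_nhdsLT ht] with s hs
  have h2 := h s hs.1 hs.2
  have h3 : 0 < t - s := sub_pos.2 hs.2
  rw [slope_def_field, ← neg_div_neg_eq, le_div_iff₀ (by linarith)]
  linarith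

/-- Each l_i is the full product times the n - 1 reciprocals of the other eigenvalues, each of which
is at most τ. -/
lemma sum_le_of_sum_inv_le {n : ℕ} {l : Fin n → ℝ} (hl : ∀ j, 0 < l j) {τ D : ℝ}
    (hτ : ∑ j, 1 / l j ≤ τ) (hD : ∏ j, l j ≤ D) : ∑ j, l j ≤ n * (D * τ ^ (n - 1)) := by
  have h1 : ∀ j, l j ≤ D * τ ^ (n - 1) := fun i => by
    have hle : ∀ j, 1 / l j ≤ τ := fun j =>
      (Finset.single_le_sum (f := fun j => 1 / l j) (fun k _ => (one_div_pos.2 (hl k)).le)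
        (Finset.mem_univ j)).trans hτ
    have hp : ∏ j ∈ Finset.univ.erase i, 1 / l j ≤ τ ^ (n - 1) := by
      refine (Finset.prod_le_prod (fun k _ => (one_div_pos.2 (hl k)).le) fun k _ => hle k).trans ?_
      simp
    have hi : l i = (∏ j, l j) * ∏ j ∈ Finset.univ.erase i, 1 / l j := by
      rw [← Finset.mul_prod_erase _ _ (Finset.mem_univ i), mul_assoc, ← Finset.prod_mul_distrib,
        Finset.prod_eq_one fun k _ => mul_one_div_cancel (hl k).ne', mul_one]
    rw [hi]
    have h0 : 0 ≤ ∏ j, l j := Finset.prod_nonneg fun k _ => (hl k).le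
    exact mul_le_mul hD hp (Finset.prod_nonneg fun k _ => (one_div_pos.2 (hl k)).le) (h0.trans hD)
  refine (Finset.sum_le_sum fun j _ => h1 j).trans ?_
  simp

lemma abs_potentialTerm_sub_le {A c a b : ℝ} (hA : 0 ≤ A) (ha : c ≤ a) (hb : c ≤ b) :
    |potentialTerm A c a - potentialTerm A c b| ≤ (A + 1) * |a - b| := by
  have h1 : 0 < a - c + 1 := by linarith
  have h2 : 0 < b - c + 1 := by linarith
  have e : potentialTerm A c a - potentialTerm A c b
      = -((A + 1 / ((a - c + 1) * (b - c + 1))) * (a - b)) := by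
    unfold potentialTerm; field_simp; ring
  rw [e, abs_neg, abs_mul, abs_of_nonneg (by positivity)]
  gcongr
  rw [div_le_one (by positivity)]
  nlinarith

/-- Compactness of [a, b] inside (0,∞). The lower bound for F'(s) s comes from an upper bound for
its reciprocal. -/
lemma exists_speed_bounds {F : ℝ → ℝ} (hF : ContDiffOn ℝ ∞ F (Set.Ioi 0))
    (hF' : ∀ s, 0 < s → 0 < deriv F s) {a : ℝ} (ha : 0 < a) (b : ℝ) :
    ∃ K β Ψ : ℝ, 0 ≤ K ∧ 0 < β ∧ 0 ≤ Ψ ∧ ∀ s, a ≤ s → s ≤ b →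
      |F s| ≤ K ∧ β ≤ deriv F s * s ∧
        |(deriv (deriv F) s + deriv F s / s) / deriv F s ^ 2| ≤ Ψ := by
  have hsub : Set.Icc a b ⊆ Set.Ioi 0 := fun s hs => ha.trans_le hs.1
  have d1 : ContDiffOn ℝ ∞ (deriv F) (Set.Ioi 0) := hF.deriv_of_isOpen isOpen_Ioi (by simp)
  have d2 : ContDiffOn ℝ ∞ (deriv (deriv F)) (Set.Ioi 0) := d1.deriv_of_isOpen isOpen_Ioi (by simp)
  have c0 := hF.continuousOn.mono hsub
  have c1 := d1.continuousOn.mono hsub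
  have c2 := d2.continuousOn.mono hsub
  have n0 : ∀ s ∈ Set.Icc a b, s ≠ 0 := fun s hs => ne_of_gt (hsub hs)
  have n1 : ∀ s ∈ Set.Icc a b, deriv F s ≠ 0 := fun s hs => ne_of_gt (hF' s (hsub hs))
  obtain ⟨K, hK⟩ := isCompact_Icc.exists_bound_of_continuousOn c0
  obtain ⟨R, hR⟩ := isCompact_Icc.exists_bound_of_continuousOn
    ((c1.mul continuousOn_id).inv₀ fun s hs => mul_ne_zero (n1 s hs) (n0 s hs))
  obtain ⟨Ψ, hΨ⟩ := isCompact_Icc.exists_bound_of_continuousOn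
    ((c2.add (c1.div continuousOn_id n0)).div (c1.pow 2) fun s hs => pow_ne_zero 2 (n1 s hs))
  refine ⟨|K|, 1 / (|R| + 1), |Ψ|, abs_nonneg _, by positivity, abs_nonneg _,
    fun s h1 h2 => ⟨(hK s ⟨h1, h2⟩).trans (le_abs_self _), ?_, (hΨ s ⟨h1, h2⟩).trans (le_abs_self _)⟩⟩
  have h3 : ‖(deriv F s * s)⁻¹‖ ≤ R := hR s ⟨h1, h2⟩
  have h4 : 0 < deriv F s * s := mul_pos (hF' s (ha.trans_le h1)) (ha.trans_le h1)
  rw [norm_inv, Real.norm_of_nonneg h4.le] at h3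
  rw [one_div]
  refine inv_le_of_inv_le₀ h4 (h3.trans ?_)
  linarith [le_abs_self R]

end RealLemmas

/-! ### Maximum principle for the speed, and Lipschitz control in time. -/

section Global

-- If the real volume is 0, which includes infinite measure, then 1/0 = 0 and both averages vanish.
-- So neither finiteness nor positivity of the volume has to be established.
open MeasureTheory in
lemma abs_average_sub_le {X : Type*} [TopologicalSpace X] [CompactSpace X] [MeasurableSpace X]
    [BorelSpace X] (μ : Measure X) {v w : X → ℝ} (hv : Continuous v) (hw : Continuous w) {c : ℝ}
    (hc : 0 ≤ c) (h : ∀ x, |v x - w x| ≤ c) :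
    |1 / μ.real Set.univ * (∫ y, v y ∂μ) - 1 / μ.real Set.univ * ∫ y, w y ∂μ| ≤ c := by
  rcases eq_or_ne (μ.real Set.univ) 0 with h0 | h0
  · simpa [h0] using hc
  · have hμ : IsFiniteMeasure μ := by
      refine ⟨lt_top_iff_ne_top.2 fun ht => h0 ?_⟩
      rw [Measure.real, ht, ENNReal.toReal_top]
    have hint : ∀ {v : X → ℝ}, Continuous v → Integrable v μ := fun hv =>
      hv.integrable_of_hasCompactSupport (HasCompactSupport.of_compactSpace _)
    rw [← mul_sub, ← integral_sub (hint hv) (hint hw), abs_mul, abs_of_nonneg (by positivity)]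
    have h1 := norm_integral_le_of_norm_le_const (μ := μ) (f := fun y => v y - w y) (C := c)
      (Filter.Eventually.of_forall h)
    rw [Real.norm_eq_abs] at h1
    have h2 : 0 < μ.real Set.univ := lt_of_le_of_ne measureReal_nonneg (Ne.symm h0)
    rw [one_div, inv_mul_le_iff₀ h2]
    linarith

variable {n : ℕ} {X : Type*} [TopologicalSpace X] [ChartedSpace (Cn n) X]
variable [IsManifold 𝓘(ℂ, Cn n) ω X] {χ : HermitianMetric n X} {f : X → ℝ} {F : ℝ → ℝ}
  {u₀ : X → ℝ} {T : EReal} {u : ℝ → X → ℝ}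

/-- The inverse chart takes values in X even off the target, so a global spatial maximum gives the
inequality for every s. -/
lemma isLocalMax_line {e : OpenPartialHomeomorph X (Cn n)} {x : X} (hx : x ∈ e.source)
    {W : ℝ → X → ℝ} {t : ℝ} (hmax : ∀ y, W t y ≤ W t x) {a : ℝ × Cn n} (ha : a.1 = 0) :
    IsLocalMax (fun s : ℝ => W ((t, e x) + s • a).1 (e.symm ((t, e x) + s • a).2)) 0 :=
  Filter.Eventually.of_forall fun s => by
    simpa [ha, e.left_inv hx] using hmax (e.symm (e x + s • a.2))

lemma hasDerivAt_time {w : ℝ × Cn n → ℝ} {t : ℝ} {z : Cn n} (hw : DifferentiableAt ℝ w (t, z)) :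
    HasDerivAt (fun s => w (s, z)) (fderiv ℝ w (t, z) (1, 0)) t :=
  hw.hasFDerivAt.comp_hasDerivAt t ((hasDerivAt_id t).prodMk (hasDerivAt_const t z))

lemma Icc_subset_timeInterval {t : ℝ} (ht : (t : EReal) ≤ T) : Set.Icc 0 t ⊆ timeInterval T :=
  fun _ hs => ⟨hs.1, (EReal.coe_le_coe_iff.2 hs.2).trans ht⟩

/-- An inequality on `[0, T)` extends to `[0, T]`. -/
lemma le_of_forall_lt (hT : 0 < T) {g : ℝ → ℝ} (hg : ContinuousOn g (timeInterval T)) {c : ℝ}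
    (h : ∀ t : ℝ, 0 ≤ t → (t : EReal) < T → g t ≤ c) {t : ℝ} (ht : t ∈ timeInterval T) : g t ≤ c := by
  rcases ht.2.lt_or_eq with h1 | h1
  · exact h t ht.1 h1
  · have h0 : 0 < t := by rw [← h1] at hT; exact_mod_cast hT
    have hs : Set.Ioo 0 t ⊆ timeInterval T := fun s hs =>
      Icc_subset_timeInterval ht.2 ⟨hs.1.le, hs.2.le⟩
    refine ContinuousWithinAt.closure_le (s := Set.Ioo 0 t) ?_ ((hg t ht).mono hs)
      continuousWithinAt_const fun s hs => h s hs.1.le (lt_of_lt_of_le ?_ ht.2)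
    · rw [closure_Ioo h0.ne]; exact Set.right_mem_Icc.2 h0.le
    · exact EReal.coe_lt_coe_iff.2 hs.2

/-- In a frame diagonalizing both forms the trace is the sum of the positive eigenvalues; this makes
log Tr h meaningful. -/
lemma trace_pos_of_posDef [NeZero n] {A G : Matrix (Fin n) (Fin n) ℂ} (hA : A.PosDef)
    (hG : G.PosDef) : 0 < (A⁻¹ * G).trace.re := by
  obtain ⟨P, l, hP, hPA, hPG, hl⟩ := exists_diagonalizing_frame hA hG
  have h1 : A⁻¹ = P * P.conjTranspose := by
    refine Matrix.inv_eq_left_inv ?_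
    have h2 := mul_eq_one_comm.1 hPA
    simpa only [Matrix.mul_assoc] using h2
  rw [h1, Matrix.mul_assoc, Matrix.trace_mul_comm, hPG, Matrix.trace_diagonal, ← Complex.ofReal_sum,
    Complex.ofReal_re]
  exact Finset.sum_pos (fun j _ => hl j) Finset.univ_nonempty

namespace IsSolution

variable (h : IsSolution χ f F u₀ T u)

include h

lemma continuousOn : ContinuousOn (fun p : ℝ × X => u p.1 p.2) (timeInterval T ×ˢ Set.univ) :=
  h.smooth.continuousOn

lemma continuous_slice {t : ℝ} (ht : t ∈ timeInterval T) : Continuous (u t) :=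
  h.continuousOn.comp_continuous (f := fun x : X => (t, x)) (by fun_prop) fun x => ⟨ht, trivial⟩

lemma traceH_pos [NeZero n] (hT : 0 < T) (hpos : IsPositive χ u₀) {t : ℝ} (ht : t ∈ timeInterval T)
    (x : X) : 0 < traceH χ (u t) x := by
  have he := chart_mem_atlas (Cn n) x
  have hx := mem_chart_source (Cn n) x
  have hz := (chartAt (Cn n) x).map_source hx
  have h1 := HermitianFlow.traceH_eq (χ := χ) he hx (h.slice_smooth he ht)
  have h2 := trace_pos_of_posDef (metricMatrix_posDef χ he hz) (h.posDef hT hpos he ht hz)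
  rwa [← chartH_eq he hz, ← h1, Complex.ofReal_re] at h2

lemma continuousOn_arg (hT : 0 < T) (hf : Continuous f) :
    ContinuousOn (fun p : ℝ × X => Real.exp (-f p.2) * detH χ (u p.1) p.2)
      (timeInterval T ×ˢ Set.univ) :=
  (Continuous.continuousOn (by fun_prop)).mul (h.continuousOn_detH hT)

lemma arg_pos {t : ℝ} (ht : t ∈ timeInterval T) (x : X) :
    0 < Real.exp (-f x) * detH χ (u t) x := mul_pos (Real.exp_pos _) (h.det_pos t ht x)

lemma continuousOn_speed (hT : 0 < T) (hf : Continuous f) (hF : ContDiffOn ℝ ∞ F (Set.Ioi 0)) :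
    ContinuousOn (fun p : ℝ × X => F (Real.exp (-f p.2) * detH χ (u p.1) p.2))
      (timeInterval T ×ˢ Set.univ) :=
  hF.continuousOn.comp (h.continuousOn_arg hT hf) fun p hp => h.arg_pos hp.1 p.2

/-- The maximum principle for the speed of the flow. -/
lemma speed_le [CompactSpace X] (hT : 0 < T) (hpos : IsPositive χ u₀)
    (hf : ContMDiff 𝓘(ℝ, Cn n) 𝓘(ℝ, ℝ) ∞ f) (hF : ContDiffOn ℝ ∞ F (Set.Ioi 0))
    (hF' : ∀ s, 0 < s → 0 < deriv F s) (σ : ℝ) {m : ℝ}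
    (hm : ∀ x, σ * F (Real.exp (-f x) * detH χ u₀ x) ≤ m) {t : ℝ} (ht : t ∈ timeInterval T) (x : X) :
    σ * F (Real.exp (-f x) * detH χ (u t) x) ≤ m := by
  have hcont := h.continuousOn_speed hT hf.continuous hF
  have hσ : ContinuousOn (fun s => σ * F (Real.exp (-f x) * detH χ (u s) x)) (timeInterval T) :=
    continuousOn_const.mul (hcont.comp (f := fun s : ℝ => (s, x)) (by fun_prop)
      fun s hs => ⟨hs, trivial⟩)
  refine le_of_forall_lt hT hσ (fun t ht0 htT => ?_) ht
  by_contra! hlt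
  set V : ℝ → X → ℝ := fun s y => σ * F (Real.exp (-f y) * detH χ (u s) y)
  change m < V t x at hlt
  -- Subtracting ε times the time keeps the value at (t, x) above m, so the maximum is not at time
  -- 0. There the time derivative of V is at least ε, yet at most 0 by the linearized equation.
  obtain ⟨ε, hε, hεt⟩ : ∃ ε > 0, ε * t < V t x - m := by
    refine ⟨(V t x - m) / (t + 1), div_pos (sub_pos.2 hlt) (by linarith), ?_⟩
    rw [div_mul_eq_mul_div, div_lt_iff₀ (by linarith)]
    nlinarith
  have hsub : Set.Icc 0 t ×ˢ (Set.univ : Set X) ⊆ timeInterval T ×ˢ Set.univ :=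
    Set.prod_mono_left (Icc_subset_timeInterval htT.le)
  have hW : ContinuousOn (fun p : ℝ × X => V p.1 p.2 - ε * p.1) (Set.Icc 0 t ×ˢ Set.univ) :=
    ((continuousOn_const.mul hcont).mono hsub).sub (by fun_prop)
  obtain ⟨⟨s, y⟩, ⟨hs, -⟩, hmax⟩ := (isCompact_Icc.prod isCompact_univ).exists_isMaxOn
    ⟨(t, x), Set.right_mem_Icc.2 ht0, Set.mem_univ _⟩ hW
  have hmax' : ∀ r z, r ∈ Set.Icc 0 t → V r z - ε * r ≤ V s y - ε * s := fun r z hr =>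
    hmax (Set.mk_mem_prod hr (Set.mem_univ z))
  have hs0 : 0 < s := by
    refine lt_of_le_of_ne hs.1 fun h0 => ?_
    have h1 := hmax' t x (Set.right_mem_Icc.2 ht0)
    have h2 := hm y
    rw [← h0] at h1
    have h3 : V 0 y = σ * F (Real.exp (-f y) * detH χ u₀ y) := by
      simp only [V, show u 0 = u₀ from funext h.initial]
    linarith
  have hsT : s ∈ openTime T := ⟨hs0, lt_of_le_of_lt (EReal.coe_le_coe_iff.2 hs.2) htT⟩
  obtain ⟨K, hK⟩ := exists_geometryBound χ hf
  obtain ⟨e, he, hy, hg⟩ := hK y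
  obtain ⟨O, M, -, -, hMτ, hMd, -, hMe, hMV, -⟩ :=
    h.exists_localModel hT hpos hf he hy hsT isOpen_univ (Set.mem_univ _) hg
  have hMV' : ∀ q, σ * M.V q = V q.1 (e.symm q.2) := fun q => by simp only [hMV, hMe, V]
  have hspace : ∀ z, V s z ≤ V s y := fun z => by linarith [hmax' s z hs]
  have h1 := M.time_derivative_nonpos hF hF' σ
    (fun j => by
      simp only [hMV']
      exact isLocalMax_line hy hspace (hMd j).1)
    (fun j => by
      simp only [hMV']
      exact isLocalMax_line hy hspace (hMd j).2)
  have h2 := (hasDerivAt_time (differentiableAt_of_contDiffOn M.isOpen (M.smooth_V hF)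
    M.mem)).const_mul σ
  rw [hMτ] at h1
  have h3 := neg_le_deriv_of_left (c := -ε) h2 hs0 fun r hr0 hrs => by
    rw [hMV', hMV']
    have := hmax' r y ⟨hr0.le, hrs.le.trans hs.2⟩
    simp only [e.left_inv hy]
    linarith
  linarith

/-- The argument of `F` in the flow equation stays within its initial range. -/
lemma arg_mem_Icc [CompactSpace X] (hT : 0 < T) (hpos : IsPositive χ u₀)
    (hf : ContMDiff 𝓘(ℝ, Cn n) 𝓘(ℝ, ℝ) ∞ f) (hF : ContDiffOn ℝ ∞ F (Set.Ioi 0))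
    (hF' : ∀ s, 0 < s → 0 < deriv F s) {a b : ℝ} (ha : 0 < a)
    (hab : ∀ x, Real.exp (-f x) * detH χ u₀ x ∈ Set.Icc a b) {t : ℝ} (ht : t ∈ timeInterval T)
    (x : X) : Real.exp (-f x) * detH χ (u t) x ∈ Set.Icc a b := by
  have hmono : StrictMonoOn F (Set.Ioi 0) := by
    refine strictMonoOn_of_deriv_pos (convex_Ioi 0) hF.continuousOn fun s hs => hF' s ?_
    rwa [interior_Ioi] at hs
  have hb : 0 < b := ha.trans_le ((hab x).1.trans (hab x).2)
  have hE := h.arg_pos ht x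
  have hmem : ∀ y, Real.exp (-f y) * detH χ u₀ y ∈ Set.Ioi (0 : ℝ) := fun y => ha.trans_le (hab y).1
  constructor
  -- The sign σ = -1 turns the maximum principle into the minimum principle.
  · have h1 := h.speed_le hT hpos hf hF hF' (-1) (m := -1 * F a)
      (fun y => mul_le_mul_of_nonpos_left (hmono.monotoneOn ha (hmem y) (hab y).1) (by norm_num))
      ht x
    exact (hmono.le_iff_le ha hE).1 (by linarith)
  · have h1 := h.speed_le hT hpos hf hF hF' 1 (m := 1 * F b)
      (fun y => mul_le_mul_of_nonneg_left (hmono.monotoneOn (hmem y) hb (hab y).2) (by norm_num))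
      ht x
    exact (hmono.le_iff_le hE hb).1 (by linarith)

variable {K : ℝ}

lemma abs_sub_le (hK : ∀ t ∈ timeInterval T, ∀ x, |F (Real.exp (-f x) * detH χ (u t) x)| ≤ K)
    {s t : ℝ} (hs : s ∈ timeInterval T) (ht : t ∈ timeInterval T) (x : X) :
    |u t x - u s x| ≤ K * |t - s| :=
  (convex_timeInterval T).norm_image_sub_le_of_norm_hasDerivWithin_le
    (fun r hr => h.flow r hr x) (fun r hr => hK r hr x) hs ht

variable [MeasurableSpace X] [BorelSpace X] [CompactSpace X]

lemma abs_average_sub_le (hK0 : 0 ≤ K)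
    (hK : ∀ t ∈ timeInterval T, ∀ x, |F (Real.exp (-f x) * detH χ (u t) x)| ≤ K)
    {s t : ℝ} (hs : s ∈ timeInterval T) (ht : t ∈ timeInterval T) :
    |1 / (volumeMeasure χ).real Set.univ * (∫ y, u t y ∂(volumeMeasure χ))
      - 1 / (volumeMeasure χ).real Set.univ * ∫ y, u s y ∂(volumeMeasure χ)| ≤ K * |t - s| :=
  HermitianFlow.abs_average_sub_le _ (h.continuous_slice ht) (h.continuous_slice hs)
    (by positivity) fun x => h.abs_sub_le hK hs ht x

lemma abs_normalized_sub_le (hK0 : 0 ≤ K)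
    (hK : ∀ t ∈ timeInterval T, ∀ x, |F (Real.exp (-f x) * detH χ (u t) x)| ≤ K)
    {s t : ℝ} (hs : s ∈ timeInterval T) (ht : t ∈ timeInterval T) (x : X) :
    |normalized χ (u t) x - normalized χ (u s) x| ≤ 2 * K * |t - s| := by
  have h1 := h.abs_sub_le hK hs ht x
  have h2 := h.abs_average_sub_le hK0 hK hs ht
  simp only [normalized]
  rw [abs_le] at h1 h2 ⊢
  constructor <;> linarith [h1.1, h1.2, h2.1, h2.2]

lemma continuousOn_normalized (hK0 : 0 ≤ K)
    (hK : ∀ t ∈ timeInterval T, ∀ x, |F (Real.exp (-f x) * detH χ (u t) x)| ≤ K) :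
    ContinuousOn (fun p : ℝ × X => normalized χ (u p.1) p.2) (timeInterval T ×ˢ Set.univ) := by
  have h1 : ContinuousOn (fun t => 1 / (volumeMeasure χ).real Set.univ
      * ∫ y, u t y ∂(volumeMeasure χ)) (timeInterval T) := by
    refine LipschitzOnWith.continuousOn (K := K.toNNReal) (LipschitzOnWith.of_dist_le_mul ?_)
    intro t ht s hs
    rw [Real.dist_eq, Real.dist_eq, Real.coe_toNNReal _ hK0]
    exact h.abs_average_sub_le hK0 hK hs ht
  exact h.continuousOn.sub (h1.comp continuousOn_fst fun p hp => hp.1)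

lemma bddBelow_normalizedValues (hT : 0 < T) (hT' : T ≠ ⊤) (hK0 : 0 ≤ K)
    (hK : ∀ t ∈ timeInterval T, ∀ x, |F (Real.exp (-f x) * detH χ (u t) x)| ≤ K) :
    BddBelow (normalizedValues χ T u) := by
  have hc : IsCompact (timeInterval T) := by
    have : timeInterval T = Set.Icc 0 T.toReal := by
      ext t
      rw [← EReal.coe_toReal hT' (ne_bot_of_gt hT), timeInterval]
      simp
    rw [this]; exact isCompact_Icc
  refine ((hc.prod isCompact_univ).bddBelow_image (h.continuousOn_normalized hK0 hK)).mono ?_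
  rintro r ⟨t, ht, x, rfl⟩
  exact ⟨(t, x), ⟨ht, trivial⟩, rfl⟩

end IsSolution

end Global

/-! ### The trace estimate. -/

section Estimate

variable {n : ℕ} {X : Type*} [TopologicalSpace X] [ChartedSpace (Cn n) X]
variable [IsManifold 𝓘(ℂ, Cn n) ω X] {χ : HermitianMetric n X} {f : X → ℝ} {F : ℝ → ℝ}
  {u₀ : X → ℝ}

/-- Continuity of the initial trace and determinant, and positivity of the latter, are read off from
any solution at time 0. The bounds involve only u₀, hence serve all solutions; if there is none, the
claim is vacuous. -/
lemma exists_initial_bounds [CompactSpace X] (χ : HermitianMetric n X) (hf : Continuous f)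
    (F : ℝ → ℝ) (u₀ : X → ℝ) : ∃ a b s : ℝ, 0 < a ∧ 1 ≤ s ∧
      ∀ (T : EReal) (u : ℝ → X → ℝ), 0 < T → IsSolution χ f F u₀ T u → ∀ x,
        Real.exp (-f x) * detH χ u₀ x ∈ Set.Icc a b ∧ traceH χ u₀ x ≤ s := by
  by_cases hex : ∃ (T : EReal) (u : ℝ → X → ℝ), 0 < T ∧ IsSolution χ f F u₀ T u
  · obtain ⟨T, u, hT, h⟩ := hex
    have h0 : u 0 = u₀ := funext h.initial
    have ht := zero_mem_timeInterval hT
    have cE : Continuous fun x => Real.exp (-f x) * detH χ (u 0) x :=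
      (h.continuousOn_arg hT hf).comp_continuous (f := fun x : X => ((0 : ℝ), x)) (by fun_prop)
        fun x => ⟨ht, trivial⟩
    have cS : Continuous fun x => traceH χ (u 0) x :=
      (h.continuousOn_traceH hT).comp_continuous (f := fun x : X => ((0 : ℝ), x)) (by fun_prop)
        fun x => ⟨ht, trivial⟩
    have pE := h.arg_pos ht
    rw [h0] at cE cS pE
    obtain ⟨R, hR⟩ := isCompact_univ.exists_bound_of_continuousOn
      (cE.inv₀ fun x => (pE x).ne').continuousOn
    obtain ⟨b, hb⟩ := isCompact_univ.exists_bound_of_continuousOn cE.continuousOn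
    obtain ⟨s, hs⟩ := isCompact_univ.exists_bound_of_continuousOn cS.continuousOn
    refine ⟨(|R| + 1)⁻¹, b, max s 1, by positivity, le_max_right _ _, fun _ _ _ _ x =>
      ⟨⟨inv_le_of_inv_le₀ (pE x) ?_, (le_abs_self _).trans (hb x trivial)⟩,
        ((le_abs_self _).trans (hs x trivial)).trans (le_max_left _ _)⟩⟩
    have h1 : (Real.exp (-f x) * detH χ u₀ x)⁻¹ ≤ R := (le_abs_self _).trans (hR x trivial)
    linarith [le_abs_self R]
  · exact ⟨1, 1, 1, one_pos, le_rfl, fun T u hT h => (hex ⟨T, u, hT, h⟩).elim⟩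

variable {T : EReal} {u : ℝ → X → ℝ}

/-- The trace of the evolving metric is bounded at a positive time at which the test function
attains its maximum, unless it is controlled by the potential. -/
lemma IsSolution.traceH_le_of_isMax (h : IsSolution χ f F u₀ T u) [NeZero n] (hT : 0 < T)
    (hpos : IsPositive χ u₀) (hf : ContMDiff 𝓘(ℝ, Cn n) 𝓘(ℝ, ℝ) ∞ f)
    (hF : ContDiffOn ℝ ∞ F (Set.Ioi 0)) (hF' : ∀ s, 0 < s → 0 < deriv F s)
    {κ C a b D K A B Ψ β : ℝ} (hκ : ∀ x : X, ∃ e ∈ atlas (Cn n) X, x ∈ e.source ∧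
      GeometryBound χ f e (e x) κ) (hC : C = frameConstant n κ) (hK : 0 ≤ K) (hβ : 0 < β)
    (hbounds : ∀ s, a ≤ s → s ≤ b → |F s| ≤ K ∧ β ≤ deriv F s * s ∧
        |(deriv (deriv F) s + deriv F s / s) / deriv F s ^ 2| ≤ Ψ)
    (hE : ∀ t ∈ timeInterval T, ∀ x, Real.exp (-f x) * detH χ (u t) x ∈ Set.Icc a b)
    (hD : ∀ x, b * Real.exp (f x) ≤ D)
    (hB : B = Ψ / β + 1)
    (hA : A = 2 * n * C + C + n * C ^ 2 + 4 * n ^ 2 * C ^ 2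
      + (2 * (n * C) ^ 2 + (2 * (n * C) * B * K) ^ 2) + 1)
    {φ : ℝ → X → ℝ} {w : ℝ → ℝ} (hφ : ∀ t x, φ t x = u t x - w t) {m : ℝ}
    (hm : ∀ t ∈ timeInterval T, ∀ x, m ≤ φ t x)
    (hw : ∀ s ∈ timeInterval T, ∀ t ∈ timeInterval T, ∀ x,
      |φ t x - φ s x| ≤ 2 * K * |t - s|)
    {t : ℝ} (ht : t ∈ openTime T) {x : X}
    (hmax : ∀ s y, 0 ≤ s → s ≤ t →
      Real.log (traceH χ (u s) y) + potentialTerm A m (φ s y)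
        + B / 2 * F (Real.exp (-f y) * detH χ (u s) y) ^ 2
      ≤ Real.log (traceH χ (u t) x) + potentialTerm A m (φ t x)
        + B / 2 * F (Real.exp (-f x) * detH χ (u t) x) ^ 2)
    (hS : 1 ≤ traceH χ (u t) x)
    (hSr : (A + 1) ^ 2 * (φ t x - m + 1) ^ 3 ≤ traceH χ (u t) x ^ 2) :
    traceH χ (u t) x
      ≤ n * (D * (n * C + (A + 1) * n + 2 * K * (A + 1) / β) ^ (n - 1)) := by
  obtain ⟨e, he, hx, hg⟩ := hκ x
  have hz := e.map_source hx
  have htI := openTime_subset T ht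
  have hC0 : 0 ≤ C := hC ▸ (frameConstant_bounds hg.one_le).1
  have hΨ0 : 0 ≤ Ψ := (abs_nonneg _).trans
    (hbounds _ (hE t htI x).1 (hE t htI x).2).2.2
  have hA0 : 0 ≤ A := by rw [hA]; positivity
  have cU : ContinuousOn (fun q : ℝ × Cn n => u q.1 (e.symm q.2)) (openTime T ×ˢ e.target) :=
    (h.spacetime_smooth he).continuousOn.mono (Set.prod_mono_left (openTime_subset T))
  -- The neighbourhood is shrunk to where u > m + w t - 1, which keeps the potential term off its
  -- pole.
  obtain ⟨O, M, hOO', hO, hMτ, hMd, hMU, hMe, hMV, hMS, hMl, hχ, hχ', hN, hρ⟩ :=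
    h.exists_localModel hT hpos hf he hx ht
      (cU.isOpen_inter_preimage ((isOpen_openTime T).prod e.open_target)
        (isOpen_Ioi (a := m + w t - 1)))
      ⟨⟨ht, hz⟩, by
        have := hm t htI x
        rw [hφ] at this
        simp only [Set.mem_preimage, Set.mem_Ioi, e.left_inv hx]
        linarith⟩ hg
  rw [← hC] at hχ hχ' hN hρ
  have hMe' : ∀ q, M.e q = Real.exp (-f (e.symm q.2)) * detH χ (u q.1) (e.symm q.2) :=
    fun q => by rw [hMe]
  have hMV' : ∀ q, M.V q = F (Real.exp (-f (e.symm q.2)) * detH χ (u q.1) (e.symm q.2)) :=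
    fun q => by rw [hMV, hMe]
  have hMS' : ∀ q, M.S q = traceH χ (u q.1) (e.symm q.2) := fun q => by rw [hMS]
  have hMU' : ∀ q, M.U q = u q.1 (e.symm q.2) := fun q => by rw [hMU]
  -- The average is frozen at the time of the maximum. Since only spatial directions are tested, φ
  -- may be replaced by u with a shifted constant.
  have hShift : ∀ y, potentialTerm A (m + w t) (u t y) = potentialTerm A m (φ t y) :=
    fun y => by
      unfold potentialTerm
      rw [hφ, show u t y - (m + w t) = u t y - w t - m by ring]
  have hline : ∀ v : ℝ × Cn n, (∃ j, v = (M.d j).1 ∨ v = (M.d j).2) →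
      IsLocalMax (fun s : ℝ => Real.log (M.S ((t, e x) + s • v))
        + potentialTerm A (m + w t) (M.U ((t, e x) + s • v))
        + B / 2 * M.V ((t, e x) + s • v) ^ 2) 0 := by
    intro v hv
    have hv0 : v.1 = 0 := by
      obtain ⟨j, rfl | rfl⟩ := hv
      exacts [(hMd j).1, (hMd j).2]
    simp only [hMS', hMU', hMV']
    refine isLocalMax_line (W := fun s y => Real.log (traceH χ (u s) y)
      + potentialTerm A (m + w t) (u s y)
      + B / 2 * F (Real.exp (-f y) * detH χ (u s) y) ^ 2) hx (fun y => ?_) hv0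
    simp only [hShift]
    exact hmax t y htI.1 le_rfl
  have hSpos : ∀ q ∈ O, 0 < M.S q := fun q hq => by
    rw [hMS']
    exact h.traceH_pos hT hpos (openTime_subset T (hO hq).1) _
  -- Backward difference quotients in time: the potential term has Lipschitz constant A + 1 and φ
  -- has 2K, so neither φ nor the average is differentiated.
  have htime : -(2 * K * (A + 1)) ≤
      fderiv ℝ (fun q => Real.log (M.S q) + B / 2 * M.V q ^ 2) (t, e x) M.τ := by
    have hd : DifferentiableAt ℝ (fun q => Real.log (M.S q) + B / 2 * M.V q ^ 2) (t, e x) :=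
      ((differentiableAt_of_contDiffOn M.isOpen M.smooth_S M.mem).log (hSpos _ M.mem).ne').add
        (((differentiableAt_of_contDiffOn M.isOpen (M.smooth_V hF) M.mem).pow 2).const_mul _)
    rw [hMτ]
    refine neg_le_deriv_of_left (hasDerivAt_time hd) ht.1 fun s hs0 hst => ?_
    have hsI : s ∈ timeInterval T := Icc_subset_timeInterval ht.2.le ⟨hs0.le, hst.le⟩
    simp only [hMS', hMV', e.left_inv hx]
    have h1 := hmax s x hs0.le hst.le
    have h2 := abs_potentialTerm_sub_le hA0 (hm t htI x) (hm s hsI x)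
    have h3 := mul_le_mul_of_nonneg_left (hw s hsI t htI x) (by linarith : 0 ≤ A + 1)
    rw [abs_of_pos (sub_pos.2 hst)] at h3
    have h4 := (le_abs_self _).trans (h2.trans h3)
    linarith
  have hp : M.S (t, e x) = traceH χ (u t) x := by rw [hMS', e.left_inv hx]
  have hpe : M.e (t, e x) = Real.exp (-f x) * detH χ (u t) x := by rw [hMe', e.left_inv hx]
  have hpU : M.U (t, e x) = u t x := by rw [hMU', e.left_inv hx]
  have hb := hbounds _ (hE t htI x).1 (hE t htI x).2
  have hτ := M.inverse_trace_le (c := m + w t) hF hF' hC0 hK hβ hχ hχ' hN hρ (by rw [hpe]; exact hb.2.2)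
    (by rw [hpe]; exact hb.2.1) (by rw [hMV', e.left_inv hx]; exact hb.1) hB hA hSpos
    (fun q hq => by
      have : m + w t - 1 < u q.1 (e.symm q.2) := (hOO' hq).2
      rw [hMU']; linarith)
    (by rw [hpU]; linarith [hm t htI x, hφ t x]) (by rw [hp]; exact hS)
    (by
      rw [hp, hpU, show u t x - (m + w t) + 1 = φ t x - m + 1 by rw [hφ]; ring]
      exact hSr) hline htime
  have hdet : ∏ j, M.l j ≤ D := by
    rw [hMl]
    refine le_trans ?_ (hD x)
    have h1 := mul_le_mul_of_nonneg_right (hE t htI x).2 (Real.exp_pos (f x)).le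
    rwa [mul_right_comm, ← Real.exp_add, neg_add_cancel, Real.exp_zero, one_mul] at h1
  rw [← hp, M.S_p]
  exact sum_le_of_sum_inv_le M.l_pos hτ hdet

/-- Either `S` is small, or it is controlled by the potential `r`. -/
lemma log_le_of_sq_lt {A r S : ℝ} (hA : 1 ≤ A) (hr : 0 ≤ r) (hS : 0 < S)
    (h : S ^ 2 < (A + 1) ^ 2 * (r + 1) ^ 3) : Real.log S ≤ Real.log (A + 1) + 1 + r := by
  have h1 := Real.log_le_log (by positivity) h.le
  rw [Real.log_mul (by positivity) (by positivity), Real.log_pow, Real.log_pow, Real.log_pow] at h1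
  -- Halving the argument brings the slope of the bound for (3/2) log (r + 1) down to 3/4; the plain
  -- inequality log (r + 1) ≤ r would give 3/2 > 1.
  have h2 := Real.log_le_sub_one_of_pos (show 0 < (r + 1) / 2 by linarith)
  rw [Real.log_div (by linarith) (by norm_num)] at h2
  have h3 := Real.log_two_lt_d9
  push_cast at h1
  linarith

/-- All constants are fixed before T and u appear. B depends only on the bounds for F, A on B and
the geometry, and C on these and the initial data. -/
theorem exists_trace_bound [CompactSpace X] [MeasurableSpace X] [BorelSpace X]
    (χ : HermitianMetric n X) (hf : ContMDiff 𝓘(ℝ, Cn n) 𝓘(ℝ, ℝ) ∞ f)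
    (hF : ContDiffOn ℝ ∞ F (Set.Ioi 0)) (hF' : ∀ s : ℝ, 0 < s → 0 < deriv F s)
    (hpos : IsPositive χ u₀) :
    ∃ C : ℝ, 0 < C ∧ ∀ (T : EReal), 0 < T → ∀ u : ℝ → X → ℝ, IsSolution χ f F u₀ T u →
      (T ≠ ⊤ → BddBelow (normalizedValues χ T u)) ∧
      ∀ m : ℝ, IsGLB (normalizedValues χ T u) m → ∀ t ∈ timeInterval T, ∀ x : X,
        traceH χ (u t) x ≤ C * Real.exp (C * (normalized χ (u t) x - m)) := by
  obtain ⟨κ, hκ⟩ := exists_geometryBound χ hf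
  obtain ⟨a, b, s₀, ha, hs₀, hinit⟩ := exists_initial_bounds χ hf.continuous F u₀
  obtain ⟨K, β, Ψ, hK, hβ, hΨ, hbounds⟩ := exists_speed_bounds hF hF' ha b
  obtain ⟨D, hD⟩ := isCompact_univ.exists_bound_of_continuousOn (f := fun x => b * Real.exp (f x))
    (continuous_const.mul (Real.continuous_exp.comp hf.continuous)).continuousOn
  have hD' : ∀ x, b * Real.exp (f x) ≤ D := fun x => (le_abs_self _).trans (hD x trivial)
  -- If X is empty, κ is unconstrained; the maximum with 0 keeps the constant nonnegative, and it
  -- equals `frameConstant n κ` as soon as X has a point.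
  obtain ⟨C₀, hC₀⟩ : ∃ C₀, C₀ = max 0 (frameConstant n κ) := ⟨_, rfl⟩
  have hC₀0 : 0 ≤ C₀ := hC₀ ▸ le_max_left _ _
  obtain ⟨B, hB⟩ : ∃ B, B = Ψ / β + 1 := ⟨_, rfl⟩
  obtain ⟨A, hA⟩ : ∃ A, A = 2 * n * C₀ + C₀ + n * C₀ ^ 2 + 4 * n ^ 2 * C₀ ^ 2
      + (2 * (n * C₀) ^ 2 + (2 * (n * C₀) * B * K) ^ 2) + 1 := ⟨_, rfl⟩
  have hA1 : 1 ≤ A := by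
    rw [hA]; exact le_add_of_nonneg_left (by positivity)
  have hB0 : 0 ≤ B := by rw [hB]; positivity
  obtain ⟨S₁, hS₁1, hS₁⟩ : ∃ S₁ : ℝ, 1 ≤ S₁ ∧
      n * (D * (n * C₀ + (A + 1) * n + 2 * K * (A + 1) / β) ^ (n - 1)) ≤ S₁ :=
    ⟨max 1 _, le_max_left _ _, le_max_right _ _⟩
  -- The three logarithms cover the cases at the maximum; the 2 is one unit from `suff` and one from
  -- the reciprocal in the potential term.
  obtain ⟨L, hL⟩ : ∃ L, L = Real.log s₀ + Real.log (A + 1) + Real.log S₁ + 2 + B / 2 * K ^ 2 :=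
    ⟨_, rfl⟩
  have l1 := Real.log_nonneg hs₀
  have l2 := Real.log_nonneg (by linarith : 1 ≤ A + 1)
  have l3 := Real.log_nonneg hS₁1
  obtain ⟨C, hCL, hCA⟩ : ∃ C, Real.exp L ≤ C ∧ A ≤ C := ⟨_, le_max_left _ _, le_max_right _ _⟩
  have hC0 : 0 < C := (Real.exp_pos L).trans_le hCL
  refine ⟨C, hC0, fun T hT u h => ?_⟩
  have hE : ∀ t ∈ timeInterval T, ∀ x, Real.exp (-f x) * detH χ (u t) x ∈ Set.Icc a b :=
    fun t ht x => h.arg_mem_Icc hT hpos hf hF hF' ha (fun y => (hinit T u hT h y).1) ht x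
  have hV : ∀ t ∈ timeInterval T, ∀ x, |F (Real.exp (-f x) * detH χ (u t) x)| ≤ K :=
    fun t ht x => (hbounds _ (hE t ht x).1 (hE t ht x).2).1
  refine ⟨fun hT' => h.bddBelow_normalizedValues hT hT' hK hV, fun m hm t ht x => ?_⟩
  have hmφ : ∀ t ∈ timeInterval T, ∀ x, m ≤ normalized χ (u t) x := fun t ht x =>
    hm.1 ⟨t, ht, x, rfl⟩
  -- In dimension 0 the trace is 0 and its logarithm is useless, so this case is treated apart.
  rcases Nat.eq_zero_or_pos n with hn | hn
  · subst hn
    rw [traceH, Matrix.trace, Finset.univ_eq_empty, Finset.sum_empty, Complex.zero_re]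
    exact mul_nonneg hC0.le (Real.exp_pos _).le
  have : NeZero n := ⟨hn.ne'⟩
  have hS := fun t ht => h.traceH_pos hT hpos (t := t) ht
  have cS := h.continuousOn_traceH hT
  have cφ := h.continuousOn_normalized hK hV
  have cV := h.continuousOn_speed hT hf.continuous hF
  set G : ℝ × X → ℝ := fun p => Real.log (traceH χ (u p.1) p.2)
    + potentialTerm A m (normalized χ (u p.1) p.2)
    + B / 2 * F (Real.exp (-f p.2) * detH χ (u p.1) p.2) ^ 2 with hG
  have cG : ContinuousOn G (timeInterval T ×ˢ Set.univ) :=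
    ((cS.log fun p hp => (hS p.1 hp.1 p.2).ne').add
      ((contDiffOn_potentialTerm A m).continuousOn.comp cφ fun p hp => by
        have := hmφ p.1 hp.1 p.2
        change 0 < normalized χ (u p.1) p.2 - m + 1; linarith)).add (continuousOn_const.mul (cV.pow 2))
  have bV : ∀ t ∈ timeInterval T, ∀ x,
      B / 2 * F (Real.exp (-f x) * detH χ (u t) x) ^ 2 ≤ B / 2 * K ^ 2 := fun t ht x =>
    mul_le_mul_of_nonneg_left (sq_le_sq' (abs_le.1 (hV t ht x)).1 (abs_le.1 (hV t ht x)).2)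
      (by linarith)
  have bP : ∀ t ∈ timeInterval T, ∀ x, potentialTerm A m (normalized χ (u t) x)
      ≤ -(normalized χ (u t) x - m) + 1 := fun t ht x => by
    have h1 := sub_nonneg.2 (hmφ t ht x)
    have h2 : 1 / (normalized χ (u t) x - m + 1) ≤ 1 := by
      rw [div_le_one (by linarith)]; linarith
    unfold potentialTerm
    nlinarith
  -- Working on [0, t] with t < T makes the domain compact and puts any positive maximum time inside
  -- the open time interval.
  have key : ∀ t : ℝ, 0 ≤ t → (t : EReal) < T → ∀ x, G (t, x) ≤ L := by
    intro t ht0 htT x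
    have hsub := Icc_subset_timeInterval htT.le
    obtain ⟨⟨s, y⟩, ⟨hs, -⟩, hmax⟩ := (isCompact_Icc.prod isCompact_univ).exists_isMaxOn
      ⟨(t, x), Set.right_mem_Icc.2 ht0, Set.mem_univ _⟩ (cG.mono (Set.prod_mono_left hsub))
    refine le_trans (hmax (Set.mk_mem_prod (Set.right_mem_Icc.2 ht0) (Set.mem_univ x))) ?_
    have hsI := hsub hs
    have hmax' : ∀ r z, 0 ≤ r → r ≤ s → G (r, z) ≤ G (s, y) := fun r z hr0 hrs =>
      isMaxOn_iff.1 hmax (r, z) ⟨⟨hr0, hrs.trans hs.2⟩, Set.mem_univ z⟩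
    simp only [hG] at hmax'
    have h1 := bV s hsI y
    have h2 := bP s hsI y
    have h3 := hmφ s hsI y
    -- A bound growing like φ - m with slope 1 is enough, since by `bP` the potential term takes
    -- that slope back.
    have suff : Real.log (traceH χ (u s) y)
        ≤ Real.log s₀ + Real.log (A + 1) + Real.log S₁ + 1 + (normalized χ (u s) y - m) := by
      rcases hs.1.eq_or_lt with h0 | h0
      · have h4 := Real.log_le_log (hS s hsI y) (show traceH χ (u s) y ≤ s₀ by
          rw [show s = 0 from h0.symm, show u 0 = u₀ from funext h.initial]
          exact (hinit T u hT h y).2)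
        linarith
      rcases lt_or_ge (traceH χ (u s) y) 1 with h4 | h4
      · have h5 := Real.log_nonpos (hS s hsI y).le h4.le
        linarith
      rcases lt_or_ge (traceH χ (u s) y ^ 2)
        ((A + 1) ^ 2 * (normalized χ (u s) y - m + 1) ^ 3) with h5 | h5
      · have h6 := log_le_of_sq_lt hA1 (sub_nonneg.2 h3) (hS s hsI y) h5
        linarith
      · have hκ1 : C₀ = frameConstant n κ := by
          obtain ⟨e, -, -, hg⟩ := hκ y
          exact hC₀.trans (max_eq_right (frameConstant_bounds hg.one_le).1)
        have h6 := h.traceH_le_of_isMax hT hpos hf hF hF' hκ hκ1 hK hβ hbounds hE hD' hB hA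
          (φ := fun t => normalized χ (u t))
          (w := fun t => 1 / (volumeMeasure χ).real Set.univ * ∫ y, u t y ∂(volumeMeasure χ))
          (fun _ _ => rfl) hmφ (fun s hs t ht x => h.abs_normalized_sub_le hK hV hs ht x)
          (t := s) ⟨h0, lt_of_le_of_lt (EReal.coe_le_coe_iff.2 hs.2) htT⟩ (x := y)
          hmax' h4 h5
        have h7 := Real.log_le_log (hS s hsI y) (h6.trans hS₁)
        linarith
    simp only [hG, hL]
    linarith
  -- The reciprocal and the squared speed are nonnegative, so G ≤ L yields log Tr h ≤ L + A (φ - m);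
  -- a single C dominates both e^L and A.
  have final : ∀ t : ℝ, 0 ≤ t → (t : EReal) < T → traceH χ (u t) x
      - C * Real.exp (C * (normalized χ (u t) x - m)) ≤ 0 := by
    intro t ht0 htT
    have htI : t ∈ timeInterval T := ⟨ht0, htT.le⟩
    have h1 := key t ht0 htT x
    have h2 := sub_nonneg.2 (hmφ t htI x)
    have h3 : -A * (normalized χ (u t) x - m) ≤ potentialTerm A m (normalized χ (u t) x) :=
      le_add_of_nonneg_right (by positivity)
    have h4 : 0 ≤ B / 2 * F (Real.exp (-f x) * detH χ (u t) x) ^ 2 := by positivity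
    simp only [hG] at h1
    have h5 : Real.log (traceH χ (u t) x) ≤ L + A * (normalized χ (u t) x - m) := by linarith
    have h6 := (Real.log_le_iff_le_exp (hS t htI x)).1 h5
    rw [Real.exp_add] at h6
    refine sub_nonpos.2 (h6.trans ?_)
    gcongr
  have cf : ContinuousOn (fun t => traceH χ (u t) x
      - C * Real.exp (C * (normalized χ (u t) x - m)))
      (timeInterval T) := by
    have c1 : ContinuousOn (fun t : ℝ => (t, x)) (timeInterval T) := by fun_prop
    have m1 : Set.MapsTo (fun t : ℝ => (t, x)) (timeInterval T) (timeInterval T ×ˢ Set.univ) :=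
      fun s hs => ⟨hs, trivial⟩
    have c2 : ContinuousOn (fun t => traceH χ (u t) x) (timeInterval T) :=
      ContinuousOn.comp (g := fun p : ℝ × X => traceH χ (u p.1) p.2) (f := fun t => (t, x))
        cS c1 m1
    have c3 : ContinuousOn (fun t => normalized χ (u t) x) (timeInterval T) :=
      ContinuousOn.comp (g := fun p : ℝ × X => normalized χ (u p.1) p.2) (f := fun t => (t, x))
        cφ c1 m1
    exact c2.sub (continuousOn_const.mul
      (continuousOn_const.mul (c3.sub continuousOn_const)).rexp)
  exact sub_nonpos.1 (le_of_forall_lt hT cf final ht)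

end Estimate

end HermitianFlow

end

theorem theorem2 (n : ℕ) (X : Type*) [TopologicalSpace X] [CompactSpace X] [T2Space X]
    [ChartedSpace (HermitianFlow.Cn n) X] [IsManifold 𝓘(ℂ, HermitianFlow.Cn n) ω X]
    [MeasurableSpace X] [BorelSpace X]
    (χ : HermitianFlow.HermitianMetric n X)
    (f : X → ℝ) (hf : ContMDiff 𝓘(ℝ, HermitianFlow.Cn n) 𝓘(ℝ, ℝ) ∞ f)
    (F : ℝ → ℝ) (hF : ContDiffOn ℝ ∞ F (Set.Ioi 0)) (hF' : ∀ s : ℝ, 0 < s → 0 < deriv F s)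
    (u₀ : X → ℝ) (hu₀ : ContMDiff 𝓘(ℝ, HermitianFlow.Cn n) 𝓘(ℝ, ℝ) ∞ u₀)
    (hpos : HermitianFlow.IsPositive χ u₀) :
    ∃ C : ℝ, 0 < C ∧ ∀ (T : EReal), 0 < T → ∀ u : ℝ → X → ℝ,
      HermitianFlow.IsSolution χ f F u₀ T u →
        (T ≠ ⊤ → BddBelow (HermitianFlow.normalizedValues χ T u)) ∧
        ∀ m : ℝ, IsGLB (HermitianFlow.normalizedValues χ T u) m →
          ∀ t ∈ HermitianFlow.timeInterval T, ∀ x : X,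
            HermitianFlow.traceH χ (u t) x
              ≤ C * Real.exp (C * (HermitianFlow.normalized χ (u t) x - m)) :=
  HermitianFlow.exists_trace_bound χ hf hF hF' hpos
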